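/- Conventions. For a finite quiver with node set $I$, dimension vector $(v_a)_{a\in I}$ and parameters $\lambda\in\mathbb C^I$, put $W_a=\mathbb C^{v_a}$ and $W=\bigoplus_{e}\mathrm{Hom}(W_{t(e)},W_{h(e)})\oplus\mathrm{Hom}(W_{h(e)},W_{t(e)})$, with elements $(\varphi_e,\varphi_{e^*})_e$ and the symplectic structure of $\bigoplus_e T^*\mathrm{Hom}(W_{t(e)},W_{h(e)})$ given by the trace pairing. The quiver variety is the complex symplectic quotient $N(\lambda)=\mu^{-1}(\lambda)/\prod_a GL(W_a)$, where $\mu_a=\sum_{h(e)=a}\varphi_e\varphi_{e^*}-\sum_{t(e)=a}\varphi_{e^*}\varphi_e$ and $\lambda$ stands for the tuple of scalar matrices $\lambda_a\,\mathrm{Id}$. Quotients are affine GIT quotients: points whose orbit closures meet are identified, the regular functions are the invariant restrictions of polynomials, and they carry the reduced Poisson bracket, computed from invariant polynomial lifts. Let $(\mathcal Q,\delta)$ be a star-shaped quiver with $m\ge 3$ legs, each with at least one node, all arrows pointing towards the centre, and with positive dimensions. Let $N-1$ be the dimension of the central node and $n_i$ the dimension of the node of the $i$th leg adjacent to it. Suppose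 $(\mathcal Q,\delta)$ is almost affine: the dimensions strictly decrease going from the centre down each leg, the last leg (centre included) has dimensions $N-1,N-2,\dots,2,1$, and $\sum_{i=1}^m n_i=2(N-1)$. Let $(\mathcal Q^+,\Delta)$ be the incremented quiver: the $m$th leg is lengthened by one node, and all dimensions on this leg, including the central one, are increased by $1$; so the last leg of $\mathcal Q^+$ (centre included) has dimensions $N,N-1,\dots,1$, and $\sum_{i=1}^{m-1}n_i=N$. Let $\lambda$ be parameters for $\mathcal Q^+$ with $\lambda\cdot\Delta=0$. Let $\lambda_0$ be the central parameter and $\lambda_{ij}$, $d_{ij}$ the parameter and dimension at the $j$th node of the $i$th leg of $\mathcal Q^+$ ($j=1,\dots,w_i-1$, counted from the centre), with $d_{i,w_i}=0$. For $i=1,\dots,m$ let $\mathcal O_i\subset\mathfrak{gl}_N(\mathbb C)$ be the adjoint orbit of matrices $A$ with $$\mathrm{rank}\,(A-\xi_{i1})\cdots(A-\xi_{ij})=d_{ij}\quad (1\le j\le w_i),\qquad \xi_{i,j}=-(\lambda_{i1}+\dots+\lambda_{i,j-1}),$$ and set $\widehat{\mathcal O}_i=\mathcal O_i$ for $i<m$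 and $\widehat{\mathcal O}_m=\mathcal O_m-\lambda_0$. Assume that $\lambda$ is generic in the sense that all the $\widehat{\mathcal O}_i$ are (nonempty) semisimple orbits. Put $\widehat{\mathcal O}=-\widehat{\mathcal O}_m\subset\mathfrak{gl}_N(\mathbb C)$. For $i<m$ let $\breve{\mathcal O}_i=\mathcal O_i'-\lambda_{i1}\subset\mathfrak{gl}_{n_i}(\mathbb C)$, where $\mathcal O_i'$ is the orbit attached in the same way to the leg left over from the $i$th leg when the central node is removed (top dimension $n_i=d_{i1}$, dimensions $d_{i2},d_{i3},\dots$, parameters $\lambda_{i2},\lambda_{i3},\dots$). Let $H=\prod_{i=1}^{m-1}GL_{n_i}(\mathbb C)\subset GL_N(\mathbb C)$, embedded block-diagonally, act by conjugation on $\widehat{\mathcal O}$, with moment map $\mu_H$ the projection to the diagonal blocks, and let $\breve{\mathcal O}=\prod_{i=1}^{m-1}\breve{\mathcal O}_i$. **Proposition.** The quiver variety $N_{\mathcal Q^+}(\lambda)$ is isomorphic to the complex symplectic quotient of $\widehat{\mathcal O}$ by $H$ at the coadjoint orbit $\breve{\mathcal O}$: $$N_{\mathcal Q^+}(\lambda)\;\cong\;\mu_H^{-1}(\breve{\mathcal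 O})/H .$$ That is, there is a bijection between the points of the two affine GIT quotients that identifies their algebras of regular functions and their Poisson brackets (where $\widehat{\mathcal O}$ carries the Kirillov–Kostant–Souriau structure). -/

import Mathlib

/-!
Affine complex symplectic quotients, quiver varieties, star-shaped quivers.
All spaces are complex affine varieties embedded in a coordinate space `σ → ℂ`.
-/

namespace StarQuiver

/-! ### Complex symplectic (Hamiltonian) quotients as affine GIT quotients -/

/-- The data of a complex symplectic quotient: a group acting on a coordinate space `coord → ℂ`,
a bracket on polynomial functions, and the subset `level` (the preimage of a coadjoint orbit
under the moment map) whose quotient by the group is taken. -/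
structure Reduction where
  coord : Type
  grp : Type
  [group : Group grp]
  act : grp → (coord → ℂ) → (coord → ℂ)
  one_act : ∀ x, act 1 x = x
  mul_act : ∀ g h x, act (g * h) x = act g (act h x)
  bracket : MvPolynomial coord ℂ → MvPolynomial coord ℂ → MvPolynomial coord ℂ
  level : Set (coord → ℂ)

namespace Reduction

variable (R : Reduction)

/-- Two points of the level set are identified if the closures of their orbits intersect. -/
def Rel (x y : R.level) : Prop :=
  (closure (Set.range fun g => R.act g x) ∩ closure (Set.range fun g => R.act g y)).Nonempty

/-- The points of the affine GIT quotient `level / grp`. -/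
def Quotient : Type := Quot R.Rel

/-- Regular functions on the affine GIT quotient: those whose pullback to the level set is the
restriction of a polynomial. They form the algebra `ℂ[level]^grp`. -/
def IsRegular (f : R.Quotient → ℂ) : Prop :=
  ∃ F : MvPolynomial R.coord ℂ, ∀ x : R.level, f (Quot.mk _ x) = MvPolynomial.eval x.1 F

/-- A polynomial function invariant under the group. -/
def IsInvariant (F : MvPolynomial R.coord ℂ) : Prop :=
  ∀ g x, MvPolynomial.eval (R.act g x) F = MvPolynomial.eval x F

/-- `f` is the function on the quotient induced by the invariant polynomial `F`. -/
def Represents (F : MvPolynomial R.coord ℂ) (f : R.Quotient → ℂ) : Prop :=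
  R.IsInvariant F ∧ ∀ x : R.level, f (Quot.mk _ x) = MvPolynomial.eval x.1 F

/-- The Poisson bracket of the symplectic quotient: `h = {f, g}` if `f`, `g` are induced by
invariant polynomials `F`, `G` and `h` is induced by `{F, G}`. -/
def IsPoissonBracket (f g h : R.Quotient → ℂ) : Prop :=
  ∃ F G, R.Represents F f ∧ R.Represents G g ∧
    ∀ x : R.level, h (Quot.mk _ x) = MvPolynomial.eval x.1 (R.bracket F G)

end Reduction

/-! ### Quiver varieties -/

section QuiverVariety

variable {I : Type} [Quiver.{0} I] (v : I → ℕ)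

/-- Coordinates on `W = ⨁ₑ Hom(W_{t(e)}, W_{h(e)}) ⊕ Hom(W_{h(e)}, W_{t(e)})`, `W_i = ℂ^{v i}`:
the entries of a matrix `φ_e` (`Sum.inl`) and of a matrix `φ_{e*}` (`Sum.inr`) for each arrow. -/
abbrev Coord : Type :=
  Σ i : I, Σ j : I, (i ⟶ j) × ((Fin (v j) × Fin (v i)) ⊕ (Fin (v i) × Fin (v j)))

variable {v}

/-- The matrix `φ_e`. -/
def fwd (x : Coord v → ℂ) {i j : I} (e : i ⟶ j) : Matrix (Fin (v j)) (Fin (v i)) ℂ :=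
  Matrix.of fun a b => x ⟨i, j, e, Sum.inl (a, b)⟩

/-- The matrix `φ_{e*}`. -/
def bwd (x : Coord v → ℂ) {i j : I} (e : i ⟶ j) : Matrix (Fin (v i)) (Fin (v j)) ℂ :=
  Matrix.of fun a b => x ⟨i, j, e, Sum.inr (a, b)⟩

/-- The action of `∏ᵢ GL(W_i)` on `W`. -/
noncomputable def quiverAct (g : ∀ i : I, GL (Fin (v i)) ℂ) (x : Coord v → ℂ) : Coord v → ℂ
  | ⟨i, j, e, Sum.inl (a, b)⟩ =>
      ((g j).val * fwd x e * (g i)⁻¹.val) a b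
  | ⟨i, j, e, Sum.inr (a, b)⟩ =>
      ((g i).val * bwd x e * (g j)⁻¹.val) a b

theorem fwd_quiverAct (g : ∀ i : I, GL (Fin (v i)) ℂ) (x : Coord v → ℂ) {i j : I} (e : i ⟶ j) :
    fwd (quiverAct g x) e = (g j).val * fwd x e * (g i)⁻¹.val := by
  ext a b; rfl

theorem bwd_quiverAct (g : ∀ i : I, GL (Fin (v i)) ℂ) (x : Coord v → ℂ) {i j : I} (e : i ⟶ j) :
    bwd (quiverAct g x) e = (g i).val * bwd x e * (g j)⁻¹.val := by
  ext a b; rfl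

theorem coord_ext {x y : Coord v → ℂ} (h₁ : ∀ (i j : I) (e : i ⟶ j), fwd x e = fwd y e)
    (h₂ : ∀ (i j : I) (e : i ⟶ j), bwd x e = bwd y e) : x = y := by
  funext c
  obtain ⟨i, j, e, ⟨a, b⟩ | ⟨a, b⟩⟩ := c
  · exact congrFun (congrFun (h₁ i j e) a) b
  · exact congrFun (congrFun (h₂ i j e) a) b

theorem quiverAct_one (x : Coord v → ℂ) : quiverAct 1 x = x := by
  apply coord_ext <;> intros <;> simp [fwd_quiverAct, bwd_quiverAct]

theorem quiverAct_mul (g h : ∀ i : I, GL (Fin (v i)) ℂ) (x : Coord v → ℂ) :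
    quiverAct (g * h) x = quiverAct g (quiverAct h x) := by
  apply coord_ext <;> intros <;>
    simp only [fwd_quiverAct, bwd_quiverAct, Pi.mul_apply, mul_inv_rev, Units.val_mul,
      Matrix.mul_assoc]

variable [Fintype I] [∀ i j : I, Fintype (i ⟶ j)]

/-- The moment map `μ_i = ∑_{h(e)=i} φ_e φ_{e*} - ∑_{t(e)=i} φ_{e*} φ_e`. -/
noncomputable def moment (x : Coord v → ℂ) (i : I) : Matrix (Fin (v i)) (Fin (v i)) ℂ :=
  ∑ j : I, ∑ e : j ⟶ i, fwd x e * bwd x e - ∑ j : I, ∑ e : i ⟶ j, bwd x e * fwd x e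

/-- The Poisson bracket on `W = ⨁ₑ T^*Hom(W_{t(e)}, W_{h(e)})`, the cotangent fibre being
identified with `Hom(W_{h(e)}, W_{t(e)})` through the trace pairing. -/
noncomputable def quiverBracket (F G : MvPolynomial (Coord v) ℂ) : MvPolynomial (Coord v) ℂ :=
  ∑ i : I, ∑ j : I, ∑ e : i ⟶ j, ∑ a : Fin (v j), ∑ b : Fin (v i),
    (MvPolynomial.pderiv ⟨i, j, e, Sum.inl (a, b)⟩ F *
        MvPolynomial.pderiv ⟨i, j, e, Sum.inr (b, a)⟩ G -
      MvPolynomial.pderiv ⟨i, j, e, Sum.inr (b, a)⟩ F *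
        MvPolynomial.pderiv ⟨i, j, e, Sum.inl (a, b)⟩ G)

variable (v)

/-- The quiver variety with dimension vector `v` and parameters `lam`:
the symplectic quotient `μ⁻¹(lam) / ∏ᵢ GL(W_i)`. -/
noncomputable def quiverVariety (lam : I → ℂ) : Reduction where
  coord := Coord v
  grp := ∀ i : I, GL (Fin (v i)) ℂ
  act := quiverAct
  one_act := quiverAct_one
  mul_act := quiverAct_mul
  bracket := quiverBracket
  level := {x | ∀ i, moment x i = lam i • (1 : Matrix (Fin (v i)) (Fin (v i)) ℂ)}

end QuiverVariety

/-! ### Star-shaped quivers -/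

/-- A star-shaped quiver with `m` legs together with a dimension vector: the dimension of the
central node, and for each leg the dimensions of its nodes, listed going away from the centre. -/
structure StarShape (m : ℕ) where
  center : ℕ
  leg : Fin m → List ℕ

namespace StarShape

variable {m : ℕ} (S : StarShape m)

/-- The nodes: `none` is the central node, `some ⟨i, j⟩` is the `j`-th node of the `i`-th leg
(`j = 0` being adjacent to the central node). -/
def Node : Type := Option (Σ i : Fin m, Fin (S.leg i).length)

instance : Fintype S.Node := inferInstanceAs (Fintype (Option (Σ i : Fin m, Fin (S.leg i).length)))

/-- All arrows point towards the central node. -/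
def IsArrow : S.Node → S.Node → Prop
  | some ⟨_, j⟩, none => j.val = 0
  | some ⟨i, j⟩, some ⟨i', j'⟩ => i = i' ∧ j.val = j'.val + 1
  | none, _ => False

instance : Quiver.{0} S.Node where
  Hom a b := PLift (S.IsArrow a b)

instance (a b : S.Node) : Subsingleton (a ⟶ b) :=
  inferInstanceAs (Subsingleton (PLift (S.IsArrow a b)))

noncomputable instance (a b : S.Node) : Fintype (a ⟶ b) := Fintype.ofFinite _

/-- The dimension vector. -/
def dim : S.Node → ℕ
  | none => S.center
  | some ⟨i, j⟩ => (S.leg i).get j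

/-- The dimension of the node of the `i`-th leg adjacent to the central node. -/
def adjDim (i : Fin m) : ℕ := (S.leg i).headD 0

variable {S} in
/-- The parameter at the `j`-th node of the `i`-th leg (zero beyond the end of the leg). -/
def legParam (lam : S.Node → ℂ) (i : Fin m) (j : ℕ) : ℂ :=
  if h : j < (S.leg i).length then lam (some ⟨i, ⟨j, h⟩⟩) else 0

/-- Almost affine star-shaped quivers; the full leg is labelled as the last one. -/
structure AlmostAffine {k : ℕ} (S : StarShape (k + 1)) : Prop where
  three_le : 3 ≤ k + 1
  leg_ne_nil : ∀ i, S.leg i ≠ []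
  pos : ∀ i, ∀ d ∈ S.leg i, 0 < d
  decreasing : ∀ i, (S.center :: S.leg i).Pairwise (· > ·)
  full : S.center :: S.leg (Fin.last k) = (List.range' 1 S.center).reverse
  sum_adjDim : ∑ i, S.adjDim i = 2 * S.center

/-- The incremented quiver: the last leg gets one more node, and all the dimensions on this leg,
the one of the central node included, increase by one. -/
def incr {k : ℕ} (S : StarShape (k + 1)) : StarShape (k + 1) where
  center := S.center + 1
  leg i := if i = Fin.last k then (S.leg i).map (· + 1) ++ [1] else S.leg i

/-- The partition `N = n_1 + ⋯ + n_{m-1}` of the central dimension of an incremented quiver. -/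
theorem AlmostAffine.sum_incr {k : ℕ} {S : StarShape (k + 1)} (h : S.AlmostAffine) :
    ∑ i : Fin k, S.incr.adjDim i.castSucc = S.incr.center := by
  have h1 := h.sum_adjDim
  rw [Fin.sum_univ_castSucc] at h1
  have h2 : ∀ i : Fin k, S.incr.adjDim i.castSucc = S.adjDim i.castSucc := by
    intro i
    simp [adjDim, incr, (Fin.castSucc_lt_last i).ne]
  have h3 : S.adjDim (Fin.last k) + 1 = S.center := by
    have hf := h.full
    have hn := h.leg_ne_nil (Fin.last k)
    rcases hc : S.center with _ | _ | c
    · simp [hc] at hf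
    · simp [hc] at hf; exact absurd hf hn
    · rw [hc] at hf
      simp only [adjDim]
      rw [List.range'_concat, List.reverse_append, List.range'_concat, List.reverse_append] at hf
      simp at hf
      rw [hf.2]
      simp; omega
  simp only [h2]
  change _ = S.center + 1
  omega

end StarShape

/-! ### Adjoint orbits -/

/-- The numbers `ξ_1 = 0`, `ξ_{l+1} = -(p_1 + ⋯ + p_l)`, indexed from `0`, defined by the
parameters `p` on a leg. -/
noncomputable def legRoot (p : ℕ → ℂ) (l : ℕ) : ℂ := -∑ t ∈ Finset.range l, p t

/-- The adjoint orbit associated to a leg with dimensions `dims` (top node excluded) and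
parameters `p`: the matrices `A` with `rank (A - ξ_1)⋯(A - ξ_j) = n_j` for `j = 1, …, w`, where
`w = dims.length + 1` and `n_w = 0`. -/
def legOrbit {ι : Type} [Fintype ι] [DecidableEq ι] (dims : List ℕ) (p : ℕ → ℂ) :
    Set (Matrix ι ι ℂ) :=
  {A | ∀ j ≤ dims.length, (Polynomial.aeval A (∏ l ∈ Finset.range (j + 1),
    (Polynomial.X - Polynomial.C (legRoot p l)))).rank = dims.getD j 0}

/-- An orbit of semisimple matrices. -/
def IsSemisimpleOrbit {ι : Type} [Fintype ι] [DecidableEq ι] (O : Set (Matrix ι ι ℂ)) : Prop :=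
  O.Nonempty ∧ ∀ A ∈ O, Module.End.IsSemisimple (Matrix.toLin' A)

namespace StarShape

variable {k : ℕ} {S : StarShape (k + 1)}

/-- The residue orbits: the orbit associated to the `i`-th leg, shifted for the last leg by minus
the parameter of the central node. -/
def residueOrbit (lam : S.Node → ℂ) (ι : Type) [Fintype ι] [DecidableEq ι] (i : Fin (k + 1)) :
    Set (Matrix ι ι ℂ) :=
  {B | ∃ A ∈ legOrbit (S.leg i) (legParam lam i),
    B = A + (if i = Fin.last k then -lam none else 0) • (1 : Matrix ι ι ℂ)}

/-- The orbit in `gl_{n_i}` obtained from the `i`-th leg with the central node removed, shifted by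
minus the parameter of the node adjacent to the central one. -/
def dualOrbit (lam : S.Node → ℂ) (i : Fin (k + 1)) :
    Set (Matrix (Fin (S.adjDim i)) (Fin (S.adjDim i)) ℂ) :=
  {B | ∃ A ∈ legOrbit (S.leg i).tail (fun j => legParam lam i (j + 1)),
    B = A - legParam lam i 0 • (1 : Matrix _ _ ℂ)}

variable (S)

/-- The index set of the standard basis of `⨁ᵢ ℂ^{n_i}`, the sum being over all legs but the
last. -/
abbrev BlockIndex : Type := Σ i : Fin k, Fin (S.adjDim i.castSucc)

/-- Coordinates on `gl_N`, for `ℂ^N = ⨁ᵢ ℂ^{n_i}`. -/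
abbrev GlCoord : Type := S.BlockIndex × S.BlockIndex

variable {S}

/-- A point of `gl_N` as a matrix. -/
def toMat (B : S.GlCoord → ℂ) : Matrix S.BlockIndex S.BlockIndex ℂ :=
  Matrix.of fun a b => B (a, b)

/-- The `i`-th component of the moment map of `H`, the `i`-th diagonal block. -/
def diagBlock (B : S.GlCoord → ℂ) (i : Fin k) :
    Matrix (Fin (S.adjDim i.castSucc)) (Fin (S.adjDim i.castSucc)) ℂ :=
  (toMat B).submatrix (fun a => ⟨i, a⟩) (fun a => ⟨i, a⟩)

/-- The conjugation action of `H = ∏ᵢ GL_{n_i}`, embedded block diagonally in `GL_N`. -/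
noncomputable def conjAct (h : ∀ i : Fin k, GL (Fin (S.adjDim i.castSucc)) ℂ)
    (B : S.GlCoord → ℂ) : S.GlCoord → ℂ := fun c =>
  (Matrix.blockDiagonal' (fun i => (h i).val) * toMat B *
    Matrix.blockDiagonal' (fun i => (h i)⁻¹.val)) c.1 c.2

theorem toMat_conjAct (h : ∀ i : Fin k, GL (Fin (S.adjDim i.castSucc)) ℂ) (B : S.GlCoord → ℂ) :
    toMat (conjAct h B) = Matrix.blockDiagonal' (fun i => (h i).val) * toMat B *
      Matrix.blockDiagonal' (fun i => (h i)⁻¹.val) := by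
  ext a b; rfl

theorem toMat_injective : Function.Injective (toMat (S := S)) := by
  intro x y h
  funext c
  exact congrFun (congrFun h c.1) c.2

theorem conjAct_one (B : S.GlCoord → ℂ) : conjAct 1 B = B := by
  apply toMat_injective
  rw [toMat_conjAct]
  have h1 : Matrix.blockDiagonal' (fun i : Fin k =>
      (1 : Matrix (Fin (S.adjDim i.castSucc)) (Fin (S.adjDim i.castSucc)) ℂ)) = 1 :=
    Matrix.blockDiagonal'_one
  simp [h1]

theorem conjAct_mul (g h : ∀ i : Fin k, GL (Fin (S.adjDim i.castSucc)) ℂ) (B : S.GlCoord → ℂ) :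
    conjAct (g * h) B = conjAct g (conjAct h B) := by
  apply toMat_injective
  simp only [toMat_conjAct, Pi.mul_apply, mul_inv_rev, Units.val_mul, Matrix.blockDiagonal'_mul,
    Matrix.mul_assoc]

/-- The gradient of a function on `gl_N` with respect to the trace pairing. -/
noncomputable def grad (F : MvPolynomial S.GlCoord ℂ) :
    Matrix S.BlockIndex S.BlockIndex (MvPolynomial S.GlCoord ℂ) :=
  Matrix.of fun a b => MvPolynomial.pderiv (b, a) F

/-- The Lie-Poisson bracket on `gl_N ≅ gl_N^*`, `{F, G}(B) = Tr(B [dF, dG])`; its restriction to an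
adjoint orbit is the bracket of the Kirillov-Kostant-Souriau symplectic form. -/
noncomputable def glBracket (F G : MvPolynomial S.GlCoord ℂ) : MvPolynomial S.GlCoord ℂ :=
  (Matrix.mvPolynomialX S.BlockIndex S.BlockIndex ℂ *
    (grad F * grad G - grad G * grad F)).trace

/-- The symplectic quotient of minus the last residue orbit by `H`, taken at the coadjoint orbit of
`H` that is the product of the orbits `dualOrbit`. -/
noncomputable def dualReduction (lam : S.Node → ℂ) : Reduction where
  coord := S.GlCoord
  grp := ∀ i : Fin k, GL (Fin (S.adjDim i.castSucc)) ℂ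
  act := conjAct
  one_act := conjAct_one
  mul_act := conjAct_mul
  bracket := glBracket
  level := {B | -toMat B ∈ residueOrbit lam S.BlockIndex (Fin.last k) ∧
    ∀ i : Fin k, diagBlock B i ∈ dualOrbit lam i.castSucc}

end StarShape

end StarQuiver

/-! Cut the star at its centre. On one leg, the moment map equations at the non-central nodes
describe an iterated factorisation of the contribution A = φψ of the leg at the centre. When the
roots ξ of the leg are distinct, these equations force every product ψφ along the leg to be
invertible. Then A lies in the orbit of the leg, every element of the orbit occurs, and A determines
the leg up to base change at its own nodes (`Chain.Sol.mem_legOrbit_and_isUnit`, `Chain.exists_sol`,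
`Chain.exists_conj`). Distinctness comes from semisimplicity together with strictly decreasing
dimensions (`distinctRoots_of_isSemisimple`). So gauge orbits in the level set are simultaneous
conjugacy classes of tuples of orbit elements with sum λ₀.

Collect the maps between the centre and the adjacent nodes of all legs but the last into P : ⨁
ℂ^{n_i} → ℂ^N and Q in the other direction. Since ∑ n_i = N, both are square. The central equation
turns the contribution of the last leg into λ₀ - PQ, while QP is acted on by H alone and has the
ψ_iφ_i as diagonal blocks. The isomorphism is x ↦ (QP)ᵀ. Because the last leg is a full flag with
distinct roots, λ₀ - PQ has N simple eigenvalues, so λ₀ - QP lies in the same orbit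
(`sub_mul_mem_legOrbit_comm`). Taking P = 1 and Q = Bᵀ gives surjectivity.

For injectivity on the GIT quotient, an invertible P can be moved to 1 by the gauge group at the
centre, and then Q = Bᵀ. If P is singular, λ₀ is a root and PQ, QP have one-dimensional kernels; a
one-parameter degeneration along these lines connects the point to one with invertible P and the
same QP (`exists_rel_invertible`).

Closures and regular functions are both handled by a local section `sect` of the map from the level
set to tuples of contributions. It is continuous near its base point, so convergence of
contributions lifts to W (`mem_closure_orbit`). It is rational, so an invariant polynomial on W
becomes a locally rational function of B, and the Nullstellensatz makes it polynomial
(`exists_polynomial_of_local`). Compatibility of brackets is the chain rule for the quadratic map x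
↦ (QP)ᵀ (`eval_quiverBracket`). -/

namespace StarQuiver

open Polynomial Matrix

set_option linter.unusedSectionVars false

/-! ### Rank factorisations and the recursion for the orbits attached to a leg. -/

section LinearAlgebra

variable {ι κ : Type} [Fintype ι] [DecidableEq ι] [Fintype κ] [DecidableEq κ]

theorem exists_rank_factorization {n : ℕ} (A : Matrix ι κ ℂ) (hA : A.rank = n) :
    ∃ (φ : Matrix ι (Fin n) ℂ) (ψ : Matrix (Fin n) κ ℂ) (φ' : Matrix (Fin n) ι ℂ)
      (ψ' : Matrix κ (Fin n) ℂ), A = φ * ψ ∧ φ' * φ = 1 ∧ ψ * ψ' = 1 := by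
  set f := Matrix.toLin' A with hf
  have hr : Module.finrank ℂ (LinearMap.range f) = Module.finrank ℂ (Fin n → ℂ) := by
    rw [Module.finrank_fin_fun, ← hA, Matrix.rank, hf]; rfl
  let e : LinearMap.range f ≃ₗ[ℂ] (Fin n → ℂ) := LinearEquiv.ofFinrankEq _ _ hr
  let a : (Fin n → ℂ) →ₗ[ℂ] (ι → ℂ) := (LinearMap.range f).subtype ∘ₗ e.symm.toLinearMap
  let b : (κ → ℂ) →ₗ[ℂ] (Fin n → ℂ) := e.toLinearMap ∘ₗ f.rangeRestrict
  have ha : LinearMap.ker a = ⊥ := by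
    rw [LinearMap.ker_eq_bot]
    exact (Submodule.injective_subtype _).comp e.symm.injective
  have hb : LinearMap.range b = ⊤ := by
    rw [LinearMap.range_eq_top]
    exact e.surjective.comp f.surjective_rangeRestrict
  have hab : a ∘ₗ b = f := by
    ext x i
    simp [a, b]
  obtain ⟨a', ha'⟩ := LinearMap.exists_leftInverse_of_injective a ha
  obtain ⟨b', hb'⟩ := LinearMap.exists_rightInverse_of_surjective b hb
  refine ⟨LinearMap.toMatrix' a, LinearMap.toMatrix' b, LinearMap.toMatrix' a',
    LinearMap.toMatrix' b', ?_, ?_, ?_⟩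
  · rw [← LinearMap.toMatrix'_comp, hab, hf, LinearMap.toMatrix'_toLin']
  · rw [← LinearMap.toMatrix'_comp, ha', LinearMap.toMatrix'_id]
  · rw [← LinearMap.toMatrix'_comp, hb', LinearMap.toMatrix'_id]

/-- Used mostly with u = φ, X = φψ, Y = ψφ: polynomial expressions pass from one side of a
factorisation to the other. -/
theorem aeval_mul_of_intertwine {X : Matrix ι ι ℂ} {Y : Matrix κ κ ℂ} {u : Matrix ι κ ℂ}
    (h : X * u = u * Y) (q : ℂ[X]) : aeval X q * u = u * aeval Y q := by
  induction q using Polynomial.induction_on' with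
  | add p q hp hq => simp only [map_add, Matrix.add_mul, Matrix.mul_add, hp, hq]
  | monomial n a =>
    have : X ^ n * u = u * Y ^ n := by
      induction n with
      | zero => simp
      | succ n ih =>
        rw [pow_succ, pow_succ, Matrix.mul_assoc, h, ← Matrix.mul_assoc, ih, Matrix.mul_assoc]
    simp only [aeval_monomial, Matrix.algebraMap_eq_diagonal, Matrix.mul_assoc, this]
    rw [← Matrix.mul_assoc, ← Matrix.mul_assoc]
    congr 1
    ext i j
    simp [Matrix.diagonal_mul, Matrix.mul_diagonal, mul_comm]

theorem rank_mul_mul {ι' κ' : Type} [Fintype ι'] [Fintype κ']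
    {φ : Matrix ι' ι ℂ} {ψ : Matrix κ κ' ℂ} {φ' : Matrix ι ι' ℂ}
    {ψ' : Matrix κ' κ ℂ} (hφ : φ' * φ = 1) (hψ : ψ * ψ' = 1) (X : Matrix ι κ ℂ) :
    (φ * X * ψ).rank = X.rank := by
  apply le_antisymm
  · exact (Matrix.rank_mul_le_left _ _).trans (Matrix.rank_mul_le_right _ _)
  · have : X = φ' * (φ * X * ψ) * ψ' := by
      simp only [← Matrix.mul_assoc, hφ, Matrix.one_mul]
      rw [Matrix.mul_assoc, hψ, Matrix.mul_one]
    conv_lhs => rw [this]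
    exact (Matrix.rank_mul_le_left _ _).trans (Matrix.rank_mul_le_right _ _)

/-- Passing from ψφ to φψ costs exactly one factor `X`; this is where the recursion along a leg
comes from. -/
theorem mul_aeval_mul {n : ℕ} (φ : Matrix ι (Fin n) ℂ) (ψ : Matrix (Fin n) ι ℂ) (q : ℂ[X]) :
    φ * aeval (ψ * φ) q * ψ = aeval (φ * ψ) (X * q) := by
  rw [← aeval_mul_of_intertwine (X := φ * ψ) (Matrix.mul_assoc φ ψ φ) q, mul_comm X q, map_mul,
    aeval_X, Matrix.mul_assoc]

theorem legRoot_zero (p : ℕ → ℂ) : legRoot p 0 = 0 := by simp [legRoot]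

theorem legRoot_succ' (p : ℕ → ℂ) (l : ℕ) :
    legRoot p (l + 1) = legRoot (fun j => p (j + 1)) l - p 0 := by
  simp only [legRoot, Finset.sum_range_succ']
  ring

/-- The product of the first `j` factors `X - ξ_l`. -/
noncomputable def legPoly (p : ℕ → ℂ) (j : ℕ) : ℂ[X] :=
  ∏ l ∈ Finset.range j, (X - C (legRoot p l))

theorem legPoly_zero (p : ℕ → ℂ) : legPoly p 0 = 1 := by simp [legPoly]

/-- The first root is 0, which gives the factor `X`; the others are the roots of the shortened leg
shifted by `-p 0`. -/
theorem legPoly_succ' (p : ℕ → ℂ) (j : ℕ) :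
    legPoly p (j + 1) = X * (legPoly (fun j => p (j + 1)) j).comp (X + C (p 0)) := by
  rw [legPoly, Finset.prod_range_succ', legRoot_zero, mul_comm, legPoly, Polynomial.prod_comp]
  congr 1
  · simp
  · refine Finset.prod_congr rfl fun l _ => ?_
    rw [legRoot_succ']
    simp only [sub_comp, X_comp, C_comp, C_sub]
    ring

theorem mem_legOrbit {dims : List ℕ} {p : ℕ → ℂ} {A : Matrix ι ι ℂ} :
    A ∈ legOrbit dims p ↔
      ∀ j ≤ dims.length, (aeval A (legPoly p (j + 1))).rank = dims.getD j 0 := Iff.rfl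

theorem rank_eq_zero_iff {A : Matrix ι κ ℂ} : A.rank = 0 ↔ A = 0 := by
  rw [Matrix.rank, Submodule.finrank_eq_zero, LinearMap.range_eq_bot]
  exact Matrix.toLin'.map_eq_zero_iff

theorem mem_legOrbit_nil {p : ℕ → ℂ} {A : Matrix ι ι ℂ} : A ∈ legOrbit [] p ↔ A = 0 := by
  rw [mem_legOrbit]
  simp [legPoly_succ', legPoly_zero, rank_eq_zero_iff]

theorem aeval_comp_add (A : Matrix ι ι ℂ) (c : ℂ) (q : ℂ[X]) :
    aeval A (q.comp (X + C c)) = aeval (A + c • 1) q := by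
  rw [aeval_comp]
  simp [Algebra.algebraMap_eq_smul_one]

theorem aeval_legPoly_mul {n : ℕ} (p : ℕ → ℂ) (φ : Matrix ι (Fin n) ℂ) (ψ : Matrix (Fin n) ι ℂ)
    (j : ℕ) : aeval (φ * ψ) (legPoly p (j + 1)) =
      φ * aeval (ψ * φ + p 0 • 1) (legPoly (fun j => p (j + 1)) j) * ψ := by
  rw [legPoly_succ', ← mul_aeval_mul, aeval_comp_add]

/-- One step of the recursion along a leg. By `aeval_legPoly_mul` each product of factors at φψ is
φ(⋯)ψ, with the products of the shortened leg inside, and an injective φ and a surjective ψ do not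
change the rank. The condition at index 0 is automatic, since the inner matrix is then the identity
of size n. -/
theorem mul_mem_legOrbit_cons {n : ℕ} {l : List ℕ} {p : ℕ → ℂ} {φ : Matrix ι (Fin n) ℂ}
    {ψ : Matrix (Fin n) ι ℂ} {φ' : Matrix (Fin n) ι ℂ} {ψ' : Matrix ι (Fin n) ℂ}
    (hφ : φ' * φ = 1) (hψ : ψ * ψ' = 1) :
    φ * ψ ∈ legOrbit (n :: l) p ↔ ψ * φ + p 0 • 1 ∈ legOrbit l (fun j => p (j + 1)) := by
  simp only [mem_legOrbit, aeval_legPoly_mul, rank_mul_mul hφ hψ]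
  constructor
  · intro h j hj
    simpa using h (j + 1) (by simpa using hj)
  · intro h j hj
    cases j with
    | zero => simp [legPoly_zero]
    | succ j => simpa using h j (by simpa using hj)

theorem rank_of_mem_legOrbit_cons {n : ℕ} {l : List ℕ} {p : ℕ → ℂ} {A : Matrix ι ι ℂ}
    (hA : A ∈ legOrbit (n :: l) p) : A.rank = n := by
  have := hA 0 (by simp)
  simpa [legRoot_zero] using this

theorem aeval_legPoly_eq_zero {dims : List ℕ} {p : ℕ → ℂ} {A : Matrix ι ι ℂ}
    (hA : A ∈ legOrbit dims p) : aeval A (legPoly p (dims.length + 1)) = 0 := by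
  have := (mem_legOrbit.1 hA) dims.length le_rfl
  simpa [rank_eq_zero_iff] using this

/-- Dividing q by X - c leaves the remainder q(c), so the quotient evaluated at A, times -q(c)⁻¹,
inverts A - c. -/
theorem isUnit_sub_of_aeval_eq_zero {A : Matrix ι ι ℂ} {q : ℂ[X]} (hA : aeval A q = 0) {c : ℂ}
    (hc : q.eval c ≠ 0) : IsUnit (A - c • (1 : Matrix ι ι ℂ)) := by
  have h1 : (X - C c) * (q /ₘ (X - C c)) + C (q.eval c) = q := by
    have := modByMonic_add_div q (X - C c)
    rw [modByMonic_X_sub_C_eq_C_eval] at this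
    rw [add_comm]; exact this
  have h2 := congrArg (aeval A) h1
  rw [hA, map_add, map_mul] at h2
  simp only [map_sub, aeval_X, aeval_C, Algebra.algebraMap_eq_smul_one] at h2
  have h3 : (A - c • (1 : Matrix ι ι ℂ)) * (-(q.eval c)⁻¹ • aeval A (q /ₘ (X - C c))) = 1 := by
    rw [Matrix.mul_smul, eq_neg_of_add_eq_zero_left h2, smul_neg, neg_smul, neg_neg, smul_smul,
      inv_mul_cancel₀ hc, one_smul]
  exact IsUnit.of_mul_eq_one _ h3

theorem isUnit_sub_of_mem_legOrbit {dims : List ℕ} {p : ℕ → ℂ} {A : Matrix ι ι ℂ}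
    (hA : A ∈ legOrbit dims p) {c : ℂ} (hc : ∀ l ≤ dims.length, legRoot p l ≠ c) :
    IsUnit (A - c • (1 : Matrix ι ι ℂ)) := by
  refine isUnit_sub_of_aeval_eq_zero (aeval_legPoly_eq_zero hA) ?_
  rw [legPoly, eval_prod, Finset.prod_ne_zero_iff]
  intro l hl
  simp only [eval_sub, eval_X, eval_C, sub_ne_zero]
  exact (hc l (Nat.lt_succ_iff.1 (Finset.mem_range.1 hl))).symm

theorem exists_leftInv_rightInv_of_isUnit {n : ℕ} {φ : Matrix ι (Fin n) ℂ}
    {ψ : Matrix (Fin n) ι ℂ} (h : IsUnit (ψ * φ)) :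
    ∃ (φ' : Matrix (Fin n) ι ℂ) (ψ' : Matrix ι (Fin n) ℂ), φ' * φ = 1 ∧ ψ * ψ' = 1 := by
  obtain ⟨u, hu⟩ := h
  refine ⟨u⁻¹.val * ψ, φ * u⁻¹.val, ?_, ?_⟩
  · rw [Matrix.mul_assoc, ← hu, Units.inv_mul]
  · rw [← Matrix.mul_assoc, ← hu, Units.mul_inv]

/-- Uniqueness of a factorisation through ℂⁿ up to `GL_n`, with a prescribed base change g on the
large space. -/
theorem exists_conj_of_mul_eq {n : ℕ} {φ φ' : Matrix ι (Fin n) ℂ} {ψ ψ' : Matrix (Fin n) ι ℂ}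
    (g : GL ι ℂ) (h : IsUnit (ψ * φ)) (h' : IsUnit (ψ' * φ'))
    (hg : φ' * ψ' = g.val * (φ * ψ) * g⁻¹.val) :
    ∃ k : GL (Fin n) ℂ, φ' = g.val * φ * k⁻¹.val ∧ ψ' = k.val * ψ * g⁻¹.val := by
  obtain ⟨u, hu⟩ := h
  obtain ⟨u', hu'⟩ := h'
  have gi : g⁻¹.val * g.val = 1 := Units.inv_mul g
  -- The base change k is forced: applying φ'ψ' = gφψg⁻¹ to gφ gives φ'(ψ'gφ) = gφ(ψφ), hence φ'a =
  -- gφ. The matrix b is obtained by exchanging the two factorisations.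
  let a := ψ' * g.val * φ * u⁻¹.val
  let b := ψ * g⁻¹.val * φ' * u'⁻¹.val
  have ha : φ' * a = g.val * φ := by
    calc φ' * a = (φ' * ψ') * g.val * φ * u⁻¹.val := by simp only [a, Matrix.mul_assoc]
      _ = g.val * φ * (ψ * (g⁻¹.val * g.val) * φ) * u⁻¹.val := by
        rw [hg]; simp only [Matrix.mul_assoc]
      _ = g.val * φ := by
        rw [gi, Matrix.mul_one, ← hu, Matrix.mul_assoc, Units.mul_inv, Matrix.mul_one]
  have hb : g.val * φ * b = φ' := by
    calc g.val * φ * b = (g.val * (φ * ψ) * g⁻¹.val) * φ' * u'⁻¹.val := by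
          simp only [b, Matrix.mul_assoc]
      _ = φ' * (ψ' * φ') * u'⁻¹.val := by rw [← hg]; simp only [Matrix.mul_assoc]
      _ = φ' := by rw [← hu', Matrix.mul_assoc, Units.mul_inv, Matrix.mul_one]
  have cancel : ∀ {m : Type} (s t : Matrix (Fin n) m ℂ), φ' * s = φ' * t → s = t := by
    intro m s t hst
    have h1 : u'.val * s = u'.val * t := by rw [hu', Matrix.mul_assoc, hst, Matrix.mul_assoc]
    have h2 := congrArg (u'⁻¹.val * ·) h1
    simpa only [← Matrix.mul_assoc, Units.inv_mul, Matrix.one_mul] using h2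
  have hab : a * b = 1 := cancel _ _ (by rw [← Matrix.mul_assoc, ha, hb, Matrix.mul_one])
  refine ⟨⟨a, b, hab, mul_eq_one_comm.1 hab⟩, hb.symm, ?_⟩
  change ψ' = a * ψ * g⁻¹.val
  apply cancel
  rw [hg, Matrix.mul_assoc a, ← Matrix.mul_assoc φ', ha]
  simp only [Matrix.mul_assoc]

theorem mem_legOrbit_of_conj {dims : List ℕ} {p : ℕ → ℂ} {A : Matrix ι ι ℂ} {B : Matrix κ κ ℂ}
    {u : Matrix ι κ ℂ} {v : Matrix κ ι ℂ} (h₁ : v * u = 1) (h₂ : u * v = 1) (h : A * u = u * B)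
    (hA : A ∈ legOrbit dims p) : B ∈ legOrbit dims p := by
  rw [mem_legOrbit] at hA ⊢
  intro j hj
  rw [← hA j hj]
  have h3 := aeval_mul_of_intertwine h (legPoly p (j + 1))
  have h4 : aeval B (legPoly p (j + 1)) = v * aeval A (legPoly p (j + 1)) * u := by
    rw [Matrix.mul_assoc, h3, ← Matrix.mul_assoc, h₁, Matrix.one_mul]
  rw [h4, rank_mul_mul h₂ h₂]

/-- Needed because the comparison map to `gl_N` contains a transpose. -/
theorem transpose_mem_legOrbit {dims : List ℕ} {p : ℕ → ℂ} {A : Matrix ι ι ℂ}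
    (hA : A ∈ legOrbit dims p) : Aᵀ ∈ legOrbit dims p := by
  rw [mem_legOrbit] at hA ⊢
  intro j hj
  have : aeval Aᵀ (legPoly p (j + 1)) = (aeval A (legPoly p (j + 1)))ᵀ := by
    induction legPoly p (j + 1) using Polynomial.induction_on' with
    | add p q hp hq => simp [hp, hq]
    | monomial n a =>
      simp [aeval_monomial, Matrix.algebraMap_eq_diagonal, Matrix.transpose_mul,
        Matrix.transpose_pow]
      exact (Matrix.scalar_commute a (fun r => mul_comm _ _) _).eq
  rw [this, Matrix.rank_transpose, hA j hj]

end LinearAlgebra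

end StarQuiver

namespace StarQuiver

open Polynomial Matrix

set_option linter.unusedSectionVars false

/-! ### Orbits with distinct roots: spectral projections, and exchanging PQ with QP. -/

section Spectral

variable {ι κ : Type} [Fintype ι] [DecidableEq ι] [Fintype κ] [DecidableEq κ]

/-- If E = φψ is a full rank factorisation, E² = E forces ψφ = 1. The point is to replace ranks by
traces, which are polynomial in the matrix. -/
theorem rank_eq_trace_of_idempotent {E : Matrix ι ι ℂ} (hE : E * E = E) :
    (E.rank : ℂ) = E.trace := by
  obtain ⟨n, hn⟩ : ∃ n, E.rank = n := ⟨_, rfl⟩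
  obtain ⟨φ, ψ, φ', ψ', h, h₁, h₂⟩ := exists_rank_factorization E hn
  have h3 : ψ * φ = 1 := by
    have : φ' * (E * E) * ψ' = φ' * E * ψ' := by rw [hE]
    rw [h] at this
    calc ψ * φ = (φ' * φ) * (ψ * φ) * (ψ * ψ') := by rw [h₁, h₂, Matrix.one_mul, Matrix.mul_one]
      _ = φ' * (φ * ψ * (φ * ψ)) * ψ' := by simp only [Matrix.mul_assoc]
      _ = (φ' * φ) * (ψ * ψ') := by rw [this]; simp only [Matrix.mul_assoc]
      _ = 1 := by rw [h₁, h₂, Matrix.one_mul]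
  rw [hn, h, Matrix.trace_mul_comm, h3]
  simp

variable {dims : List ℕ} {p : ℕ → ℂ}

/-- The numbers `ξ_1, …, ξ_w` attached to a leg with `L = w - 1` nodes are distinct. -/
def DistinctRoots (p : ℕ → ℂ) (L : ℕ) : Prop :=
  Set.InjOn (legRoot p) (Finset.range (L + 1))

theorem eval_legPoly (p : ℕ → ℂ) (j : ℕ) (z : ℂ) :
    (legPoly p j).eval z = ∏ l ∈ Finset.range j, (z - legRoot p l) := by
  simp [legPoly, eval_prod]

/-- A is killed by a product of distinct linear factors, so f(A) depends only on the values of f at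
the roots. Spectral identities below reduce to checking these values. -/
theorem aeval_eq_of_eval_eq {L : ℕ} (hξ : DistinctRoots p L) {A : Matrix ι ι ℂ}
    (hA : aeval A (legPoly p (L + 1)) = 0) {f g : ℂ[X]}
    (h : ∀ l ∈ Finset.range (L + 1), f.eval (legRoot p l) = g.eval (legRoot p l)) :
    aeval A f = aeval A g := by
  have hd : legPoly p (L + 1) ∣ f - g := by
    refine Finset.prod_dvd_of_coprime ?_ ?_
    · intro i hi j hj hij
      exact pairwise_coprime_X_sub_C (s := fun l : Finset.range (L + 1) => legRoot p l)
        (fun a b hab => Subtype.ext (hξ a.2 b.2 hab)) (i := ⟨i, hi⟩) (j := ⟨j, hj⟩)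
        (fun h => hij (congrArg Subtype.val h))
    · intro l hl
      rw [dvd_iff_isRoot, IsRoot, eval_sub, h l hl, sub_self]
  obtain ⟨q, hq⟩ := hd
  rw [← sub_eq_zero, ← map_sub, hq, map_mul, hA, zero_mul]

/-- The spectral projection of a matrix to the eigenvalue `ξ_{l+1}`, as a polynomial. -/
noncomputable def specPoly (p : ℕ → ℂ) (L l : ℕ) : ℂ[X] :=
  Lagrange.basis (Finset.range (L + 1)) (legRoot p) l

theorem eval_specPoly {L : ℕ} (hξ : DistinctRoots p L) {l i : ℕ} (hi : i ∈ Finset.range (L + 1)) :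
    (specPoly p L l).eval (legRoot p i) = if i = l then 1 else 0 := by
  split_ifs with h
  · subst h
    exact Lagrange.eval_basis_self hξ hi
  · exact Lagrange.eval_basis_of_ne (Ne.symm h) hi

/-- The polynomial that is `1` at `ξ_{l+1}` for `l > j` and `0` at the other `ξ`. -/
noncomputable def tailPoly (p : ℕ → ℂ) (L j : ℕ) : ℂ[X] :=
  ∑ l ∈ Finset.range (L + 1) with j < l, specPoly p L l

theorem eval_tailPoly {L : ℕ} (hξ : DistinctRoots p L) {j i : ℕ}
    (hi : i ∈ Finset.range (L + 1)) :
    (tailPoly p L j).eval (legRoot p i) = if j < i then 1 else 0 := by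
  rw [tailPoly, eval_finsetSum, Finset.sum_congr rfl fun l _ => eval_specPoly hξ hi,
    Finset.sum_ite_eq]
  simp [Finset.mem_filter, Finset.mem_range.1 hi]

/-- The product of the first j + 1 factors vanishes at exactly those roots where `tailPoly` does.
Evaluated at A, each is therefore a multiple of the other, so they have equal rank, and `tailPoly`
gives an idempotent. -/
theorem rank_aeval_legPoly {L : ℕ} (hξ : DistinctRoots p L) {A : Matrix ι ι ℂ}
    (hA : aeval A (legPoly p (L + 1)) = 0) (j : ℕ) :
    ((aeval A (legPoly p (j + 1))).rank : ℂ) = (aeval A (tailPoly p L j)).trace := by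
  have hE : aeval A (tailPoly p L j) * aeval A (tailPoly p L j) = aeval A (tailPoly p L j) := by
    rw [← map_mul]
    refine aeval_eq_of_eval_eq hξ hA fun i hi => ?_
    rw [eval_mul, eval_tailPoly hξ hi]
    split_ifs <;> simp
  rw [← rank_eq_trace_of_idempotent hE, Nat.cast_inj]
  have hv : ∀ i ∈ Finset.range (L + 1), j < i → (legPoly p (j + 1)).eval (legRoot p i) ≠ 0 := by
    intro i hi hji
    rw [eval_legPoly, Finset.prod_ne_zero_iff]
    intro l hl h0
    have hl := Finset.mem_range.1 hl
    have hi' := Finset.mem_range.1 hi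
    have := hξ hi (Finset.mem_coe.2 (Finset.mem_range.2 (by omega))) (sub_eq_zero.1 h0)
    omega
  have hv0 : ∀ i ∈ Finset.range (L + 1), ¬ j < i →
      (legPoly p (j + 1)).eval (legRoot p i) = 0 := by
    intro i hi hji
    rw [eval_legPoly]
    exact Finset.prod_eq_zero (Finset.mem_range.2 (by omega : i < j + 1)) (sub_self _)
  apply le_antisymm
  · have : aeval A (legPoly p (j + 1)) = aeval A (legPoly p (j + 1)) * aeval A (tailPoly p L j) := by
      rw [← map_mul]
      refine aeval_eq_of_eval_eq hξ hA fun i hi => ?_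
      rw [eval_mul, eval_tailPoly hξ hi]
      split_ifs with h
      · simp
      · simp [hv0 i hi h]
    rw [this]
    exact Matrix.rank_mul_le_right _ _
  -- The cofactor interpolates the inverse values of `legPoly`; where `legPoly` vanishes the
  -- interpolated value `0⁻¹` is irrelevant.
  · have : aeval A (tailPoly p L j) = aeval A (Lagrange.interpolate (Finset.range (L + 1))
        (legRoot p) (fun i => ((legPoly p (j + 1)).eval (legRoot p i))⁻¹)) *
          aeval A (legPoly p (j + 1)) := by
      rw [← map_mul]
      refine aeval_eq_of_eval_eq hξ hA fun i hi => ?_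
      rw [eval_mul, eval_tailPoly hξ hi, Lagrange.eval_interpolate_at_node _ hξ hi]
      split_ifs with h
      · rw [inv_mul_cancel₀ (hv i hi h)]
      · simp [hv0 i hi h]
    rw [this]
    exact Matrix.rank_mul_le_right _ _

/-- Replaces the rank conditions by polynomial equations. It serves twice: to exchange PQ and QP,
and to see that the level set of the dual quotient is Zariski closed. -/
theorem mem_legOrbit_iff_trace (hξ : DistinctRoots p dims.length) {A : Matrix ι ι ℂ} :
    A ∈ legOrbit dims p ↔ aeval A (legPoly p (dims.length + 1)) = 0 ∧
      ∀ j ≤ dims.length, (aeval A (tailPoly p dims.length j)).trace = (dims.getD j 0 : ℕ) := by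
  constructor
  · intro h
    have h0 := aeval_legPoly_eq_zero h
    refine ⟨h0, fun j hj => ?_⟩
    rw [← rank_aeval_legPoly hξ h0, mem_legOrbit.1 h j hj]
  · rintro ⟨h0, h⟩
    rw [mem_legOrbit]
    intro j hj
    have := h j hj
    rw [← rank_aeval_legPoly hξ h0] at this
    exact_mod_cast this

/-- A matrix `u` with `A * u = u * B` that is the identity for `A = B`. -/
noncomputable def intertwiner (p : ℕ → ℂ) (L : ℕ) (A B : Matrix ι ι ℂ) : Matrix ι ι ℂ :=
  ∑ l ∈ Finset.range (L + 1), aeval A (specPoly p L l) * aeval B (specPoly p L l)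

theorem mul_aeval_specPoly {L : ℕ} (hξ : DistinctRoots p L) {A : Matrix ι ι ℂ}
    (hA : aeval A (legPoly p (L + 1)) = 0) (l : ℕ) :
    A * aeval A (specPoly p L l) = legRoot p l • aeval A (specPoly p L l) := by
  have := aeval_eq_of_eval_eq hξ hA (f := X * specPoly p L l)
    (g := C (legRoot p l) * specPoly p L l) fun i hi => by
      rw [eval_mul, eval_mul, eval_specPoly hξ hi]
      split_ifs with h
      · simp [h]
      · simp
  simpa [Algebra.algebraMap_eq_smul_one] using this

theorem aeval_specPoly_mul {L : ℕ} (hξ : DistinctRoots p L) {A : Matrix ι ι ℂ}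
    (hA : aeval A (legPoly p (L + 1)) = 0) (l : ℕ) :
    aeval A (specPoly p L l) * A = legRoot p l • aeval A (specPoly p L l) := by
  rw [← mul_aeval_specPoly hξ hA]
  have : aeval A (specPoly p L l * X) = aeval A (X * specPoly p L l) := by rw [mul_comm]
  simpa only [map_mul, aeval_X] using this

theorem aeval_specPoly_mul_self {L : ℕ} (hξ : DistinctRoots p L) {A : Matrix ι ι ℂ}
    (hA : aeval A (legPoly p (L + 1)) = 0) (l : ℕ) :
    aeval A (specPoly p L l) * aeval A (specPoly p L l) = aeval A (specPoly p L l) := by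
  rw [← map_mul]
  refine aeval_eq_of_eval_eq hξ hA fun i hi => ?_
  rw [eval_mul, eval_specPoly hξ hi]
  split_ifs <;> simp

/-- On the l-th summand A acts from the left and B from the right by the same scalar ξ. With
`intertwiner_self` and continuity, this yields for A near B a matrix conjugating B to A, with
entries polynomial in A. -/
theorem mul_intertwiner {L : ℕ} (hξ : DistinctRoots p L) {A B : Matrix ι ι ℂ}
    (hA : aeval A (legPoly p (L + 1)) = 0) (hB : aeval B (legPoly p (L + 1)) = 0) :
    A * intertwiner p L A B = intertwiner p L A B * B := by
  rw [intertwiner, Finset.mul_sum, Finset.sum_mul]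
  refine Finset.sum_congr rfl fun l _ => ?_
  rw [← Matrix.mul_assoc, mul_aeval_specPoly hξ hA, Matrix.mul_assoc, aeval_specPoly_mul hξ hB,
    Matrix.smul_mul, Matrix.mul_smul]

/-- For A = B the summands are the spectral projections of A, which add up to 1. -/
theorem intertwiner_self {L : ℕ} (hξ : DistinctRoots p L) {A : Matrix ι ι ℂ}
    (hA : aeval A (legPoly p (L + 1)) = 0) : intertwiner p L A A = 1 := by
  rw [intertwiner, Finset.sum_congr rfl fun l _ => aeval_specPoly_mul_self hξ hA l, ← map_sum,
    ← map_one (aeval A : ℂ[X] →ₐ[ℂ] Matrix ι ι ℂ)]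
  congr 1
  exact Lagrange.sum_basis hξ ⟨0, by simp⟩

theorem rank_aeval_legPoly_of_mem {A : Matrix ι ι ℂ} (hA : A ∈ legOrbit dims p) {j : ℕ}
    (hj : j ≤ dims.length + 1) :
    (aeval A (legPoly p j)).rank = (Fintype.card ι :: dims).getD j 0 := by
  cases j with
  | zero => simp [legPoly_zero]
  | succ j => simpa using mem_legOrbit.1 hA j (by omega)

theorem legPoly_succ (p : ℕ → ℂ) (j : ℕ) :
    legPoly p (j + 1) = (X - C (legRoot p j)) * legPoly p j := by
  rw [legPoly, Finset.prod_range_succ, mul_comm, legPoly]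

/-- If A - ξ were invertible, multiplying by it could not lower the rank, but the dimensions
strictly decrease. -/
theorem det_sub_legRoot_eq_zero
    (hd : ∀ j ≤ dims.length, dims.getD j 0 < (Fintype.card ι :: dims).getD j 0)
    {A : Matrix ι ι ℂ} (hA : A ∈ legOrbit dims p) {l : ℕ} (hl : l ≤ dims.length) :
    (A - legRoot p l • (1 : Matrix ι ι ℂ)).det = 0 := by
  by_contra h
  have h1 := rank_aeval_legPoly_of_mem hA (j := l + 1) (by omega)
  have h2 := rank_aeval_legPoly_of_mem hA (j := l) (by omega)
  rw [legPoly_succ, map_mul, Matrix.rank_mul_eq_right_of_isUnit_det, h2] at h1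
  · have := hd l hl
    simp at h1 this
    omega
  · simpa [Algebra.algebraMap_eq_smul_one] using h

/-- Suppose a root repeats and put N = A - ξ. The product before the second occurrence already
contains N, and ker N² = ker N for semisimple A, so the second factor N leaves the rank unchanged,
against the strict decrease of the dimensions. -/
theorem distinctRoots_of_isSemisimple
    (hd : ∀ j ≤ dims.length, dims.getD j 0 < (Fintype.card ι :: dims).getD j 0)
    {A : Matrix ι ι ℂ} (hA : A ∈ legOrbit dims p)
    (hs : Module.End.IsSemisimple (Matrix.toLin' A)) : DistinctRoots p dims.length := by
  have key : ∀ l j, l < j → j ≤ dims.length → legRoot p l ≠ legRoot p j := by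
    intro l j hlj hj heq
    set N := A - legRoot p j • (1 : Matrix ι ι ℂ) with hN
    have hNa : aeval A (X - C (legRoot p j)) = N := by
      simp [hN, Algebra.algebraMap_eq_smul_one]
    have hker : ∀ v : ι → ℂ, N *ᵥ (N *ᵥ v) = 0 → N *ᵥ v = 0 := by
      intro v hv
      have h1 := hs.isFinitelySemisimple.genEigenspace_eq_eigenspace (legRoot p j)
        (k := ((2 : ℕ) : ℕ∞)) (by norm_num)
      have hNl : Matrix.toLin' A - (legRoot p j) • (1 : Module.End ℂ (ι → ℂ)) = Matrix.toLin' N := by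
        rw [hN, map_sub, map_smul, Matrix.toLin'_one]; rfl
      have h2 : v ∈ Module.End.genEigenspace (Matrix.toLin' A) (legRoot p j) ((2 : ℕ) : ℕ∞) := by
        rw [Module.End.mem_genEigenspace_nat, hNl, LinearMap.mem_ker, pow_two,
          Module.End.mul_apply, Matrix.toLin'_apply, Matrix.toLin'_apply, hv]
      rw [h1, Module.End.eigenspace_def, LinearMap.mem_ker] at h2
      have h3 : Matrix.toLin' N v = 0 := by
        rw [← hNl]
        exact h2
      simpa using h3
    have hdvd : (X - C (legRoot p j)) ∣ legPoly p j := by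
      rw [← heq]
      exact Finset.dvd_prod_of_mem _ (Finset.mem_range.2 hlj)
    obtain ⟨r, hr⟩ := hdvd
    have h1 := rank_aeval_legPoly_of_mem hA (j := j + 1) (by omega)
    have h2 := rank_aeval_legPoly_of_mem hA (j := j) (by omega)
    rw [legPoly_succ, hr, map_mul, map_mul, hNa] at h1
    rw [hr, map_mul, hNa] at h2
    have hk : LinearMap.ker (N * (N * aeval A r)).mulVecLin =
        LinearMap.ker (N * aeval A r).mulVecLin := by
      ext v
      simp only [LinearMap.mem_ker, Matrix.mulVecLin_apply, ← Matrix.mulVec_mulVec]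
      constructor
      · exact hker _
      · intro h
        rw [h, Matrix.mulVec_zero]
    have h3 := LinearMap.finrank_range_add_finrank_ker (N * (N * aeval A r)).mulVecLin
    have h4 := LinearMap.finrank_range_add_finrank_ker (N * aeval A r).mulVecLin
    rw [hk] at h3
    have := hd j hj
    simp only [Matrix.rank] at h1 h2
    simp only [List.getD_cons_succ] at h1
    omega
  intro a ha b hb hab
  have ha := Finset.mem_range.1 (Finset.mem_coe.1 ha)
  have hb := Finset.mem_range.1 (Finset.mem_coe.1 hb)
  rcases lt_trichotomy a b with h | h | h
  · exact absurd hab (key a b h (by omega))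
  · exact h
  · exact absurd hab.symm (key b a h (by omega))

/-- The part of f divisible by X is cyclicity of the trace; the constant term needs the two sizes to
agree. -/
theorem trace_aeval_mul_comm (h : Fintype.card ι = Fintype.card κ) (P : Matrix ι κ ℂ)
    (Q : Matrix κ ι ℂ) (f : ℂ[X]) : (aeval (P * Q) f).trace = (aeval (Q * P) f).trace := by
  rw [← divX_mul_X_add f]
  simp only [map_add, map_mul, aeval_X, aeval_C, Matrix.trace_add]
  congr 1
  · rw [← Matrix.mul_assoc, aeval_mul_of_intertwine (Matrix.mul_assoc P Q P), Matrix.mul_assoc,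
      Matrix.trace_mul_comm, Matrix.mul_assoc]
  · simp [Matrix.algebraMap_eq_diagonal, Matrix.trace_diagonal, h]

theorem aeval_smul_one_sub (c : ℂ) (A : Matrix ι ι ℂ) (f : ℂ[X]) :
    aeval (c • 1 - A) f = aeval A (f.comp (C c - X)) := by
  rw [aeval_comp]
  simp [Algebra.algebraMap_eq_smul_one]

/-- This is where the full leg is indispensable. PQ and QP always share their characteristic
polynomial, but QP may have a nilpotent part at 0 that PQ lacks. With as many distinct roots as the
size, the characteristic polynomial is squarefree, so Cayley-Hamilton gives the annihilating
polynomial for QP; the traces agree by `trace_aeval_mul_comm`. -/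
theorem sub_mul_mem_legOrbit_comm (hξ : DistinctRoots p dims.length)
    (hcard : Fintype.card ι = Fintype.card κ) (hL : dims.length + 1 = Fintype.card ι)
    (hd : ∀ j ≤ dims.length, dims.getD j 0 < (Fintype.card ι :: dims).getD j 0)
    {P : Matrix ι κ ℂ} {Q : Matrix κ ι ℂ} {c : ℂ}
    (h : c • 1 - P * Q ∈ legOrbit dims p) : c • 1 - Q * P ∈ legOrbit dims p := by
  have htr := (mem_legOrbit_iff_trace hξ).1 h
  rw [mem_legOrbit_iff_trace hξ]
  constructor
  · have hχ : (Q * P).charpoly = (P * Q).charpoly := by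
      rw [Matrix.charpoly_mul_comm_of_le _ _ hcard.le, hcard]
      simp
    have hdvd : ∏ l ∈ Finset.range (dims.length + 1), (X - C (c - legRoot p l)) ∣
        (P * Q).charpoly := by
      refine Finset.prod_dvd_of_coprime ?_ ?_
      · intro i hi j hj hij
        exact pairwise_coprime_X_sub_C
          (s := fun l : Finset.range (dims.length + 1) => c - legRoot p l)
          (fun a b hab => Subtype.ext (hξ a.2 b.2 (sub_right_injective hab)))
          (i := ⟨i, hi⟩) (j := ⟨j, hj⟩) (fun h => hij (congrArg Subtype.val h))
      · intro l hl
        rw [dvd_iff_isRoot, IsRoot, Matrix.eval_charpoly,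
          ← det_sub_legRoot_eq_zero hd h (Nat.lt_succ_iff.1 (Finset.mem_range.1 hl))]
        congr 1
        rw [sub_right_comm, ← sub_smul]
        simp [Matrix.smul_one_eq_diagonal]
    -- The N distinct eigenvalues exhaust a monic polynomial of degree N; `hL` does the counting.
    have heq : ∏ l ∈ Finset.range (dims.length + 1), (X - C (c - legRoot p l)) =
        (P * Q).charpoly := by
      symm
      apply eq_of_monic_of_dvd_of_natDegree_le
      · exact monic_prod_of_monic _ _ fun l _ => monic_X_sub_C _
      · exact Matrix.charpoly_monic _
      · exact hdvd
      · rw [Matrix.charpoly_natDegree_eq_dim, natDegree_prod_of_monic _ _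
          fun l _ => monic_X_sub_C _, Finset.sum_congr rfl fun l _ => natDegree_X_sub_C _]
        simp [hL]
    have hz : aeval (Q * P) (∏ l ∈ Finset.range (dims.length + 1), (X - C (c - legRoot p l))) =
        0 := by
      rw [heq, ← hχ]
      exact Matrix.aeval_self_charpoly _
    have hcomp : (legPoly p (dims.length + 1)).comp (C c - X) =
        (-1) ^ (dims.length + 1) *
          ∏ l ∈ Finset.range (dims.length + 1), (X - C (c - legRoot p l)) := by
      have hf : ∀ l ∈ Finset.range (dims.length + 1), (X - C (legRoot p l)).comp (C c - X) =
          -1 * (X - C (c - legRoot p l)) := fun l _ => by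
        simp only [sub_comp, X_comp, C_comp, C_sub]
        ring
      rw [legPoly, Polynomial.prod_comp, Finset.prod_congr rfl hf, Finset.prod_mul_distrib,
        Finset.prod_const, Finset.card_range]
    rw [aeval_smul_one_sub, hcomp, map_mul, hz, mul_zero]
  · intro j hj
    rw [← htr.2 j hj, aeval_smul_one_sub, aeval_smul_one_sub, trace_aeval_mul_comm hcard]

/-- The trace of the l-th spectral projection is the difference of two consecutive dimensions, which
is 1 on a full leg: all eigenspaces are lines. -/
theorem rank_aeval_specPoly_eq_one (hξ : DistinctRoots p dims.length)
    (hd : ∀ j ≤ dims.length, dims.getD j 0 + 1 = (Fintype.card ι :: dims).getD j 0)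
    {A : Matrix ι ι ℂ} (hA : A ∈ legOrbit dims p) {l : ℕ} (hl : l ≤ dims.length) :
    (aeval A (specPoly p dims.length l)).rank = 1 := by
  obtain ⟨h0, htr⟩ := (mem_legOrbit_iff_trace hξ).1 hA
  have h1 := rank_eq_trace_of_idempotent (aeval_specPoly_mul_self hξ h0 l)
  -- Tails telescope; for l = 0 there is no preceding tail, and the total is the identity.
  have h2 : aeval A (specPoly p dims.length l + tailPoly p dims.length l) =
      if l = 0 then 1 else aeval A (tailPoly p dims.length (l - 1)) := by
    split_ifs with hl0
    · rw [← map_one (aeval A : ℂ[X] →ₐ[ℂ] Matrix ι ι ℂ)]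
      refine aeval_eq_of_eval_eq hξ h0 fun i hi => ?_
      rw [eval_add, eval_specPoly hξ hi, eval_tailPoly hξ hi, eval_one, hl0]
      rcases Nat.eq_zero_or_pos i with h | h
      · simp [h]
      · simp [h, h.ne']
    · refine aeval_eq_of_eval_eq hξ h0 fun i hi => ?_
      rw [eval_add, eval_specPoly hξ hi, eval_tailPoly hξ hi, eval_tailPoly hξ hi]
      rcases lt_trichotomy i l with h | h | h
      · rw [if_neg h.ne, if_neg (by omega), if_neg (by omega), add_zero]
      · rw [if_pos h, if_neg (by omega), if_pos (by omega), add_zero]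
      · rw [if_neg h.ne', if_pos h, if_pos (by omega), zero_add]
  have h3 : ((aeval A (specPoly p dims.length l)).rank : ℂ) + (dims.getD l 0 : ℕ) =
      ((Fintype.card ι :: dims).getD l 0 : ℕ) := by
    rw [h1, ← htr l hl, ← Matrix.trace_add, ← map_add, h2]
    cases l with
    | zero => simp
    | succ l =>
      rw [if_neg (Nat.succ_ne_zero l), List.getD_cons_succ]
      exact htr l (by omega)
  have h4 : (aeval A (specPoly p dims.length l)).rank + dims.getD l 0 =
      (Fintype.card ι :: dims).getD l 0 := by exact_mod_cast h3
  have := hd l hl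
  omega

end Spectral

end StarQuiver

/-! ### Representations of a single leg. -/

namespace StarQuiver

open Polynomial Matrix

set_option linter.unusedSectionVars false

/-- A representation of the doubled quiver of type `A` (a leg together with the centre), with
dimensions `d`. -/
structure Chain {L : ℕ} (d : Fin (L + 1) → ℕ) where
  φ : ∀ j : Fin L, Matrix (Fin (d j.castSucc)) (Fin (d j.succ)) ℂ
  ψ : ∀ j : Fin L, Matrix (Fin (d j.succ)) (Fin (d j.castSucc)) ℂ

namespace Chain

/-- The contribution to the moment map at the `j`-th node of the arrow coming into it. -/
noncomputable def T {L : ℕ} {d : Fin (L + 1) → ℕ} (D : Chain d) (j : Fin (L + 1)) :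
    Matrix (Fin (d j)) (Fin (d j)) ℂ :=
  if h : j.val < L then D.φ ⟨j, h⟩ * D.ψ ⟨j, h⟩ else 0

/-- The moment map equations at all nodes but the initial one. -/
def Sol {L : ℕ} {d : Fin (L + 1) → ℕ} (D : Chain d) (p : ℕ → ℂ) : Prop :=
  ∀ j : Fin L, D.ψ j * D.φ j + p j • 1 = D.T j.succ

theorem T_castSucc {L : ℕ} {d : Fin (L + 1) → ℕ} (D : Chain d) (j : Fin L) :
    D.T j.castSucc = D.φ j * D.ψ j := by
  have h : j.castSucc.val < L := j.2
  simp only [T, h, dif_pos]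
  rfl

theorem T_of_not_lt {L : ℕ} {d : Fin (L + 1) → ℕ} (D : Chain d) {j : Fin (L + 1)}
    (h : ¬ j.val < L) : D.T j = 0 := by
  simp only [T, h, dif_neg, not_false_eq_true]

/-- The chain without its initial node. -/
def tail {L : ℕ} {d : Fin (L + 2) → ℕ} (D : Chain d) : Chain (fun j => d j.succ) where
  φ j := D.φ j.succ
  ψ j := D.ψ j.succ

theorem T_tail {L : ℕ} {d : Fin (L + 2) → ℕ} (D : Chain d) (j : Fin (L + 1)) :
    D.tail.T j = D.T j.succ := by
  by_cases h : j.val < L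
  · have h' : j.succ.val < L + 1 := by simpa using h
    simp only [T, h, h', dif_pos]
    rfl
  · rw [T_of_not_lt _ h, T_of_not_lt]
    simpa using h

theorem Sol.tail {L : ℕ} {d : Fin (L + 2) → ℕ} {D : Chain d} {p : ℕ → ℂ} (h : D.Sol p) :
    D.tail.Sol (fun j => p (j + 1)) := by
  intro j
  rw [T_tail]
  exact h j.succ

/-- A chain from its first two maps and the remaining ones. -/
def cons {L : ℕ} {d : Fin (L + 2) → ℕ} (φ : Matrix (Fin (d 0)) (Fin (d 1)) ℂ)
    (ψ : Matrix (Fin (d 1)) (Fin (d 0)) ℂ) (D : Chain (fun j => d j.succ)) : Chain d where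
  φ := Fin.cases φ D.φ
  ψ := Fin.cases ψ D.ψ

/-- The map into the initial node. -/
def φ₀ {L : ℕ} {d : Fin (L + 2) → ℕ} (D : Chain d) : Matrix (Fin (d 0)) (Fin (d 1)) ℂ := D.φ 0

/-- The map out of the initial node. -/
def ψ₀ {L : ℕ} {d : Fin (L + 2) → ℕ} (D : Chain d) : Matrix (Fin (d 1)) (Fin (d 0)) ℂ := D.ψ 0

theorem T_zero {L : ℕ} {d : Fin (L + 2) → ℕ} (D : Chain d) : D.T 0 = D.φ₀ * D.ψ₀ :=
  T_castSucc D 0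

/-- The contribution to the moment map at the first node after the initial one. -/
noncomputable def T₁ {L : ℕ} {d : Fin (L + 2) → ℕ} (D : Chain d) :
    Matrix (Fin (d 1)) (Fin (d 1)) ℂ := D.tail.T 0

theorem Sol.zero {L : ℕ} {d : Fin (L + 2) → ℕ} {D : Chain d} {p : ℕ → ℂ} (h : D.Sol p) :
    D.T₁ = D.ψ₀ * D.φ₀ + p 0 • 1 :=
  (T_tail D 0).trans (h 0).symm

/-- The dimensions of a chain, the initial node excluded. -/
def dims {L : ℕ} (d : Fin (L + 1) → ℕ) : List ℕ := List.ofFn fun j : Fin L => d j.succ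

theorem dims_succ {L : ℕ} (d : Fin (L + 2) → ℕ) : dims d = d 1 :: dims (fun j => d j.succ) := by
  rw [dims, List.ofFn_succ]
  rfl

theorem length_dims {L : ℕ} (d : Fin (L + 1) → ℕ) : (dims d).length = L := by simp [dims]

end Chain

theorem DistinctRoots.tail {p : ℕ → ℂ} {L : ℕ} (h : DistinctRoots p (L + 1)) :
    DistinctRoots (fun j => p (j + 1)) L := by
  intro a ha b hb hab
  have ha := Finset.mem_range.1 (Finset.mem_coe.1 ha)
  have hb := Finset.mem_range.1 (Finset.mem_coe.1 hb)
  have := h (x₁ := a + 1) (x₂ := b + 1) (Finset.mem_coe.2 (Finset.mem_range.2 (by omega)))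
    (Finset.mem_coe.2 (Finset.mem_range.2 (by omega)))
    (by rw [legRoot_succ', legRoot_succ', hab])
  omega

/-- The first root, 0, is not repeated: after the shift, `p 0` is not a root of the shortened leg.
This is what makes ψφ invertible at the first node. -/
theorem DistinctRoots.tail_ne {p : ℕ → ℂ} {L : ℕ} (h : DistinctRoots p (L + 1)) {l : ℕ}
    (hl : l ≤ L) : legRoot (fun j => p (j + 1)) l ≠ p 0 := by
  intro h0
  have := h (x₁ := l + 1) (x₂ := 0) (Finset.mem_coe.2 (Finset.mem_range.2 (by omega)))
    (Finset.mem_coe.2 (Finset.mem_range.2 (by omega)))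
    (by rw [legRoot_succ', legRoot_zero, h0, sub_self])
  omega

namespace Chain

theorem conj_mul_add {m n : ℕ} (g : GL (Fin m) ℂ) (k : GL (Fin n) ℂ)
    (φ : Matrix (Fin m) (Fin n) ℂ) (ψ : Matrix (Fin n) (Fin m) ℂ) (c : ℂ) :
    k.val * ψ * g⁻¹.val * (g.val * φ * k⁻¹.val) + c • 1 =
      k.val * (ψ * φ + c • 1) * k⁻¹.val := by
  have h1 : g⁻¹.val * g.val = 1 := Units.inv_mul g
  have h2 : k.val * k⁻¹.val = 1 := Units.mul_inv k
  rw [Matrix.mul_add, Matrix.add_mul, Matrix.mul_smul, Matrix.smul_mul, Matrix.mul_one, h2]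
  congr 1
  calc _ = k.val * ψ * (g⁻¹.val * g.val) * φ * k⁻¹.val := by simp only [Matrix.mul_assoc]
    _ = _ := by rw [h1, Matrix.mul_one]; simp only [Matrix.mul_assoc]

theorem isUnit_of_add_mem_legOrbit {n L : ℕ} {p : ℕ → ℂ} {dims : List ℕ} (hL : dims.length = L)
    (hξ : DistinctRoots p (L + 1)) {M : Matrix (Fin n) (Fin n) ℂ}
    (h : M + p 0 • 1 ∈ legOrbit dims (fun j => p (j + 1))) : IsUnit M := by
  have := isUnit_sub_of_mem_legOrbit h (c := p 0) fun l hl => hξ.tail_ne (hL ▸ hl)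
  rwa [add_sub_cancel_right] at this

/-- Induction from the far end of the leg. The equation at the first node puts ψφ + p₀ into the
orbit of the shortened leg, where p₀ is not an eigenvalue, so ψφ is invertible. Hence φ is
injective, ψ is surjective, and `mul_mem_legOrbit_cons` applies. No rank assumption on the chain is
needed. -/
theorem Sol.mem_legOrbit_and_isUnit {L : ℕ} {d : Fin (L + 1) → ℕ} {D : Chain d} {p : ℕ → ℂ}
    (h : D.Sol p) (hξ : DistinctRoots p L) :
    D.T 0 ∈ legOrbit (dims d) p ∧ ∀ j, IsUnit (D.ψ j * D.φ j) := by
  induction L generalizing p with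
  | zero => exact ⟨mem_legOrbit_nil.2 (T_of_not_lt _ (lt_irrefl _)), fun j => j.elim0⟩
  | succ L ih =>
    obtain ⟨h₁, h₂⟩ := ih h.tail hξ.tail
    change D.T₁ ∈ legOrbit (dims fun j => d j.succ) _ at h₁
    rw [h.zero] at h₁
    have hu : IsUnit (D.ψ₀ * D.φ₀) := isUnit_of_add_mem_legOrbit (length_dims _) hξ h₁
    refine ⟨?_, Fin.cases hu h₂⟩
    obtain ⟨φ', ψ', hφ, hψ⟩ := exists_leftInv_rightInv_of_isUnit hu
    rw [dims_succ, T_zero]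
    exact (mul_mem_legOrbit_cons hφ hψ).2 h₁

/-- Factor A through its image; the equation at the next node prescribes the matrix to be factored
there, again an orbit element. -/
theorem exists_sol {L : ℕ} {d : Fin (L + 1) → ℕ} {p : ℕ → ℂ}
    {A : Matrix (Fin (d 0)) (Fin (d 0)) ℂ} (hA : A ∈ legOrbit (dims d) p) :
    ∃ D : Chain d, D.Sol p ∧ D.T 0 = A := by
  induction L generalizing p with
  | zero =>
    refine ⟨⟨fun j => j.elim0, fun j => j.elim0⟩, fun j => j.elim0, ?_⟩
    rw [mem_legOrbit_nil.1 hA, T_of_not_lt _ (lt_irrefl _)]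
  | succ L ih =>
    rw [dims_succ] at hA
    obtain ⟨φ, ψ, φ', ψ', h, hφ, hψ⟩ :=
      exists_rank_factorization A (rank_of_mem_legOrbit_cons hA)
    rw [h, mul_mem_legOrbit_cons hφ hψ] at hA
    obtain ⟨D, hD, hT⟩ := ih (d := fun j => d j.succ) hA
    have ht : (cons φ ψ D).tail = D := rfl
    refine ⟨cons φ ψ D, ?_, ?_⟩
    · refine Fin.cases ?_ fun j => ?_
      · rw [← T_tail, ht]
        exact hT.symm
      · rw [← T_tail, ht]
        exact hD j
    · rw [h]
      exact T_zero (cons φ ψ D)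

/-- The base change found at one node by `exists_conj_of_mul_eq` conjugates ψφ, hence through the
moment equation the contribution of the remaining leg, and the induction continues with it. -/
theorem exists_conj {L : ℕ} {d : Fin (L + 1) → ℕ} {D D' : Chain d} {p : ℕ → ℂ}
    (h : D.Sol p) (h' : D'.Sol p) (hu : ∀ j, IsUnit (D.ψ j * D.φ j))
    (hu' : ∀ j, IsUnit (D'.ψ j * D'.φ j)) (g₀ : GL (Fin (d 0)) ℂ)
    (hg : D'.T 0 = g₀.val * D.T 0 * g₀⁻¹.val) :
    ∃ g : ∀ j, GL (Fin (d j)) ℂ, g 0 = g₀ ∧ ∀ j : Fin L,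
      D'.φ j = (g j.castSucc).val * D.φ j * (g j.succ)⁻¹.val ∧
      D'.ψ j = (g j.succ).val * D.ψ j * (g j.castSucc)⁻¹.val := by
  induction L generalizing p with
  | zero =>
    exact ⟨fun j => if hj : j = 0 then hj ▸ g₀ else 1, rfl, fun j => j.elim0⟩
  | succ L ih =>
    rw [T_zero, T_zero] at hg
    obtain ⟨k, hk₁, hk₂⟩ : ∃ k : GL (Fin (d 1)) ℂ, D'.φ₀ = g₀.val * D.φ₀ * k⁻¹.val ∧
        D'.ψ₀ = k.val * D.ψ₀ * g₀⁻¹.val := exists_conj_of_mul_eq g₀ (hu 0) (hu' 0) hg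
    have ht : D'.T₁ = k.val * D.T₁ * k⁻¹.val := by
      have h3 := conj_mul_add g₀ k D.φ₀ D.ψ₀ (p 0)
      rw [← h.zero, ← hk₁, ← hk₂, ← h'.zero] at h3
      exact h3
    obtain ⟨g, hg0, hgj⟩ := ih h.tail h'.tail (fun j => hu j.succ) (fun j => hu' j.succ) k ht
    refine ⟨Fin.cases g₀ g, rfl, Fin.cases ?_ fun j => hgj j⟩
    subst hg0
    exact ⟨hk₁, hk₂⟩

end Chain

end StarQuiver

/-! ### Star-shaped quivers as legs glued at the centre. -/

namespace StarQuiver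

open Matrix

set_option linter.unusedSectionVars false

namespace StarShape

variable {m : ℕ} (S : StarShape m)

/-- The central node. -/
def ctr : S.Node := (none : Option _)

/-- The nodes of the `i`-th leg, starting with the central node. -/
def nd (i : Fin m) : Fin ((S.leg i).length + 1) → S.Node :=
  Fin.cases S.ctr fun j => (some ⟨i, j⟩ : Option _)

/-- The `j`-th arrow of the `i`-th leg. -/
def arr (i : Fin m) : ∀ j : Fin (S.leg i).length, S.nd i j.succ ⟶ S.nd i j.castSucc
  | ⟨0, _⟩ => ⟨rfl⟩
  | ⟨_ + 1, _⟩ => ⟨⟨rfl, rfl⟩⟩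

/-- Induction on arrows. -/
def arrowRec {C : ∀ a b : S.Node, (a ⟶ b) → Type}
    (h : ∀ i j, C (S.nd i j.succ) (S.nd i j.castSucc) (S.arr i j)) :
    ∀ (a b : S.Node) (e : a ⟶ b), C a b e
  | some ⟨i, ⟨0, hj⟩⟩, none, _ => h i ⟨0, hj⟩
  | some ⟨_, ⟨_ + 1, _⟩⟩, none, ⟨e⟩ => absurd e (Nat.succ_ne_zero _)
  | some ⟨i, ⟨j, hj⟩⟩, some ⟨i', ⟨j', hj'⟩⟩, ⟨e⟩ => by
    have h₁ : i = i' := e.1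
    have h₂ : j = j' + 1 := e.2
    subst h₁
    subst h₂
    exact h i ⟨j' + 1, hj⟩

theorem arrowRec_arr {C : ∀ a b : S.Node, (a ⟶ b) → Type}
    (h : ∀ i j, C (S.nd i j.succ) (S.nd i j.castSucc) (S.arr i j)) (i : Fin m)
    (j : Fin (S.leg i).length) : S.arrowRec h _ _ (S.arr i j) = h i j := by
  obtain ⟨_ | j, hj⟩ := j <;> rfl

theorem arrow_induction {C : ∀ a b : S.Node, (a ⟶ b) → Prop}
    (h : ∀ i j, C (S.nd i j.succ) (S.nd i j.castSucc) (S.arr i j)) :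
    ∀ (a b : S.Node) (e : a ⟶ b), C a b e := fun a b e =>
  (S.arrowRec (C := fun a b e => PLift (C a b e)) (fun i j => ⟨h i j⟩) a b e).down

/-- The dimensions along the `i`-th leg. -/
def legDim (i : Fin m) (j : Fin ((S.leg i).length + 1)) : ℕ := S.dim (S.nd i j)

theorem dims_legDim (i : Fin m) : Chain.dims (S.legDim i) = S.leg i := by
  rw [Chain.dims]
  exact List.ofFn_get (S.leg i)

variable {S}

/-- The restriction of a representation to the `i`-th leg. -/
def chain (x : Coord S.dim → ℂ) (i : Fin m) : Chain (S.legDim i) where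
  φ j := fwd x (S.arr i j)
  ψ j := bwd x (S.arr i j)

/-- The representation with given restrictions to the legs. -/
def ofChains (D : ∀ i, Chain (S.legDim i)) : Coord S.dim → ℂ
  | ⟨a, b, e, Sum.inl s⟩ => S.arrowRec (C := fun a b _ => Matrix (Fin (S.dim b)) (Fin (S.dim a)) ℂ)
      (fun i j => (D i).φ j) a b e s.1 s.2
  | ⟨a, b, e, Sum.inr s⟩ => S.arrowRec (C := fun a b _ => Matrix (Fin (S.dim a)) (Fin (S.dim b)) ℂ)
      (fun i j => (D i).ψ j) a b e s.1 s.2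

theorem chain_ofChains (D : ∀ i, Chain (S.legDim i)) (i : Fin m) : chain (ofChains D) i = D i := by
  have h1 : (chain (ofChains D) i).φ = (D i).φ := by
    funext j
    ext a b
    exact congrFun (congrFun (S.arrowRec_arr
      (C := fun a b _ => Matrix (Fin (S.dim b)) (Fin (S.dim a)) ℂ) (fun i j => (D i).φ j) i j) a) b
  have h2 : (chain (ofChains D) i).ψ = (D i).ψ := by
    funext j
    ext a b
    exact congrFun (congrFun (S.arrowRec_arr
      (C := fun a b _ => Matrix (Fin (S.dim a)) (Fin (S.dim b)) ℂ) (fun i j => (D i).ψ j) i j) a) b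
  cases h : chain (ofChains D) i
  cases h' : D i
  simp only [h, h'] at h1 h2
  rw [h1, h2]

theorem ext_of_chain {x y : Coord S.dim → ℂ}
    (h : ∀ i j, (chain x i).φ j = (chain y i).φ j ∧ (chain x i).ψ j = (chain y i).ψ j) : x = y :=
  coord_ext (S.arrow_induction fun i j => (h i j).1) (S.arrow_induction fun i j => (h i j).2)

theorem eq_nd_castSucc {i : Fin m} {j : Fin (S.leg i).length} :
    ∀ {b : S.Node}, (S.nd i j.succ ⟶ b) → b = S.nd i j.castSucc
  | none, ⟨e⟩ => by
    obtain ⟨j, hj⟩ := j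
    change j = 0 at e
    subst e
    rfl
  | some ⟨i', ⟨j', hj'⟩⟩, ⟨e⟩ => by
    obtain ⟨j, hj⟩ := j
    obtain ⟨rfl, h⟩ := e
    change j = j' + 1 at h
    subst h
    rfl

theorem sum_arrow_from {M : Type} [AddCommMonoid M] (i : Fin m) (j : Fin (S.leg i).length)
    (F : ∀ b : S.Node, (S.nd i j.succ ⟶ b) → M) :
    ∑ b : S.Node, ∑ e : S.nd i j.succ ⟶ b, F b e = F _ (S.arr i j) := by
  classical
  rw [Finset.sum_eq_single (S.nd i j.castSucc)]
  · exact Fintype.sum_subsingleton _ (S.arr i j)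
  · intro b _ hb
    have : IsEmpty (S.nd i j.succ ⟶ b) := ⟨fun e => hb (eq_nd_castSucc e)⟩
    simp
  · simp

theorem sum_node {M : Type} [AddCommMonoid M] (F : S.Node → M) :
    ∑ a : S.Node, F a = F S.ctr + ∑ i, ∑ j, F (S.nd i (Fin.succ j)) := by
  rw [← Fintype.sum_sigma' (f := fun i j => F (S.nd i (Fin.succ j)))]
  exact Fintype.sum_option F

theorem sum_arrow {M : Type} [AddCommMonoid M] (F : ∀ a b : S.Node, (a ⟶ b) → M) :
    ∑ a : S.Node, ∑ b : S.Node, ∑ e : a ⟶ b, F a b e =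
      ∑ i, ∑ j, F _ _ (S.arr i j) := by
  rw [sum_node]
  have h : ∀ b : S.Node, IsEmpty (S.ctr ⟶ b) := fun b => ⟨fun e => e.down⟩
  have h0 : ∑ b : S.Node, ∑ e : S.ctr ⟶ b, F _ b e = 0 :=
    Finset.sum_eq_zero fun b _ => by
      have := h b
      exact Fintype.sum_empty _
  rw [h0, zero_add]
  exact Finset.sum_congr rfl fun i _ => Finset.sum_congr rfl fun j _ => sum_arrow_from i j _

theorem sum_arrow_to {M : Type} [AddCommMonoid M] (b : S.Node) (F : ∀ a : S.Node, (a ⟶ b) → M) :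
    ∑ a : S.Node, ∑ e : a ⟶ b, F a e =
      ∑ i, ∑ j : Fin (S.leg i).length, ∑ e : S.nd i j.succ ⟶ b, F _ e := by
  rw [sum_node]
  have h : IsEmpty (S.ctr ⟶ b) := ⟨fun e => e.down⟩
  have h0 : ∑ e : S.ctr ⟶ b, F _ e = 0 := Fintype.sum_empty _
  rw [h0, zero_add]

theorem moment_nd_succ (x : Coord S.dim → ℂ) (i : Fin m) (j : Fin (S.leg i).length) :
    moment x (S.nd i j.succ) = (chain x i).T j.succ - (chain x i).ψ j * (chain x i).φ j := by
  rw [moment]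
  congr 1
  · rw [sum_arrow_to, Finset.sum_eq_single i]
    · by_cases h : j.val + 1 < (S.leg i).length
      · have h' : j.succ.val < (S.leg i).length := h
        simp only [Chain.T, h', dif_pos]
        rw [Finset.sum_eq_single ⟨j.val + 1, h⟩]
        · exact Fintype.sum_subsingleton _ (S.arr i ⟨j.val + 1, h⟩)
        · intro j' _ hj'
          have : IsEmpty (S.nd i j'.succ ⟶ S.nd i j.succ) := ⟨fun e => hj' (Fin.ext e.down.2)⟩
          exact Fintype.sum_empty _
        · intro h0
          exact absurd (Finset.mem_univ _) h0
      · rw [Chain.T_of_not_lt _ h]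
        refine Finset.sum_eq_zero fun j' _ => ?_
        have : IsEmpty (S.nd i j'.succ ⟶ S.nd i j.succ) :=
          ⟨fun e => h (lt_of_le_of_lt (le_of_eq e.down.2.symm) j'.2)⟩
        exact Fintype.sum_empty _
    · intro i' _ hi'
      refine Finset.sum_eq_zero fun j' _ => ?_
      have : IsEmpty (S.nd i' j'.succ ⟶ S.nd i j.succ) := ⟨fun e => hi' e.down.1⟩
      exact Fintype.sum_empty _
    · intro h0
      exact absurd (Finset.mem_univ _) h0
  · exact sum_arrow_from i j _

/-- The contribution of the `i`-th leg to the moment map at the central node. -/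
noncomputable def resid (x : Coord S.dim → ℂ) (i : Fin m) :
    Matrix (Fin S.center) (Fin S.center) ℂ := (chain x i).T 0

theorem moment_center (x : Coord S.dim → ℂ) :
    moment x S.ctr = ∑ i, resid x i := by
  rw [moment]
  have h2 : ∑ b : S.Node, ∑ e : S.ctr ⟶ b, bwd x e * fwd x e = 0 :=
    Finset.sum_eq_zero fun b _ => by
      have : IsEmpty (S.ctr ⟶ b) := ⟨fun e => e.down⟩
      exact Fintype.sum_empty _
  rw [h2, sub_zero, sum_arrow_to]
  refine Finset.sum_congr rfl fun i _ => ?_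
  change _ = (chain x i).T 0
  by_cases h : 0 < (S.leg i).length
  · have h' : (0 : Fin ((S.leg i).length + 1)).val < (S.leg i).length := h
    simp only [Chain.T, h', dif_pos]
    rw [Finset.sum_eq_single ⟨0, h⟩]
    · exact Fintype.sum_subsingleton _ (S.arr i ⟨0, h⟩)
    · intro j' _ hj'
      have : IsEmpty (S.nd i j'.succ ⟶ S.ctr) :=
        ⟨fun e => hj' (Fin.ext e.down)⟩
      exact Fintype.sum_empty _
    · intro h0
      exact absurd (Finset.mem_univ _) h0
  · rw [Chain.T_of_not_lt _ h]
    refine Finset.sum_eq_zero fun j' _ => ?_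
    exact absurd (lt_of_le_of_lt (Nat.zero_le _) j'.2) h

/-- The moment equations decouple into one system per leg, tied together only by the equation at the
centre. -/
theorem mem_level_iff {lam : S.Node → ℂ} {x : Coord S.dim → ℂ} :
    x ∈ (quiverVariety S.dim lam).level ↔
      (∀ i, (chain x i).Sol (legParam lam i)) ∧
        ∑ i, resid x i = lam S.ctr • 1 := by
  have hp : ∀ i (j : Fin (S.leg i).length), legParam lam i j = lam (S.nd i j.succ) := by
    intro i j
    rw [legParam, dif_pos j.2]
    rfl
  constructor
  · intro h
    refine ⟨fun i j => ?_, ?_⟩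
    · have := h (S.nd i j.succ)
      rw [moment_nd_succ] at this
      rw [hp]
      exact (sub_eq_iff_eq_add'.1 this).symm
    · rw [← moment_center]
      exact h _
  · rintro ⟨h₁, h₂⟩ a
    rcases a with _ | ⟨i, j⟩
    · exact (moment_center x).trans h₂
    · refine (moment_nd_succ x i j).trans (sub_eq_iff_eq_add'.2 ?_)
      have := h₁ i j
      rw [hp] at this
      exact this.symm

/-- The element of the gauge group with given components along the legs. -/
def glue (g₀ : GL (Fin S.center) ℂ) (g : ∀ i j, GL (Fin (S.legDim i j)) ℂ) :
    ∀ a : S.Node, GL (Fin (S.dim a)) ℂ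
  | none => g₀
  | some ⟨i, j⟩ => g i j.succ

theorem glue_nd {g₀ : GL (Fin S.center) ℂ} {g : ∀ i j, GL (Fin (S.legDim i j)) ℂ}
    (h : ∀ i, g i 0 = g₀) (i : Fin m) (j : Fin ((S.leg i).length + 1)) :
    glue g₀ g (S.nd i j) = g i j := by
  refine Fin.cases ?_ (fun j => ?_) j
  · exact (h i).symm
  · rfl

theorem chain_quiverAct_glue {g₀ : GL (Fin S.center) ℂ} {g : ∀ i j, GL (Fin (S.legDim i j)) ℂ}
    (h : ∀ i, g i 0 = g₀) (x : Coord S.dim → ℂ) (i : Fin m) (j : Fin (S.leg i).length) :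
    (chain (quiverAct (glue g₀ g) x) i).φ j =
      (g i j.castSucc).val * (chain x i).φ j * (g i j.succ)⁻¹.val ∧
    (chain (quiverAct (glue g₀ g) x) i).ψ j =
      (g i j.succ).val * (chain x i).ψ j * (g i j.castSucc)⁻¹.val := by
  refine ⟨(fwd_quiverAct _ _ _).trans ?_, (bwd_quiverAct _ _ _).trans ?_⟩ <;>
    rw [glue_nd h, glue_nd h] <;> rfl

/-- All the `ξ`'s attached to each leg are distinct. -/
def Generic (lam : S.Node → ℂ) : Prop :=
  ∀ i, DistinctRoots (legParam lam i) (S.leg i).length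

/-- Each leg supplies its own base changes, all starting from the same g₀, so they glue. Thus
contributions at the centre, up to simultaneous conjugation, classify gauge orbits in the level set.
-/
theorem exists_quiverAct_eq {lam : S.Node → ℂ} (hgen : Generic lam) {x y : Coord S.dim → ℂ}
    (hx : x ∈ (quiverVariety S.dim lam).level) (hy : y ∈ (quiverVariety S.dim lam).level)
    (g₀ : GL (Fin S.center) ℂ)
    (h : ∀ i, resid y i = g₀.val * resid x i * g₀⁻¹.val) :
    ∃ g : ∀ a : S.Node, GL (Fin (S.dim a)) ℂ, g S.ctr = g₀ ∧ y = quiverAct g x := by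
  rw [mem_level_iff] at hx hy
  have : ∀ i, ∃ g : ∀ j, GL (Fin (S.legDim i j)) ℂ, g 0 = g₀ ∧ ∀ j : Fin (S.leg i).length,
      (chain y i).φ j = (g j.castSucc).val * (chain x i).φ j * (g j.succ)⁻¹.val ∧
      (chain y i).ψ j = (g j.succ).val * (chain x i).ψ j * (g j.castSucc)⁻¹.val := fun i =>
    Chain.exists_conj (hx.1 i) (hy.1 i) ((hx.1 i).mem_legOrbit_and_isUnit (hgen i)).2
      ((hy.1 i).mem_legOrbit_and_isUnit (hgen i)).2 g₀ (h i)
  choose g hg0 hg using this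
  refine ⟨glue g₀ g, rfl, ext_of_chain fun i j => ?_⟩
  rw [(chain_quiverAct_glue hg0 x i j).1, (chain_quiverAct_glue hg0 x i j).2]
  exact hg i j

theorem chain_T_mem_legOrbit {lam : S.Node → ℂ} (hgen : Generic lam) {x : Coord S.dim → ℂ}
    (hx : x ∈ (quiverVariety S.dim lam).level) (i : Fin m) :
    resid x i ∈ legOrbit (S.leg i) (legParam lam i) := by
  have := (((mem_level_iff.1 hx).1 i).mem_legOrbit_and_isUnit (hgen i)).1
  rwa [dims_legDim] at this

/-- The legs are solved independently; the condition on the sum is precisely the equation at the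
centre. -/
theorem exists_mem_level {lam : S.Node → ℂ}
    {A : Fin m → Matrix (Fin S.center) (Fin S.center) ℂ}
    (hA : ∀ i, A i ∈ legOrbit (S.leg i) (legParam lam i))
    (hsum : ∑ i, A i = lam S.ctr • 1) :
    ∃ x ∈ (quiverVariety S.dim lam).level, ∀ i, resid x i = A i := by
  have : ∀ i, ∃ D : Chain (S.legDim i), D.Sol (legParam lam i) ∧ D.T 0 = A i := fun i =>
    Chain.exists_sol (by rw [dims_legDim]; exact hA i)
  choose D hD hT using this
  refine ⟨ofChains D, mem_level_iff.2 ⟨fun i => ?_, ?_⟩, fun i => ?_⟩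
  · rw [chain_ofChains]
    exact hD i
  · simp only [resid, chain_ofChains, hT]
    exact hsum
  · rw [resid, chain_ofChains, hT]

end StarShape

end StarQuiver

/-! ### Local sections of the contribution map, and orbit closures. -/

namespace StarQuiver

open Matrix Filter Topology

set_option linter.unusedSectionVars false

namespace Chain

variable {L : ℕ} {d : Fin (L + 1) → ℕ}

/-- The chain obtained by changing bases; `b` is supposed to be inverse to `a`. -/
def twist (D : Chain d) (a b : ∀ j, Matrix (Fin (d j)) (Fin (d j)) ℂ) : Chain d where
  φ j := a j.castSucc * D.φ j * b j.succ
  ψ j := a j.succ * D.ψ j * b j.castSucc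

theorem T_twist (D : Chain d) {a b : ∀ j, Matrix (Fin (d j)) (Fin (d j)) ℂ}
    (hab : ∀ j, b j * a j = 1) (j : Fin (L + 1)) : (D.twist a b).T j = a j * D.T j * b j := by
  by_cases h : j.val < L
  · obtain ⟨i, rfl⟩ : ∃ i : Fin L, j = i.castSucc := ⟨⟨j, h⟩, rfl⟩
    rw [T_castSucc, T_castSucc]
    calc _ = a i.castSucc * D.φ i * (b i.succ * a i.succ) * D.ψ i * b i.castSucc := by
          simp only [twist, Matrix.mul_assoc]
      _ = _ := by rw [hab, Matrix.mul_one]; simp only [Matrix.mul_assoc]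
  · rw [T_of_not_lt _ h, T_of_not_lt _ h, Matrix.mul_zero, Matrix.zero_mul]

theorem Sol.twist {D : Chain d} {p : ℕ → ℂ} (h : D.Sol p)
    {a b : ∀ j, Matrix (Fin (d j)) (Fin (d j)) ℂ} (hab : ∀ j, b j * a j = 1) :
    (D.twist a b).Sol p := by
  intro j
  have hba : a j.succ * b j.succ = 1 := mul_eq_one_comm.1 (hab _)
  rw [T_twist D hab, ← h j, Matrix.mul_add, Matrix.add_mul, Matrix.mul_smul, Matrix.smul_mul,
    Matrix.mul_one, hba]
  congr 1
  calc _ = a j.succ * D.ψ j * (b j.castSucc * a j.castSucc) * D.φ j * b j.succ := by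
        simp only [Chain.twist, Matrix.mul_assoc]
    _ = _ := by rw [hab, Matrix.mul_one]; simp only [Matrix.mul_assoc]

/-- The family of matrices that is `u` at the initial node and the identity elsewhere. -/
noncomputable def atTop (u : Matrix (Fin (d 0)) (Fin (d 0)) ℂ) (j : Fin (L + 1)) :
    Matrix (Fin (d j)) (Fin (d j)) ℂ :=
  Function.update (β := fun j => Matrix (Fin (d j)) (Fin (d j)) ℂ) (fun _ => 1) 0 u j

theorem atTop_zero (u : Matrix (Fin (d 0)) (Fin (d 0)) ℂ) : atTop u 0 = u :=
  Function.update_self _ _ _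

theorem atTop_of_ne (u : Matrix (Fin (d 0)) (Fin (d 0)) ℂ) {j : Fin (L + 1)} (hj : j ≠ 0) :
    atTop u j = 1 := Function.update_of_ne hj _ _

theorem atTop_one (j : Fin (L + 1)) : atTop (1 : Matrix (Fin (d 0)) (Fin (d 0)) ℂ) j = 1 := by
  by_cases hj : j = 0
  · subst hj
    exact atTop_zero _
  · exact atTop_of_ne _ hj

theorem atTop_mul_atTop {u v : Matrix (Fin (d 0)) (Fin (d 0)) ℂ} (h : u * v = 1)
    (j : Fin (L + 1)) : atTop u j * atTop v j = 1 := by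
  by_cases hj : j = 0
  · subst hj
    rw [atTop_zero, atTop_zero, h]
  · rw [atTop_of_ne _ hj, atTop_of_ne _ hj, Matrix.mul_one]

theorem T_twist_atTop (D : Chain d) {u v : Matrix (Fin (d 0)) (Fin (d 0)) ℂ} (h : v * u = 1) :
    (D.twist (atTop u) (atTop v)).T 0 = u * D.T 0 * v := by
  rw [T_twist D (atTop_mul_atTop h), atTop_zero, atTop_zero]

theorem tendsto_atTop {α : Type} {l : Filter α} {u : α → Matrix (Fin (d 0)) (Fin (d 0)) ℂ}
    {v : Matrix (Fin (d 0)) (Fin (d 0)) ℂ} (h : Tendsto u l (𝓝 v)) (j : Fin (L + 1)) :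
    Tendsto (fun t => atTop (u t) j) l (𝓝 (atTop v j)) := by
  by_cases hj : j = 0
  · subst hj
    simpa only [atTop_zero] using h
  · simp only [atTop_of_ne _ hj]
    exact tendsto_const_nhds

end Chain

theorem continuous_intertwiner {ι : Type} [Fintype ι] [DecidableEq ι] (p : ℕ → ℂ) (L : ℕ)
    (B : Matrix ι ι ℂ) : Continuous fun A => intertwiner p L A B := by
  unfold intertwiner
  exact continuous_finsetSum _ fun l _ =>
    (Polynomial.continuous_aeval _).matrix_mul continuous_const

theorem tendsto_matrix_inv {ι α : Type} [Fintype ι] [DecidableEq ι] {l : Filter α}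
    {u : α → Matrix ι ι ℂ} {v : Matrix ι ι ℂ} (h : Tendsto u l (𝓝 v)) (hv : v.det ≠ 0) :
    Tendsto (fun t => (u t)⁻¹) l (𝓝 v⁻¹) := by
  simp only [Matrix.inv_def, Ring.inverse_eq_inv']
  have h1 : Continuous fun M : Matrix ι ι ℂ => M.det := continuous_id.matrix_det
  have h2 : Continuous fun M : Matrix ι ι ℂ => M.adjugate := continuous_id.matrix_adjugate
  exact Tendsto.smul (((h1.tendsto _).comp h).inv₀ hv) ((h2.tendsto _).comp h)

namespace StarShape

variable {m : ℕ} {S : StarShape m} {lam : S.Node → ℂ}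

/-- The comparison matrix between the `i`-th entry of a tuple and the one coming from `z`. -/
noncomputable def legTwist (lam : S.Node → ℂ) (z : Coord S.dim → ℂ)
    (A : Fin m → Matrix (Fin S.center) (Fin S.center) ℂ) (i : Fin m) :
    Matrix (Fin S.center) (Fin S.center) ℂ :=
  intertwiner (legParam lam i) (S.leg i).length (A i) (resid z i)

/-- A local section of `resid` around `z`. -/
noncomputable def sect (lam : S.Node → ℂ) (z : Coord S.dim → ℂ)
    (A : Fin m → Matrix (Fin S.center) (Fin S.center) ℂ) : Coord S.dim → ℂ :=
  ofChains fun i => (chain z i).twist (Chain.atTop (d := S.legDim i) (legTwist lam z A i))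
    (Chain.atTop (d := S.legDim i) (legTwist lam z A i)⁻¹)

theorem aeval_resid_eq_zero (hgen : Generic lam) {x : Coord S.dim → ℂ}
    (hx : x ∈ (quiverVariety S.dim lam).level) (i : Fin m) :
    Polynomial.aeval (resid x i) (legPoly (legParam lam i) ((S.leg i).length + 1)) = 0 :=
  aeval_legPoly_eq_zero (chain_T_mem_legOrbit hgen hx i)

theorem legTwist_self (hgen : Generic lam) {z : Coord S.dim → ℂ}
    (hz : z ∈ (quiverVariety S.dim lam).level) (i : Fin m) : legTwist lam z (resid z) i = 1 :=
  intertwiner_self (hgen i) (aeval_resid_eq_zero hgen hz i)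

/-- `sect` changes the basis of the centre by a different intertwiner on each leg, which is not a
gauge transformation; the intertwining relation says that the result on leg i is A i. -/
theorem resid_sect (hgen : Generic lam) {z : Coord S.dim → ℂ}
    (hz : z ∈ (quiverVariety S.dim lam).level)
    {A : Fin m → Matrix (Fin S.center) (Fin S.center) ℂ}
    (hA : ∀ i, A i ∈ legOrbit (S.leg i) (legParam lam i))
    (hdet : ∀ i, (legTwist lam z A i).det ≠ 0) (i : Fin m) : resid (sect lam z A) i = A i := by
  have hu : (legTwist lam z A i)⁻¹ * legTwist lam z A i = 1 :=
    Matrix.nonsing_inv_mul _ (isUnit_iff_ne_zero.2 (hdet i))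
  rw [resid, sect, chain_ofChains]
  refine (Chain.T_twist_atTop (chain z i) hu).trans ?_
  have h1 : A i * legTwist lam z A i = legTwist lam z A i * resid z i :=
    mul_intertwiner (hgen i) (aeval_legPoly_eq_zero (hA i)) (aeval_resid_eq_zero hgen hz i)
  change legTwist lam z A i * resid z i * (legTwist lam z A i)⁻¹ = A i
  rw [← h1, Matrix.mul_assoc, mul_eq_one_comm.1 hu, Matrix.mul_one]

/-- Twisting at the top preserves the equations at the other nodes, so only the sum at the centre
has to be assumed. -/
theorem sect_mem_level (hgen : Generic lam) {z : Coord S.dim → ℂ}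
    (hz : z ∈ (quiverVariety S.dim lam).level)
    {A : Fin m → Matrix (Fin S.center) (Fin S.center) ℂ}
    (hA : ∀ i, A i ∈ legOrbit (S.leg i) (legParam lam i))
    (hsum : ∑ i, A i = lam S.ctr • 1)
    (hdet : ∀ i, (legTwist lam z A i).det ≠ 0) :
    sect lam z A ∈ (quiverVariety S.dim lam).level := by
  rw [mem_level_iff]
  constructor
  · intro i
    have hu : (legTwist lam z A i)⁻¹ * legTwist lam z A i = 1 :=
      Matrix.nonsing_inv_mul _ (isUnit_iff_ne_zero.2 (hdet i))
    rw [sect, chain_ofChains]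
    exact ((mem_level_iff.1 hz).1 i).twist (Chain.atTop_mul_atTop hu)
  · rw [← hsum]
    exact Finset.sum_congr rfl fun i _ => resid_sect hgen hz hA hdet i

theorem tendsto_coord {α : Type} {l : Filter α} {x : α → Coord S.dim → ℂ} {z : Coord S.dim → ℂ}
    (h : ∀ i j, Tendsto (fun t => (chain (x t) i).φ j) l (𝓝 ((chain z i).φ j)) ∧
      Tendsto (fun t => (chain (x t) i).ψ j) l (𝓝 ((chain z i).ψ j))) :
    Tendsto x l (𝓝 z) := by
  have h1 : ∀ (a b : S.Node) (e : a ⟶ b), Tendsto (fun t => fwd (x t) e) l (𝓝 (fwd z e)) :=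
    S.arrow_induction fun i j => (h i j).1
  have h2 : ∀ (a b : S.Node) (e : a ⟶ b), Tendsto (fun t => bwd (x t) e) l (𝓝 (bwd z e)) :=
    S.arrow_induction fun i j => (h i j).2
  rw [tendsto_pi_nhds]
  rintro ⟨a, b, e, ⟨s, t⟩ | ⟨s, t⟩⟩
  · exact tendsto_pi_nhds.1 (tendsto_pi_nhds.1 (h1 a b e) s) t
  · exact tendsto_pi_nhds.1 (tendsto_pi_nhds.1 (h2 a b e) s) t

theorem tendsto_legTwist (hgen : Generic lam) {z : Coord S.dim → ℂ}
    (hz : z ∈ (quiverVariety S.dim lam).level) {α : Type} {l : Filter α}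
    {A : α → Fin m → Matrix (Fin S.center) (Fin S.center) ℂ}
    (hA : ∀ i, Tendsto (fun t => A t i) l (𝓝 (resid z i))) (i : Fin m) :
    Tendsto (fun t => legTwist lam z (A t) i) l (𝓝 1) := by
  rw [← legTwist_self hgen hz i]
  exact ((continuous_intertwiner _ _ _).tendsto _).comp (hA i)

theorem tendsto_sect (hgen : Generic lam) {z : Coord S.dim → ℂ}
    (hz : z ∈ (quiverVariety S.dim lam).level) {α : Type} {l : Filter α}
    {A : α → Fin m → Matrix (Fin S.center) (Fin S.center) ℂ}
    (hA : ∀ i, Tendsto (fun t => A t i) l (𝓝 (resid z i))) :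
    Tendsto (fun t => sect lam z (A t)) l (𝓝 z) := by
  refine tendsto_coord fun i j => ?_
  have h1 := tendsto_legTwist hgen hz hA i
  have h2 := tendsto_matrix_inv h1 (by simp)
  rw [inv_one] at h2
  have h3 := fun j => Chain.tendsto_atTop (d := S.legDim i) h1 j
  have h4 := fun j => Chain.tendsto_atTop (d := S.legDim i) h2 j
  -- The limit point is written as its own twist by the identity, so that the limit can be taken
  -- factor by factor.
  have e1 : (chain z i).φ j = Chain.atTop (d := S.legDim i) 1 j.castSucc * (chain z i).φ j *
      Chain.atTop (d := S.legDim i) 1 j.succ := by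
    rw [Chain.atTop_one, Chain.atTop_one, Matrix.one_mul, Matrix.mul_one]
  have e2 : (chain z i).ψ j = Chain.atTop (d := S.legDim i) 1 j.succ * (chain z i).ψ j *
      Chain.atTop (d := S.legDim i) 1 j.castSucc := by
    rw [Chain.atTop_one, Chain.atTop_one, Matrix.one_mul, Matrix.mul_one]
  have cm : ∀ {a b c : ℕ}, Continuous fun M : Matrix (Fin a) (Fin b) ℂ × Matrix (Fin b) (Fin c) ℂ =>
      M.1 * M.2 := continuous_fst.matrix_mul continuous_snd
  have tm : ∀ {a b c : ℕ} {M : α → Matrix (Fin a) (Fin b) ℂ} {N : α → Matrix (Fin b) (Fin c) ℂ}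
      {M' N'}, Tendsto M l (𝓝 M') → Tendsto N l (𝓝 N') →
      Tendsto (fun t => M t * N t) l (𝓝 (M' * N')) := fun hM hN =>
    (cm.tendsto _).comp (hM.prodMk_nhds hN)
  simp only [sect, chain_ofChains]
  constructor
  · rw [e1]
    exact tm (tm (h3 _) tendsto_const_nhds) (h4 _)
  · rw [e2]
    exact tm (tm (h3 _) tendsto_const_nhds) (h4 _)

/-- Degenerations only have to be checked on contributions at the centre. The values of `sect` at
the conjugated tuples converge to z, and eventually they lie in the level set with contributions
conjugate to those of x; by `exists_quiverAct_eq` they are then in the orbit of x. The base changes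
at the other nodes never need to be controlled. -/
theorem mem_closure_orbit (hgen : Generic lam) {x z : Coord S.dim → ℂ}
    (hx : x ∈ (quiverVariety S.dim lam).level) (hz : z ∈ (quiverVariety S.dim lam).level)
    {α : Type} {l : Filter α} [l.NeBot] (g : α → GL (Fin S.center) ℂ)
    (h : ∀ i, Tendsto (fun t => (g t).val * resid x i * (g t)⁻¹.val) l (𝓝 (resid z i))) :
    z ∈ closure (Set.range fun g => (quiverVariety S.dim lam).act g x) := by
  refine mem_closure_of_tendsto (tendsto_sect hgen hz (A := fun t i =>
    (g t).val * resid x i * (g t)⁻¹.val) h) ?_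
  have hdet : ∀ i, ∀ᶠ t in l, (legTwist lam z (fun i =>
      (g t).val * resid x i * (g t)⁻¹.val) i).det ≠ 0 := by
    intro i
    have hc : Continuous fun M : Matrix (Fin S.center) (Fin S.center) ℂ => M.det :=
      continuous_id.matrix_det
    refine ((hc.tendsto _).comp (tendsto_legTwist hgen hz (A := fun t i =>
      (g t).val * resid x i * (g t)⁻¹.val) h i)).eventually_ne ?_
    simp
  filter_upwards [eventually_all.2 hdet] with t ht
  have hgi : (g t)⁻¹.val * (g t).val = 1 := Units.inv_mul _
  have hig : (g t).val * (g t)⁻¹.val = 1 := Units.mul_inv _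
  have hA : ∀ i, (g t).val * resid x i * (g t)⁻¹.val ∈ legOrbit (S.leg i) (legParam lam i) :=
    fun i => mem_legOrbit_of_conj (u := (g t)⁻¹.val) (v := (g t).val) hig hgi
      (by simp only [← Matrix.mul_assoc]; rw [hgi, Matrix.one_mul])
      (chain_T_mem_legOrbit hgen hx i)
  have hsum : ∑ i, (g t).val * resid x i * (g t)⁻¹.val = lam S.ctr • 1 := by
    rw [← Finset.sum_mul, ← Finset.mul_sum, (mem_level_iff.1 hx).2, Matrix.mul_smul,
      Matrix.smul_mul, Matrix.mul_one, hig]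
  have hs := sect_mem_level hgen hz hA hsum ht
  obtain ⟨k, -, hk⟩ := exists_quiverAct_eq hgen hx hs (g t) fun i => resid_sect hgen hz hA ht i
  exact ⟨k, hk.symm⟩

end StarShape

end StarQuiver

/-! ### The pair (P, Q) between the centre and the sum of the adjacent nodes. -/

namespace StarQuiver

open Matrix Filter Topology

set_option linter.unusedSectionVars false

namespace StarShape

variable {k : ℕ} {S : StarShape (k + 1)} {lam : S.Node → ℂ}

/-! ### Blocks -/

/-- The `i`-th block of columns. -/
def colBlock {α : Type} (P : Matrix α S.BlockIndex ℂ) (i : Fin k) :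
    Matrix α (Fin (S.adjDim i.castSucc)) ℂ := Matrix.of fun a b => P a ⟨i, b⟩

/-- The `i`-th block of rows. -/
def rowBlock {α : Type} (Q : Matrix S.BlockIndex α ℂ) (i : Fin k) :
    Matrix (Fin (S.adjDim i.castSucc)) α ℂ := Matrix.of fun b a => Q ⟨i, b⟩ a

theorem ext_colBlock {α : Type} {P P' : Matrix α S.BlockIndex ℂ}
    (h : ∀ i, colBlock P i = colBlock P' i) : P = P' := by
  ext a ⟨i, b⟩
  exact congrFun (congrFun (h i) a) b

theorem ext_rowBlock {α : Type} {Q Q' : Matrix S.BlockIndex α ℂ}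
    (h : ∀ i, rowBlock Q i = rowBlock Q' i) : Q = Q' := by
  ext ⟨i, b⟩ a
  exact congrFun (congrFun (h i) b) a

theorem mul_eq_sum_blocks {α β : Type} (P : Matrix α S.BlockIndex ℂ)
    (Q : Matrix S.BlockIndex β ℂ) : P * Q = ∑ i, colBlock P i * rowBlock Q i := by
  ext a b
  rw [Matrix.mul_apply, Fintype.sum_sigma, Matrix.sum_apply]
  rfl

theorem colBlock_mul {α β : Type} [Fintype β] (M : Matrix α β ℂ) (P : Matrix β S.BlockIndex ℂ)
    (i : Fin k) : colBlock (M * P) i = M * colBlock P i := rfl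

theorem rowBlock_mul {α β : Type} [Fintype β] (Q : Matrix S.BlockIndex β ℂ) (M : Matrix β α ℂ)
    (i : Fin k) : rowBlock (Q * M) i = rowBlock Q i * M := rfl

theorem colBlock_mul_blockDiagonal' {α : Type} (P : Matrix α S.BlockIndex ℂ)
    (M : ∀ i : Fin k, Matrix (Fin (S.adjDim i.castSucc)) (Fin (S.adjDim i.castSucc)) ℂ)
    (i : Fin k) : colBlock (P * Matrix.blockDiagonal' M) i = colBlock P i * M i := by
  ext a b
  change (P * Matrix.blockDiagonal' M) a ⟨i, b⟩ = _
  rw [Matrix.mul_apply, Fintype.sum_sigma, Finset.sum_eq_single i]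
  · rw [Matrix.mul_apply]
    refine Finset.sum_congr rfl fun c _ => ?_
    rw [Matrix.blockDiagonal'_apply_eq]
    rfl
  · intro j _ hj
    refine Finset.sum_eq_zero fun c _ => ?_
    rw [Matrix.blockDiagonal'_apply_ne _ _ _ hj, mul_zero]
  · intro h
    exact absurd (Finset.mem_univ _) h

theorem rowBlock_blockDiagonal'_mul {α : Type} (Q : Matrix S.BlockIndex α ℂ)
    (M : ∀ i : Fin k, Matrix (Fin (S.adjDim i.castSucc)) (Fin (S.adjDim i.castSucc)) ℂ)
    (i : Fin k) : rowBlock (Matrix.blockDiagonal' M * Q) i = M i * rowBlock Q i := by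
  ext b a
  change (Matrix.blockDiagonal' M * Q) ⟨i, b⟩ a = _
  rw [Matrix.mul_apply, Fintype.sum_sigma, Finset.sum_eq_single i]
  · rw [Matrix.mul_apply]
    refine Finset.sum_congr rfl fun c _ => ?_
    rw [Matrix.blockDiagonal'_apply_eq]
    rfl
  · intro j _ hj
    refine Finset.sum_eq_zero fun c _ => ?_
    rw [Matrix.blockDiagonal'_apply_ne _ _ _ hj.symm, zero_mul]
  · intro h
    exact absurd (Finset.mem_univ _) h

/-- The block diagonal matrix of an element of `H`. -/
noncomputable def bd (h : ∀ i : Fin k, GL (Fin (S.adjDim i.castSucc)) ℂ) :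
    Matrix S.BlockIndex S.BlockIndex ℂ := Matrix.blockDiagonal' fun i => (h i).val

theorem bd_mul_bd_inv (h : ∀ i : Fin k, GL (Fin (S.adjDim i.castSucc)) ℂ) :
    bd h * bd h⁻¹ = 1 := by
  rw [bd, bd, ← Matrix.blockDiagonal'_mul]
  have : (fun i => (h i).val * (h⁻¹ i).val) = 1 := by
    funext i
    exact Units.mul_inv (h i)
  rw [this]
  exact Matrix.blockDiagonal'_one

theorem bd_inv_mul_bd (h : ∀ i : Fin k, GL (Fin (S.adjDim i.castSucc)) ℂ) :
    bd h⁻¹ * bd h = 1 := by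
  simpa using bd_mul_bd_inv h⁻¹

/-- The inverse transpose. -/
noncomputable def invTranspose {n : ℕ} (g : GL (Fin n) ℂ) : GL (Fin n) ℂ where
  val := (g⁻¹.val)ᵀ
  inv := (g.val)ᵀ
  val_inv := by rw [← Matrix.transpose_mul, Units.mul_inv, Matrix.transpose_one]
  inv_val := by rw [← Matrix.transpose_mul, Units.inv_mul, Matrix.transpose_one]

/-- H acts on the transpose through inverse transposes, an automorphism of H, so orbits are
unaffected. -/
theorem toMat_conjAct_invTranspose (h : ∀ i : Fin k, GL (Fin (S.adjDim i.castSucc)) ℂ)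
    (B : S.GlCoord → ℂ) :
    (toMat (conjAct (fun i => invTranspose (h i)) B))ᵀ = bd h * (toMat B)ᵀ * bd h⁻¹ := by
  rw [toMat_conjAct, Matrix.transpose_mul, Matrix.transpose_mul,
    Matrix.blockDiagonal'_transpose, Matrix.blockDiagonal'_transpose, Matrix.mul_assoc]
  rfl

/-! ### The two maps between the centre and the sum of the adjacent nodes -/

/-- The combinatorial and genericity assumptions on an incremented quiver. -/
structure FlagGeneric (S : StarShape (k + 1)) (lam : S.Node → ℂ) : Prop where
  generic : Generic lam
  leg_ne_nil : ∀ i, S.leg i ≠ []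
  sum_adjDim : ∑ i : Fin k, S.adjDim i.castSucc = S.center
  length_last : (S.leg (Fin.last k)).length + 1 = S.center
  getD_last : ∀ j ≤ (S.leg (Fin.last k)).length,
    (S.leg (Fin.last k)).getD j 0 + 1 = (S.center :: S.leg (Fin.last k)).getD j 0

section

variable (hleg : ∀ i, S.leg i ≠ [])

/-- The first arrow of a leg. -/
def first (hleg : ∀ i, S.leg i ≠ []) (i : Fin (k + 1)) : Fin (S.leg i).length :=
  ⟨0, List.length_pos_iff.2 (hleg i)⟩

/-- The two dimensions agree propositionally but not definitionally, hence the reindexing by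
`adjEquiv` throughout. -/
theorem adjDim_eq (i : Fin (k + 1)) : S.adjDim i = S.legDim i (first hleg i).succ := by
  have h : S.leg i = (S.leg i).head (hleg i) :: (S.leg i).tail := (List.cons_head_tail _).symm
  change (S.leg i).headD 0 = (S.leg i)[0]'(List.length_pos_iff.2 (hleg i))
  rw [List.headD_eq_head?_getD, List.head?_eq_some_head (hleg i), List.head_eq_getElem]
  rfl

theorem leg_eq_cons (hleg : ∀ i, S.leg i ≠ []) (i : Fin (k + 1)) :
    S.leg i = S.adjDim i :: (S.leg i).tail := by
  conv_lhs => rw [← List.cons_head_tail (hleg i)]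
  congr 1
  rw [adjDim, List.headD_eq_head?_getD, List.head?_eq_some_head (hleg i)]
  rfl

/-- Identification of the two index sets for the node adjacent to the centre. -/
def adjEquiv (i : Fin (k + 1)) : Fin (S.adjDim i) ≃ Fin (S.legDim i (first hleg i).succ) :=
  finCongr (adjDim_eq hleg i)

/-- The map to the centre from the adjacent node of the `i`-th leg. -/
def topφ (x : Coord S.dim → ℂ) (i : Fin (k + 1)) : Matrix (Fin S.center) (Fin (S.adjDim i)) ℂ :=
  Matrix.of fun a b => (chain x i).φ (first hleg i) a (adjEquiv hleg i b)

/-- The map from the centre to the adjacent node of the `i`-th leg. -/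
def topψ (x : Coord S.dim → ℂ) (i : Fin (k + 1)) : Matrix (Fin (S.adjDim i)) (Fin S.center) ℂ :=
  Matrix.of fun b a => (chain x i).ψ (first hleg i) (adjEquiv hleg i b) a

theorem topφ_mul_topψ (x : Coord S.dim → ℂ) (i : Fin (k + 1)) :
    topφ hleg x i * topψ hleg x i = resid x i := by
  have h : resid x i = (chain x i).φ (first hleg i) * (chain x i).ψ (first hleg i) :=
    Chain.T_castSucc (chain x i) (first hleg i)
  rw [h]
  ext a b
  exact (adjEquiv hleg i).sum_comp (fun c =>
    (chain x i).φ (first hleg i) a c * (chain x i).ψ (first hleg i) c b)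

theorem isUnit_topψ_mul_topφ (hgen : Generic lam) {x : Coord S.dim → ℂ}
    (hx : x ∈ (quiverVariety S.dim lam).level) (i : Fin (k + 1)) :
    IsUnit (topψ hleg x i * topφ hleg x i) := by
  have h := (((mem_level_iff.1 hx).1 i).mem_legOrbit_and_isUnit (hgen i)).2 (first hleg i)
  rw [← Matrix.isUnit_submatrix_equiv (adjEquiv hleg i)] at h
  exact h

/-- The map from the sum of the adjacent nodes of all legs but the last to the centre. -/
def colMat (x : Coord S.dim → ℂ) : Matrix (Fin S.center) S.BlockIndex ℂ :=
  Matrix.of fun a s => topφ hleg x s.1.castSucc a s.2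

/-- The map from the centre to the sum of the adjacent nodes of all legs but the last. -/
def rowMat (x : Coord S.dim → ℂ) : Matrix S.BlockIndex (Fin S.center) ℂ :=
  Matrix.of fun s a => topψ hleg x s.1.castSucc s.2 a

/-- The map to `gl_N` inducing the isomorphism of quotients. -/
noncomputable def toGl (x : Coord S.dim → ℂ) : S.GlCoord → ℂ := fun c =>
  (rowMat hleg x * colMat hleg x) c.2 c.1

/-- The transpose is there for the Poisson structure: with these conventions x ↦ QP reverses the
sign of brackets, and transposition reverses it back. -/
theorem transpose_toMat_toGl (x : Coord S.dim → ℂ) :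
    (toMat (toGl hleg x))ᵀ = rowMat hleg x * colMat hleg x := rfl

end

/-- The pairs of maps that come from the level set. -/
def PairLevel (lam : S.Node → ℂ) (P : Matrix (Fin S.center) S.BlockIndex ℂ)
    (Q : Matrix S.BlockIndex (Fin S.center) ℂ) : Prop :=
  lam S.ctr • 1 - P * Q ∈ legOrbit (S.leg (Fin.last k)) (legParam lam (Fin.last k)) ∧
    ∀ i : Fin k, rowBlock Q i * colBlock P i + legParam lam i.castSucc 0 • 1 ∈
      legOrbit (S.leg i.castSucc).tail fun j => legParam lam i.castSucc (j + 1)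

/-- The tuple of central contributions attached to a pair of maps. -/
noncomputable def pairResid (lam : S.Node → ℂ) (P : Matrix (Fin S.center) S.BlockIndex ℂ)
    (Q : Matrix S.BlockIndex (Fin S.center) ℂ) (i : Fin (k + 1)) :
    Matrix (Fin S.center) (Fin S.center) ℂ :=
  Fin.lastCases (motive := fun _ => Matrix (Fin S.center) (Fin S.center) ℂ)
    (lam S.ctr • 1 - P * Q) (fun i => colBlock P i * rowBlock Q i) i

theorem pairResid_last (P : Matrix (Fin S.center) S.BlockIndex ℂ)
    (Q : Matrix S.BlockIndex (Fin S.center) ℂ) :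
    pairResid lam P Q (Fin.last k) = lam S.ctr • 1 - P * Q := Fin.lastCases_last

theorem pairResid_castSucc (P : Matrix (Fin S.center) S.BlockIndex ℂ)
    (Q : Matrix S.BlockIndex (Fin S.center) ℂ) (i : Fin k) :
    pairResid lam P Q i.castSucc = colBlock P i * rowBlock Q i := Fin.lastCases_castSucc _

theorem sum_pairResid (P : Matrix (Fin S.center) S.BlockIndex ℂ)
    (Q : Matrix S.BlockIndex (Fin S.center) ℂ) :
    ∑ i, pairResid lam P Q i = lam S.ctr • 1 := by
  rw [Fin.sum_univ_castSucc, pairResid_last, mul_eq_sum_blocks]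
  simp only [pairResid_castSucc]
  abel

/-- The equation at the centre recovers the contribution of the last leg from the others. Hence a
point of the level set is determined up to gauge by its pair (P, Q). -/
theorem resid_eq_pairResid (hleg : ∀ i, S.leg i ≠ []) {x : Coord S.dim → ℂ}
    (hx : x ∈ (quiverVariety S.dim lam).level) :
    resid x = pairResid lam (colMat hleg x) (rowMat hleg x) := by
  have h : ∀ i : Fin k, colBlock (colMat hleg x) i * rowBlock (rowMat hleg x) i =
      resid x i.castSucc := fun i => topφ_mul_topψ hleg x i.castSucc
  funext i
  refine Fin.lastCases ?_ (fun i => ?_) i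
  · rw [pairResid_last, mul_eq_sum_blocks, ← (mem_level_iff.1 hx).2, Fin.sum_univ_castSucc]
    simp only [h]
    abel
  · rw [pairResid_castSucc, h]

theorem isUnit_of_pairLevel (hS : FlagGeneric S lam) {P : Matrix (Fin S.center) S.BlockIndex ℂ}
    {Q : Matrix S.BlockIndex (Fin S.center) ℂ} (h : PairLevel lam P Q) (i : Fin k) :
    IsUnit (rowBlock Q i * colBlock P i) := by
  have hξ := hS.generic i.castSucc
  have hl := List.length_pos_iff.2 (hS.leg_ne_nil i.castSucc)
  obtain ⟨L, hL⟩ : ∃ L, (S.leg i.castSucc).length = L + 1 := ⟨_, (Nat.succ_pred hl.ne').symm⟩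
  rw [hL] at hξ
  exact Chain.isUnit_of_add_mem_legOrbit (by simp [hL]) hξ (h.2 i)

theorem pairResid_mem_legOrbit (hS : FlagGeneric S lam)
    {P : Matrix (Fin S.center) S.BlockIndex ℂ} {Q : Matrix S.BlockIndex (Fin S.center) ℂ}
    (h : PairLevel lam P Q) (i : Fin (k + 1)) :
    pairResid lam P Q i ∈ legOrbit (S.leg i) (legParam lam i) := by
  refine Fin.lastCases ?_ (fun i => ?_) i
  · rw [pairResid_last]
    exact h.1
  · obtain ⟨φ', ψ', hφ, hψ⟩ := exists_leftInv_rightInv_of_isUnit (isUnit_of_pairLevel hS h i)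
    rw [pairResid_castSucc, leg_eq_cons hS.leg_ne_nil, mul_mem_legOrbit_cons hφ hψ]
    exact h.2 i

theorem pairLevel_of_mem_level (hS : FlagGeneric S lam) {x : Coord S.dim → ℂ}
    (hx : x ∈ (quiverVariety S.dim lam).level) :
    PairLevel lam (colMat hS.leg_ne_nil x) (rowMat hS.leg_ne_nil x) := by
  constructor
  · rw [← pairResid_last, ← resid_eq_pairResid hS.leg_ne_nil hx]
    exact chain_T_mem_legOrbit hS.generic hx _
  · intro i
    obtain ⟨φ', ψ', hφ, hψ⟩ := exists_leftInv_rightInv_of_isUnit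
      (isUnit_topψ_mul_topφ hS.leg_ne_nil hS.generic hx i.castSucc)
    have := chain_T_mem_legOrbit hS.generic hx i.castSucc
    rw [← topφ_mul_topψ hS.leg_ne_nil, leg_eq_cons hS.leg_ne_nil,
      mul_mem_legOrbit_cons hφ hψ] at this
    exact this

/-- A point of the level set with the central contributions of a pair has the same pair of maps,
up to the action of `H`. -/
theorem exists_eq_of_resid_eq (hS : FlagGeneric S lam)
    {P : Matrix (Fin S.center) S.BlockIndex ℂ} {Q : Matrix S.BlockIndex (Fin S.center) ℂ}
    (h : PairLevel lam P Q) {x : Coord S.dim → ℂ} (hx : x ∈ (quiverVariety S.dim lam).level)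
    (g : GL (Fin S.center) ℂ)
    (hr : ∀ i, resid x i = g.val * pairResid lam P Q i * g⁻¹.val) :
    ∃ b : ∀ i : Fin k, GL (Fin (S.adjDim i.castSucc)) ℂ,
      colMat hS.leg_ne_nil x = g.val * P * bd b⁻¹ ∧
      rowMat hS.leg_ne_nil x = bd b * Q * g⁻¹.val := by
  have : ∀ i : Fin k, ∃ b : GL (Fin (S.adjDim i.castSucc)) ℂ,
      topφ hS.leg_ne_nil x i.castSucc = g.val * colBlock P i * b⁻¹.val ∧
      topψ hS.leg_ne_nil x i.castSucc = b.val * rowBlock Q i * g⁻¹.val := by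
    intro i
    apply exists_conj_of_mul_eq g (isUnit_of_pairLevel hS h i)
      (isUnit_topψ_mul_topφ hS.leg_ne_nil hS.generic hx i.castSucc)
    rw [topφ_mul_topψ, hr, pairResid_castSucc]
  choose b hb₁ hb₂ using this
  refine ⟨b, ext_colBlock fun i => ?_, ext_rowBlock fun i => ?_⟩
  · rw [bd, colBlock_mul_blockDiagonal', colBlock_mul]
    exact hb₁ i
  · rw [rowBlock_mul, bd, rowBlock_blockDiagonal'_mul]
    exact hb₂ i

theorem toGl_eq_conjAct (hleg : ∀ i, S.leg i ≠ []) {x : Coord S.dim → ℂ}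
    {P : Matrix (Fin S.center) S.BlockIndex ℂ} {Q : Matrix S.BlockIndex (Fin S.center) ℂ}
    {g : GL (Fin S.center) ℂ} {b : ∀ i : Fin k, GL (Fin (S.adjDim i.castSucc)) ℂ}
    (h₁ : colMat hleg x = g.val * P * bd b⁻¹) (h₂ : rowMat hleg x = bd b * Q * g⁻¹.val)
    {B : S.GlCoord → ℂ} (hB : (toMat B)ᵀ = Q * P) :
    toGl hleg x = conjAct (fun i => invTranspose (b i)) B := by
  apply toMat_injective
  apply Matrix.transpose_injective
  rw [toMat_conjAct_invTranspose, transpose_toMat_toGl, h₁, h₂, hB]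
  have hg : g⁻¹.val * g.val = 1 := Units.inv_mul g
  calc _ = bd b * Q * (g⁻¹.val * g.val) * P * bd b⁻¹ := by simp only [Matrix.mul_assoc]
    _ = _ := by rw [hg, Matrix.mul_one]; simp only [Matrix.mul_assoc]

/-- Reindexing of an invertible matrix. -/
noncomputable def submatrixGL {a b : ℕ} (e : Fin a ≃ Fin b) (g : GL (Fin b) ℂ) : GL (Fin a) ℂ where
  val := g.val.submatrix e e
  inv := g⁻¹.val.submatrix e e
  val_inv := by rw [Matrix.submatrix_mul_equiv, Units.mul_inv, Matrix.submatrix_one_equiv]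
  inv_val := by rw [Matrix.submatrix_mul_equiv, Units.inv_mul, Matrix.submatrix_one_equiv]

/-- The component at the adjacent node of an element of the gauge group. -/
noncomputable def topGrp (hleg : ∀ i, S.leg i ≠ []) (g : ∀ a : S.Node, GL (Fin (S.dim a)) ℂ)
    (i : Fin (k + 1)) : GL (Fin (S.adjDim i)) ℂ :=
  submatrixGL (adjEquiv hleg i) (g (S.nd i (first hleg i).succ))

/-- The component at the centre of an element of the gauge group. -/
def ctrGrp (g : ∀ a : S.Node, GL (Fin (S.dim a)) ℂ) : GL (Fin S.center) ℂ := g S.ctr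

theorem topφ_quiverAct (hleg : ∀ i, S.leg i ≠ []) (g : ∀ a : S.Node, GL (Fin (S.dim a)) ℂ)
    (x : Coord S.dim → ℂ) (i : Fin (k + 1)) :
    topφ hleg (quiverAct g x) i = (ctrGrp g).val * topφ hleg x i * (topGrp hleg g i)⁻¹.val := by
  have h : ∀ (A : Matrix (Fin S.center) (Fin S.center) ℂ)
      (B : Matrix (Fin (S.legDim i (first hleg i).succ)) (Fin (S.legDim i (first hleg i).succ)) ℂ)
      (φ : Matrix (Fin S.center) (Fin (S.legDim i (first hleg i).succ)) ℂ),
      (A * φ * B).submatrix id (adjEquiv hleg i) = A * φ.submatrix id (adjEquiv hleg i) *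
        B.submatrix (adjEquiv hleg i) (adjEquiv hleg i) := fun A B φ => by
    rw [← Matrix.submatrix_mul_equiv _ _ _ (adjEquiv hleg i)]
    rfl
  exact (congrArg (fun M : Matrix (Fin S.center) (Fin (S.legDim i (first hleg i).succ)) ℂ =>
    M.submatrix id (adjEquiv hleg i)) (fwd_quiverAct g x (S.arr i (first hleg i)))).trans (h _ _ _)

theorem topψ_quiverAct (hleg : ∀ i, S.leg i ≠ []) (g : ∀ a : S.Node, GL (Fin (S.dim a)) ℂ)
    (x : Coord S.dim → ℂ) (i : Fin (k + 1)) :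
    topψ hleg (quiverAct g x) i = (topGrp hleg g i).val * topψ hleg x i * (ctrGrp g)⁻¹.val := by
  have h : ∀ (A : Matrix (Fin S.center) (Fin S.center) ℂ)
      (B : Matrix (Fin (S.legDim i (first hleg i).succ)) (Fin (S.legDim i (first hleg i).succ)) ℂ)
      (ψ : Matrix (Fin (S.legDim i (first hleg i).succ)) (Fin S.center) ℂ),
      (B * ψ * A).submatrix (adjEquiv hleg i) id =
        B.submatrix (adjEquiv hleg i) (adjEquiv hleg i) * ψ.submatrix (adjEquiv hleg i) id * A :=
    fun A B ψ => by
      rw [Matrix.submatrix_mul_equiv]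
      rfl
  exact (congrArg (fun M : Matrix (Fin (S.legDim i (first hleg i).succ)) (Fin S.center) ℂ =>
    M.submatrix (adjEquiv hleg i) id) (bwd_quiverAct g x (S.arr i (first hleg i)))).trans (h _ _ _)

/-- The central component cancels inside QP; only the components at the adjacent nodes survive. -/
theorem toGl_quiverAct (hleg : ∀ i, S.leg i ≠ []) (g : ∀ a : S.Node, GL (Fin (S.dim a)) ℂ)
    (x : Coord S.dim → ℂ) :
    toGl hleg (quiverAct g x) =
      conjAct (fun i : Fin k => invTranspose (topGrp hleg g i.castSucc)) (toGl hleg x) := by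
  refine toGl_eq_conjAct hleg (g := ctrGrp g) (b := fun i => topGrp hleg g i.castSucc)
    (P := colMat hleg x) (Q := rowMat hleg x) (ext_colBlock fun i => ?_)
    (ext_rowBlock fun i => ?_) (transpose_toMat_toGl hleg x)
  · rw [bd, colBlock_mul_blockDiagonal', colBlock_mul]
    exact topφ_quiverAct hleg g x _
  · rw [rowBlock_mul, bd, rowBlock_blockDiagonal'_mul]
    exact topψ_quiverAct hleg g x _

/-! ### The level set of the dual quotient -/

/-- Orbits are stable under transposition, so the dual level can be expressed through Bᵀ = QP, in
the same shape as `PairLevel`. -/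
theorem mem_dualLevel_iff {B : S.GlCoord → ℂ} :
    B ∈ (dualReduction lam).level ↔
      lam S.ctr • 1 - (toMat B)ᵀ ∈
        legOrbit (S.leg (Fin.last k)) (legParam lam (Fin.last k)) ∧
      ∀ i : Fin k, (diagBlock B i)ᵀ + legParam lam i.castSucc 0 • 1 ∈
        legOrbit (S.leg i.castSucc).tail fun j => legParam lam i.castSucc (j + 1) := by
  have ht : ∀ {ι : Type} [Fintype ι] [DecidableEq ι] {d : List ℕ} {p : ℕ → ℂ} {A : Matrix ι ι ℂ},
      Aᵀ ∈ legOrbit d p ↔ A ∈ legOrbit d p := fun {ι _ _ d p A} =>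
    ⟨fun h => by simpa using transpose_mem_legOrbit h, transpose_mem_legOrbit⟩
  have h1 : lam S.ctr • 1 - (toMat B)ᵀ = (-toMat B + lam S.ctr • 1)ᵀ := by
    rw [Matrix.transpose_add, Matrix.transpose_neg, Matrix.transpose_smul, Matrix.transpose_one]
    abel
  have h2 : ∀ i : Fin k, (diagBlock B i)ᵀ + legParam lam i.castSucc 0 • 1 =
      (diagBlock B i + legParam lam i.castSucc 0 • 1)ᵀ := fun i => by
    rw [Matrix.transpose_add, Matrix.transpose_smul, Matrix.transpose_one]
  simp only [h1, h2, ht]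
  refine and_congr ?_ (forall_congr' fun i => ?_)
  · constructor
    · rintro ⟨A, hA, h⟩
      rw [if_pos rfl] at h
      change _ = A + -lam S.ctr • 1 at h
      have hA' : -toMat B + lam S.ctr • 1 = A := by
        rw [h, neg_smul, neg_add_cancel_right]
      rwa [hA']
    · intro h
      refine ⟨_, h, ?_⟩
      rw [if_pos rfl, neg_smul]
      exact (add_neg_cancel_right _ _).symm
  · constructor
    · rintro ⟨A, hA, h⟩
      rw [h, sub_add_cancel]
      exact hA
    · intro h
      exact ⟨_, h, (add_sub_cancel_right _ _).symm⟩

theorem card_blockIndex (hS : FlagGeneric S lam) : Fintype.card S.BlockIndex = S.center := by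
  rw [Fintype.card_sigma]
  simp only [Fintype.card_fin]
  exact hS.sum_adjDim

theorem getD_last_lt (hS : FlagGeneric S lam) {n : ℕ} (hn : n = S.center) :
    ∀ j ≤ (S.leg (Fin.last k)).length,
      (S.leg (Fin.last k)).getD j 0 < (n :: S.leg (Fin.last k)).getD j 0 := by
  intro j hj
  have := hS.getD_last j hj
  rw [hn]
  omega

/-- The level set controls λ₀ - PQ whereas the dual level asks about λ₀ - QP: the exchange lemma
`sub_mul_mem_legOrbit_comm`. The diagonal blocks of QP are the ψφ at the adjacent nodes. -/
theorem toGl_mem_level (hS : FlagGeneric S lam) {x : Coord S.dim → ℂ}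
    (hx : x ∈ (quiverVariety S.dim lam).level) :
    toGl hS.leg_ne_nil x ∈ (dualReduction lam).level := by
  have h := pairLevel_of_mem_level hS hx
  rw [mem_dualLevel_iff]
  refine ⟨?_, fun i => ?_⟩
  · rw [transpose_toMat_toGl]
    refine sub_mul_mem_legOrbit_comm (hS.generic _) ?_ ?_ ?_ h.1
    · rw [card_blockIndex hS, Fintype.card_fin]
    · rw [Fintype.card_fin, hS.length_last]
    · exact getD_last_lt hS (Fintype.card_fin _)
  · exact h.2 i

/-- An identification of the centre with the sum of the adjacent nodes. -/
noncomputable def baseEquiv (hS : FlagGeneric S lam) : Fin S.center ≃ S.BlockIndex :=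
  Fintype.equivOfCardEq (by rw [card_blockIndex hS, Fintype.card_fin])

/-- The normal form of the map to the centre. -/
noncomputable def baseP (hS : FlagGeneric S lam) : Matrix (Fin S.center) S.BlockIndex ℂ :=
  (1 : Matrix S.BlockIndex S.BlockIndex ℂ).submatrix (baseEquiv hS) id

/-- The map from the centre corresponding to a matrix. -/
noncomputable def baseQ (hS : FlagGeneric S lam) (B : S.GlCoord → ℂ) :
    Matrix S.BlockIndex (Fin S.center) ℂ := (toMat B)ᵀ.submatrix id (baseEquiv hS)

theorem baseQ_mul_baseP (hS : FlagGeneric S lam) (B : S.GlCoord → ℂ) :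
    baseQ hS B * baseP hS = (toMat B)ᵀ := by
  rw [baseQ, baseP, Matrix.submatrix_mul_equiv, Matrix.mul_one, Matrix.submatrix_id_id]

theorem exists_baseP_inv (hS : FlagGeneric S lam) :
    ∃ P' : Matrix S.BlockIndex (Fin S.center) ℂ, P' * baseP hS = 1 ∧ baseP hS * P' = 1 := by
  refine ⟨(1 : Matrix S.BlockIndex S.BlockIndex ℂ).submatrix id (baseEquiv hS), ?_, ?_⟩
  · rw [baseP, Matrix.submatrix_mul_equiv, Matrix.mul_one, Matrix.submatrix_id_id]
  · rw [baseP, ← Matrix.submatrix_mul _ _ _ id _ Function.bijective_id, Matrix.mul_one,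
      Matrix.submatrix_one_equiv]

/-- The exchange lemma in the opposite direction, for P the identity up to relabelling of the basis
and QP = Bᵀ. -/
theorem pairLevel_base (hS : FlagGeneric S lam) {B : S.GlCoord → ℂ}
    (hB : B ∈ (dualReduction lam).level) : PairLevel lam (baseP hS) (baseQ hS B) := by
  rw [mem_dualLevel_iff] at hB
  have h := baseQ_mul_baseP hS B
  refine ⟨?_, fun i => ?_⟩
  · rw [← h] at hB
    refine sub_mul_mem_legOrbit_comm (hS.generic _) ?_ ?_ ?_ hB.1
    · rw [card_blockIndex hS, Fintype.card_fin]
    · rw [card_blockIndex hS, hS.length_last]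
    · exact getD_last_lt hS (card_blockIndex hS)
  · have : rowBlock (baseQ hS B) i * colBlock (baseP hS) i = (diagBlock B i)ᵀ := by
      ext a b
      exact congrFun (congrFun h ⟨i, a⟩) ⟨i, b⟩
    rw [this]
    exact hB.2 i

theorem exists_mem_level_of_pairLevel (hS : FlagGeneric S lam)
    {P : Matrix (Fin S.center) S.BlockIndex ℂ} {Q : Matrix S.BlockIndex (Fin S.center) ℂ}
    (h : PairLevel lam P Q) :
    ∃ x ∈ (quiverVariety S.dim lam).level, resid x = pairResid lam P Q := by
  obtain ⟨x, hx, hr⟩ := exists_mem_level (fun i => pairResid_mem_legOrbit hS h i)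
    (sum_pairResid P Q)
  exact ⟨x, hx, funext hr⟩

end StarShape

end StarQuiver

/-! ### Degenerations, and comparison of points of the two quotients. -/

namespace StarQuiver

open Matrix Filter Topology

set_option linter.unusedSectionVars false

theorem exists_leftInv_of_injective {ι κ : Type} [Fintype ι] [DecidableEq ι] [Fintype κ]
    [DecidableEq κ] {P : Matrix ι κ ℂ}
    (h : ∀ w : Matrix κ (Fin 1) ℂ, P * w = 0 → w = 0) : ∃ P' : Matrix κ ι ℂ, P' * P = 1 := by
  have hk : LinearMap.ker (Matrix.toLin' P) = ⊥ := by
    rw [LinearMap.ker_eq_bot']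
    intro v hv
    have := h (Matrix.of fun i _ => v i) (by
      ext i j
      exact congrFun hv i)
    funext i
    exact congrFun (congrFun this i) 0
  obtain ⟨g, hg⟩ := LinearMap.exists_leftInverse_of_injective _ hk
  refine ⟨LinearMap.toMatrix' g, ?_⟩
  have := congrArg LinearMap.toMatrix' hg
  rwa [LinearMap.toMatrix'_comp, LinearMap.toMatrix'_toLin', LinearMap.toMatrix'_id] at this

theorem aeval_mul_of_mul_eq_smul {ι κ : Type} [Fintype ι] [DecidableEq ι] [Fintype κ]
    [DecidableEq κ] {A : Matrix ι ι ℂ} {w : Matrix ι κ ℂ} {c : ℂ} (h : A * w = c • w)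
    (q : Polynomial ℂ) : Polynomial.aeval A q * w = q.eval c • w := by
  rw [aeval_mul_of_intertwine (Y := algebraMap ℂ (Matrix κ κ ℂ) c)
    (by rw [h, Algebra.algebraMap_eq_smul_one, Matrix.mul_smul, Matrix.mul_one]),
    Polynomial.aeval_algebraMap_apply, Polynomial.coe_aeval_eq_eval,
    Algebra.algebraMap_eq_smul_one, Matrix.mul_smul, Matrix.mul_one]

/-- An idempotent of rank one. -/
theorem exists_eq_mul_of_rank_eq_one {ι : Type} [Fintype ι] [DecidableEq ι] {E : Matrix ι ι ℂ}
    (h : E.rank = 1) (hE : E * E = E) :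
    ∃ (a : Matrix ι (Fin 1) ℂ) (b : Matrix (Fin 1) ι ℂ), E = a * b ∧ b * a = 1 := by
  obtain ⟨a, b, a', b', h1, h2, h3⟩ := exists_rank_factorization E h
  refine ⟨a, b, h1, ?_⟩
  rw [h1] at hE
  calc b * a = (a' * a) * (b * a) * (b * b') := by rw [h2, h3, Matrix.one_mul, Matrix.mul_one]
    _ = a' * (a * b * (a * b)) * b' := by simp only [Matrix.mul_assoc]
    _ = (a' * a) * (b * b') := by rw [hE]; simp only [Matrix.mul_assoc]
    _ = 1 := by rw [h2, h3, Matrix.one_mul]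

theorem mul_eq_zero_fin_one {κ ρ : Matrix (Fin 1) (Fin 1) ℂ} (h : κ * ρ = 0) : κ = 0 ∨ ρ = 0 := by
  have h0 : κ 0 0 * ρ 0 0 = 0 := by
    have := congrFun (congrFun h 0) 0
    simpa [Matrix.mul_apply] using this
  rcases mul_eq_zero.1 h0 with h | h
  · exact Or.inl (by ext i j; rwa [Subsingleton.elim i 0, Subsingleton.elim j 0])
  · exact Or.inr (by ext i j; rwa [Subsingleton.elim i 0, Subsingleton.elim j 0])

/-- The automorphism scaling the image of an idempotent by `c`. -/
noncomputable def scaleGL {n : ℕ} (E : Matrix (Fin n) (Fin n) ℂ) (hE : E * E = E) (c : ℂ)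
    (hc : c ≠ 0) : GL (Fin n) ℂ where
  val := (1 - E) + c • E
  inv := (1 - E) + c⁻¹ • E
  val_inv := by
    simp only [Matrix.add_mul, Matrix.mul_add, Matrix.sub_mul, Matrix.mul_sub, Matrix.smul_mul,
      Matrix.mul_smul, Matrix.one_mul, Matrix.mul_one, hE]
    simp [smul_smul, hc]
  inv_val := by
    simp only [Matrix.add_mul, Matrix.mul_add, Matrix.sub_mul, Matrix.mul_sub, Matrix.smul_mul,
      Matrix.mul_smul, Matrix.one_mul, Matrix.mul_one, hE]
    simp [smul_smul, hc]

theorem tendsto_of_continuous_uncurry {α X Y Z : Type*} [TopologicalSpace X] [TopologicalSpace Y]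
    [TopologicalSpace Z] {f : X → Y → Z} (hf : Continuous fun p : X × Y => f p.1 p.2)
    {l : Filter α} {u : α → X} {v : α → Y} {x : X} {y : Y} (hu : Tendsto u l (𝓝 x))
    (hv : Tendsto v l (𝓝 y)) : Tendsto (fun t => f (u t) (v t)) l (𝓝 (f x y)) :=
  (hf.tendsto (x, y)).comp (hu.prodMk_nhds hv)

namespace StarShape

variable {k : ℕ} {S : StarShape (k + 1)} {lam : S.Node → ℂ}

theorem pairLevel_congr {P P' : Matrix (Fin S.center) S.BlockIndex ℂ}
    {Q Q' : Matrix S.BlockIndex (Fin S.center) ℂ} (h : PairLevel lam P Q)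
    (h₁ : P' * Q' = P * Q) (h₂ : Q' * P' = Q * P) : PairLevel lam P' Q' := by
  refine ⟨h₁.symm ▸ h.1, fun i => ?_⟩
  have : rowBlock Q' i * colBlock P' i = rowBlock Q i * colBlock P i := by
    ext a b
    exact congrFun (congrFun h₂ ⟨i, a⟩) ⟨i, b⟩
  rw [this]
  exact h.2 i

theorem conj_pairResid (g : GL (Fin S.center) ℂ) (P : Matrix (Fin S.center) S.BlockIndex ℂ)
    (Q : Matrix S.BlockIndex (Fin S.center) ℂ) (i : Fin (k + 1)) :
    g.val * pairResid lam P Q i * g⁻¹.val = pairResid lam (g.val * P) (Q * g⁻¹.val) i := by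
  have hg : g.val * g⁻¹.val = 1 := Units.mul_inv g
  refine Fin.lastCases ?_ (fun i => ?_) i
  · rw [pairResid_last, pairResid_last, Matrix.mul_sub, Matrix.sub_mul, Matrix.mul_smul,
      Matrix.smul_mul, Matrix.mul_one, hg]
    simp only [Matrix.mul_assoc]
  · rw [pairResid_castSucc, pairResid_castSucc, colBlock_mul, rowBlock_mul]
    simp only [Matrix.mul_assoc]

theorem pairResid_bd (b : ∀ i : Fin k, GL (Fin (S.adjDim i.castSucc)) ℂ)
    (P : Matrix (Fin S.center) S.BlockIndex ℂ) (Q : Matrix S.BlockIndex (Fin S.center) ℂ) :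
    pairResid lam (P * bd b⁻¹) (bd b * Q) = pairResid lam P Q := by
  funext i
  refine Fin.lastCases ?_ (fun i => ?_) i
  · rw [pairResid_last, pairResid_last, Matrix.mul_assoc, ← Matrix.mul_assoc (bd b⁻¹),
      bd_inv_mul_bd, Matrix.one_mul]
  · rw [pairResid_castSucc, pairResid_castSucc, bd, bd, colBlock_mul_blockDiagonal',
      rowBlock_blockDiagonal'_mul, Matrix.mul_assoc, ← Matrix.mul_assoc (b⁻¹ i).val]
    have : (b⁻¹ i).val * (b i).val = 1 := Units.inv_mul (b i)
    rw [this, Matrix.one_mul]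

theorem continuous_pairResid (i : Fin (k + 1)) :
    Continuous fun p : Matrix (Fin S.center) S.BlockIndex ℂ × Matrix S.BlockIndex (Fin S.center) ℂ =>
      pairResid lam p.1 p.2 i := by
  refine Fin.lastCases ?_ (fun i => ?_) i
  · simp only [pairResid_last]
    exact continuous_const.sub (continuous_fst.matrix_mul continuous_snd)
  · simp only [pairResid_castSucc]
    refine Continuous.matrix_mul ?_ ?_
    · exact continuous_matrix fun a b => continuous_fst.matrix_elem a (⟨i, b⟩ : S.BlockIndex)
    · exact continuous_matrix fun a b => continuous_snd.matrix_elem (⟨i, a⟩ : S.BlockIndex) b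

theorem tendsto_pairResid {α : Type} {l : Filter α} {P : α → Matrix (Fin S.center) S.BlockIndex ℂ}
    {Q : α → Matrix S.BlockIndex (Fin S.center) ℂ}
    {P' : Matrix (Fin S.center) S.BlockIndex ℂ} {Q' : Matrix S.BlockIndex (Fin S.center) ℂ}
    (hP : Tendsto P l (𝓝 P')) (hQ : Tendsto Q l (𝓝 Q')) (i : Fin (k + 1)) :
    Tendsto (fun t => pairResid lam (P t) (Q t) i) l (𝓝 (pairResid lam P' Q' i)) :=
  tendsto_of_continuous_uncurry (f := fun P Q => pairResid lam P Q i) (continuous_pairResid i) hP hQ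

theorem rel_of_mem_closure {x y z : Coord S.dim → ℂ}
    (hx : x ∈ (quiverVariety S.dim lam).level) (hy : y ∈ (quiverVariety S.dim lam).level)
    (h₁ : z ∈ closure (Set.range fun g => (quiverVariety S.dim lam).act g x))
    (h₂ : z ∈ closure (Set.range fun g => (quiverVariety S.dim lam).act g y)) :
    (quiverVariety S.dim lam).Rel ⟨x, hx⟩ ⟨y, hy⟩ := ⟨z, h₁, h₂⟩

theorem tendsto_inv_nat : Tendsto (fun n : ℕ => ((n : ℂ) + 1)⁻¹) atTop (𝓝 0) := by
  have := tendsto_one_div_add_atTop_nhds_zero_nat (𝕜 := ℂ)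
  simpa using this

/-- Degeneration along the image of an idempotent `E`. -/
theorem mem_closure_of_idempotent (hgen : Generic lam) {x z : Coord S.dim → ℂ}
    (hx : x ∈ (quiverVariety S.dim lam).level) (hz : z ∈ (quiverVariety S.dim lam).level)
    {P : Matrix (Fin S.center) S.BlockIndex ℂ} {Q : Matrix S.BlockIndex (Fin S.center) ℂ}
    {E : Matrix (Fin S.center) (Fin S.center) ℂ} (hE : E * E = E)
    (hxr : resid x = pairResid lam P Q)
    (hzr : resid z = pairResid lam ((1 - E) * P) (Q * (1 - E)))
    (h : Q * E = 0 ∨ E * P = 0) :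
    z ∈ closure (Set.range fun g => (quiverVariety S.dim lam).act g x) := by
  have hn : ∀ n : ℕ, (n : ℂ) + 1 ≠ 0 := fun n => by exact_mod_cast Nat.succ_ne_zero n
  have lim : ∀ {a b : Type} (M N : Matrix a b ℂ),
      Tendsto (fun n : ℕ => M + ((n : ℂ) + 1)⁻¹ • N) atTop (𝓝 M) := by
    intro a b M N
    have h1 : Tendsto (fun n : ℕ => M + ((n : ℂ) + 1)⁻¹ • N) atTop (𝓝 (M + (0 : ℂ) • N)) :=
      tendsto_const_nhds.add (tendsto_inv_nat.smul tendsto_const_nhds)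
    simpa using h1
  rcases h with h | h
  -- If QE = 0, shrink the image of E: EP tends to 0, and the growing factor in Q g⁻¹ is multiplied
  -- by QE = 0.
  · refine mem_closure_orbit hgen hx hz (l := atTop)
      (fun n : ℕ => scaleGL E hE ((n : ℂ) + 1)⁻¹ (inv_ne_zero (hn n))) fun i => ?_
    simp only [hxr, conj_pairResid, hzr]
    refine tendsto_pairResid ?_ ?_ i
    · have : ∀ n : ℕ, (scaleGL E hE ((n : ℂ) + 1)⁻¹ (inv_ne_zero (hn n))).val * P =
          (1 - E) * P + ((n : ℂ) + 1)⁻¹ • (E * P) := fun n => by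
        change ((1 - E) + _ • E) * P = _
        rw [Matrix.add_mul, Matrix.smul_mul]
      simp only [this]
      exact lim _ _
    · have : ∀ n : ℕ, Q * (scaleGL E hE ((n : ℂ) + 1)⁻¹ (inv_ne_zero (hn n)))⁻¹.val =
          Q * (1 - E) := fun n => by
        change Q * ((1 - E) + _ • E) = _
        rw [Matrix.mul_add, Matrix.mul_smul, h, smul_zero, add_zero]
      simp only [this]
      exact tendsto_const_nhds
  -- If EP = 0, stretch the image of E instead: P contributes nothing there, and QE is scaled to 0.
  · refine mem_closure_orbit hgen hx hz (l := atTop)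
      (fun n : ℕ => scaleGL E hE ((n : ℂ) + 1) (hn n)) fun i => ?_
    simp only [hxr, conj_pairResid, hzr]
    refine tendsto_pairResid ?_ ?_ i
    · have : ∀ n : ℕ, (scaleGL E hE ((n : ℂ) + 1) (hn n)).val * P = (1 - E) * P := fun n => by
        change ((1 - E) + _ • E) * P = _
        rw [Matrix.add_mul, Matrix.smul_mul, h, smul_zero, add_zero]
      simp only [this]
      exact tendsto_const_nhds
    · have : ∀ n : ℕ, Q * (scaleGL E hE ((n : ℂ) + 1) (hn n))⁻¹.val =
          Q * (1 - E) + ((n : ℂ) + 1)⁻¹ • (Q * E) := fun n => by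
        change Q * ((1 - E) + _ • E) = _
        rw [Matrix.mul_add, Matrix.mul_smul]
      simp only [this]
      exact lim _ _

theorem center_eq_card (hS : FlagGeneric S lam) :
    Fintype.card (Fin S.center) = Fintype.card S.BlockIndex := by
  rw [card_blockIndex hS, Fintype.card_fin]

/-- Every point of the level set is equivalent to one with invertible map to the centre. -/
theorem exists_rel_invertible (hS : FlagGeneric S lam) {x : Coord S.dim → ℂ}
    (hx : x ∈ (quiverVariety S.dim lam).level)
    {P : Matrix (Fin S.center) S.BlockIndex ℂ} {Q : Matrix S.BlockIndex (Fin S.center) ℂ}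
    (hPQ : PairLevel lam P Q) (hxr : resid x = pairResid lam P Q) :
    ∃ (y : Coord S.dim → ℂ) (hy : y ∈ (quiverVariety S.dim lam).level)
      (P₁ : Matrix (Fin S.center) S.BlockIndex ℂ) (Q₁ P₂ : Matrix S.BlockIndex (Fin S.center) ℂ),
      resid y = pairResid lam P₁ Q₁ ∧ Q₁ * P₁ = Q * P ∧ P₂ * P₁ = 1 ∧
        (quiverVariety S.dim lam).Rel ⟨x, hx⟩ ⟨y, hy⟩ := by
  by_cases hinv : ∃ P₂ : Matrix S.BlockIndex (Fin S.center) ℂ, P₂ * P = 1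
  · obtain ⟨P₂, h⟩ := hinv
    have hm : x ∈ closure (Set.range fun g => (quiverVariety S.dim lam).act g x) :=
      subset_closure ⟨(1 : ∀ a : S.Node, GL (Fin (S.dim a)) ℂ), quiverAct_one x⟩
    exact ⟨x, hx, P, Q, P₂, hxr, rfl, h, rel_of_mem_closure hx hx hm hm⟩
  have hcard := center_eq_card hS
  set p := legParam lam (Fin.last k) with hp
  set dims := S.leg (Fin.last k) with hdims
  set A := lam S.ctr • 1 - P * Q with hA
  set A' := lam S.ctr • 1 - Q * P with hA'
  have hξ : DistinctRoots p dims.length := hS.generic (Fin.last k)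
  have hAO : A ∈ legOrbit dims p := hPQ.1
  have hAO' : A' ∈ legOrbit dims p := sub_mul_mem_legOrbit_comm hξ hcard
    (by rw [Fintype.card_fin, hS.length_last]) (getD_last_lt hS (Fintype.card_fin _)) hAO
  -- A singular square P makes PQ singular, so λ₀ is an eigenvalue of A = λ₀ - PQ and hence a root.
  have hroot : ∃ l ≤ dims.length, legRoot p l = lam S.ctr := by
    by_contra! h
    have h1 := isUnit_sub_of_mem_legOrbit hAO h
    have h2 : A - lam S.ctr • 1 = -(P * Q) := by rw [hA]; abel
    rw [h2, IsUnit.neg_iff] at h1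
    obtain ⟨u, hu⟩ := h1
    refine hinv ⟨Q * u⁻¹.val, ?_⟩
    refine (Matrix.mul_eq_one_comm_of_card_eq _ _ _ hcard).1 ?_
    rw [← Matrix.mul_assoc, ← hu, Units.mul_inv]
  obtain ⟨l, hl, hlr⟩ := hroot
  have hA0 := aeval_legPoly_eq_zero hAO
  have hA0' := aeval_legPoly_eq_zero hAO'
  -- E and E' are the spectral projections onto the kernels of PQ and QP. Both have rank one because
  -- the last leg is full, and they are intertwined by P and Q.
  set E := Polynomial.aeval A (specPoly p dims.length l) with hE
  set E' := Polynomial.aeval A' (specPoly p dims.length l) with hE'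
  have hEE : E * E = E := aeval_specPoly_mul_self hξ hA0 l
  have hEE' : E' * E' = E' := aeval_specPoly_mul_self hξ hA0' l
  obtain ⟨a, b, hab, hba⟩ := exists_eq_mul_of_rank_eq_one
    (rank_aeval_specPoly_eq_one hξ (by rw [Fintype.card_fin]; exact hS.getD_last) hAO hl) hEE
  obtain ⟨a', b', hab', hba'⟩ := exists_eq_mul_of_rank_eq_one
    (rank_aeval_specPoly_eq_one hξ (by rw [card_blockIndex hS]; exact hS.getD_last) hAO' hl) hEE'
  rw [← hE] at hab
  rw [← hE'] at hab'
  have hEP : E * P = P * E' := aeval_mul_of_intertwine (by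
    rw [hA, hA', Matrix.sub_mul, Matrix.mul_sub, Matrix.smul_mul, Matrix.mul_smul, Matrix.one_mul,
      Matrix.mul_one, Matrix.mul_assoc]) _
  have hQE : E' * Q = Q * E := aeval_mul_of_intertwine (by
    rw [hA, hA', Matrix.sub_mul, Matrix.mul_sub, Matrix.smul_mul, Matrix.mul_smul, Matrix.one_mul,
      Matrix.mul_one, Matrix.mul_assoc]) _
  have hPQE : P * Q * E = 0 := by
    have h1 := mul_aeval_specPoly hξ hA0 l
    rw [← hE, hlr, hA, Matrix.sub_mul, Matrix.smul_mul, Matrix.one_mul] at h1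
    exact sub_eq_self.1 h1
  have hEPQ : E * P * Q = 0 := by
    rw [hEP, Matrix.mul_assoc, hQE, ← Matrix.mul_assoc, hPQE]
  have hEa : E * a = a := by rw [hab, Matrix.mul_assoc, hba, Matrix.mul_one]
  have hbE' : b' * E' = b' := by rw [hab', ← Matrix.mul_assoc, hba', Matrix.one_mul]
  -- Between the two kernel lines P and Q act by the scalars bPa' and b'Qa; since EPQE = 0 their
  -- product vanishes.
  have hcase : Q * E = 0 ∨ E * P = 0 := by
    have h1 : Q * E = a' * (b' * Q * a) * b := by
      calc Q * E = Q * E * E := by rw [Matrix.mul_assoc, hEE]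
        _ = E' * Q * E := by rw [hQE]
        _ = _ := by rw [hab, hab']; simp only [Matrix.mul_assoc]
    have h2 : E * P = a * (b * P * a') * b' := by
      calc E * P = E * (E * P) := by rw [← Matrix.mul_assoc, hEE]
        _ = E * P * E' := by rw [hEP, ← Matrix.mul_assoc, hEP]
        _ = _ := by rw [hab, hab']; simp only [Matrix.mul_assoc]
    have h4 : E * P * (Q * E) = 0 := by rw [← Matrix.mul_assoc, hEPQ, Matrix.zero_mul]
    have h3 : (b * P * a') * (b' * Q * a) = 0 := by
      calc (b * P * a') * (b' * Q * a)
          = (b * a) * (b * P * a') * (b' * a') * (b' * Q * a) * (b * a) := by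
            rw [hba, hba', Matrix.one_mul, Matrix.mul_one, Matrix.mul_one]
        _ = b * ((a * (b * P * a') * b') * (a' * (b' * Q * a) * b)) * a := by
            simp only [Matrix.mul_assoc]
        _ = 0 := by
            rw [← h1, ← h2, h4, Matrix.mul_zero, Matrix.zero_mul]
    rcases mul_eq_zero_fin_one h3 with h | h
    · exact Or.inr (by rw [h2, h, Matrix.mul_zero, Matrix.zero_mul])
    · exact Or.inl (by rw [h1, h, Matrix.mul_zero, Matrix.zero_mul])
  have hQEP : Q * E * P = 0 := by
    rcases hcase with h | h
    · rw [h, Matrix.zero_mul]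
    · rw [Matrix.mul_assoc, h, Matrix.mul_zero]
  have hEE1 : (1 - E) * (1 - E) = 1 - E := by
    rw [Matrix.mul_sub, Matrix.mul_one, Matrix.sub_mul, Matrix.one_mul, hEE, sub_self, sub_zero]
  have hE1E : E * (1 - E) = 0 := by rw [Matrix.mul_sub, Matrix.mul_one, hEE, sub_self]
  have h1EE : (1 - E) * E = 0 := by rw [Matrix.sub_mul, Matrix.one_mul, hEE, sub_self]
  -- Discarding both maps between the kernel lines changes neither PQ nor QP.
  set P₀ := (1 - E) * P with hP₀
  set Q₀ := Q * (1 - E) with hQ₀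
  have hPQ₀ : P₀ * Q₀ = P * Q := by
    have h1 : P₀ * Q₀ = P * Q - E * P * Q - (P * Q * E - E * P * Q * E) := by
      rw [hP₀, hQ₀]
      simp only [Matrix.sub_mul, Matrix.mul_sub, Matrix.one_mul, Matrix.mul_one, Matrix.mul_assoc]
    rw [h1, hEPQ, hPQE]
    simp
  have hQP₀ : Q₀ * P₀ = Q * P := by
    calc Q₀ * P₀ = Q * ((1 - E) * (1 - E)) * P := by simp only [hP₀, hQ₀, Matrix.mul_assoc]
      _ = Q * P - Q * E * P := by
        rw [hEE1, Matrix.mul_sub, Matrix.sub_mul, Matrix.mul_one]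
      _ = Q * P := by rw [hQEP, sub_zero]
  -- An isomorphism from the kernel line of QP to that of PQ is put back into P. As b'Q₀ = 0 and Q₀a
  -- = 0, the two products still do not change.
  set P₁ := P₀ + a * b' with hP₁
  have hbQ₀ : b' * Q₀ = 0 := by
    calc b' * Q₀ = b' * E' * Q * (1 - E) := by rw [hbE', hQ₀, Matrix.mul_assoc]
      _ = b' * (Q * E) * (1 - E) := by rw [Matrix.mul_assoc b', hQE]
      _ = b' * Q * (E * (1 - E)) := by simp only [Matrix.mul_assoc]
      _ = 0 := by rw [hE1E, Matrix.mul_zero]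
  have hQ₀a : Q₀ * a = 0 := by
    rw [hQ₀, Matrix.mul_assoc, Matrix.sub_mul, Matrix.one_mul, hEa, sub_self, Matrix.mul_zero]
  have hPQ₁ : P₁ * Q₀ = P * Q := by
    rw [hP₁, Matrix.add_mul, hPQ₀, Matrix.mul_assoc, hbQ₀, Matrix.mul_zero, add_zero]
  have hQP₁ : Q₀ * P₁ = Q * P := by
    rw [hP₁, Matrix.mul_add, hQP₀, ← Matrix.mul_assoc, hQ₀a, Matrix.zero_mul, add_zero]
  -- If P₁w = 0, the component along a gives E'w = 0; then Pw = 0, so w lies in the kernel of QP, on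
  -- which E' is the identity, and w = 0.
  have hinv₁ : ∃ P₂ : Matrix S.BlockIndex (Fin S.center) ℂ, P₂ * P₁ = 1 := by
    refine exists_leftInv_of_injective fun w hw => ?_
    have hEP₁ : E * P₁ = a * b' := by
      rw [hP₁, Matrix.mul_add, hP₀, ← Matrix.mul_assoc, hE1E, Matrix.zero_mul, zero_add,
        ← Matrix.mul_assoc, hEa]
    have hb'w : b' * w = 0 := by
      calc b' * w = (b * a) * (b' * w) := by rw [hba, Matrix.one_mul]
        _ = b * (a * b') * w := by simp only [Matrix.mul_assoc]
        _ = b * (E * (P₁ * w)) := by rw [← hEP₁]; simp only [Matrix.mul_assoc]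
        _ = 0 := by rw [hw, Matrix.mul_zero, Matrix.mul_zero]
    have hE'w : E' * w = 0 := by rw [hab', Matrix.mul_assoc, hb'w, Matrix.mul_zero]
    have hP₀w : P₀ * w = 0 := by
      have : P₁ * w = P₀ * w := by
        rw [hP₁, Matrix.add_mul, Matrix.mul_assoc a, hb'w, Matrix.mul_zero, add_zero]
      rw [← this, hw]
    have hPw : P * w = 0 := by
      have : P₀ * w = P * w := by
        rw [hP₀, Matrix.sub_mul, Matrix.one_mul, hEP, Matrix.sub_mul, Matrix.mul_assoc P E' w,
          hE'w, Matrix.mul_zero, sub_zero]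
      rw [← this, hP₀w]
    have hA'w : A' * w = lam S.ctr • w := by
      rw [hA', Matrix.sub_mul, Matrix.smul_mul, Matrix.one_mul, Matrix.mul_assoc, hPw,
        Matrix.mul_zero, sub_zero]
    have h1 := aeval_mul_of_mul_eq_smul hA'w (specPoly p dims.length l)
    rw [← hE', hE'w, ← hlr, eval_specPoly hξ (Finset.mem_range.2 (Nat.lt_succ_iff.2 hl)), if_pos rfl,
      one_smul] at h1
    exact h1.symm
  obtain ⟨P₂, hP₂⟩ := hinv₁
  -- The point z with pair (P₀, Q₀) is a common degeneration of x and of the point y with invertible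
  -- P₁.
  obtain ⟨z, hz, hzr⟩ := exists_mem_level_of_pairLevel hS (pairLevel_congr hPQ hPQ₀ hQP₀)
  obtain ⟨y, hy, hyr⟩ := exists_mem_level_of_pairLevel hS (pairLevel_congr hPQ hPQ₁ hQP₁)
  refine ⟨y, hy, P₁, Q₀, P₂, hyr, hQP₁, hP₂, rel_of_mem_closure (z := z) hx hy ?_ ?_⟩
  · exact mem_closure_of_idempotent hS.generic hx hz hEE hxr hzr hcase
  · refine mem_closure_of_idempotent hS.generic hy hz hEE hyr ?_
      (Or.inl (by rw [hQ₀, Matrix.mul_assoc, h1EE, Matrix.mul_zero]))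
    rw [hzr]
    congr 1
    · rw [hP₁, Matrix.mul_add, hP₀, ← Matrix.mul_assoc (1 - E) (1 - E) P, hEE1,
        ← Matrix.mul_assoc (1 - E) a b', Matrix.sub_mul 1 E a, Matrix.one_mul, hEa, sub_self,
        Matrix.zero_mul, add_zero]
    · rw [hQ₀, Matrix.mul_assoc, hEE1]

/-- A point of the level set over a point of the dual level set, in normal form. -/
theorem exists_base (hS : FlagGeneric S lam) {B : S.GlCoord → ℂ}
    (hB : B ∈ (dualReduction lam).level) :
    ∃ x ∈ (quiverVariety S.dim lam).level, resid x = pairResid lam (baseP hS) (baseQ hS B) :=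
  exists_mem_level_of_pairLevel hS (pairLevel_base hS hB)

/-- A chosen point of the level set over a point of the dual level set. -/
noncomputable def basePoint (hS : FlagGeneric S lam) {B : S.GlCoord → ℂ}
    (hB : B ∈ (dualReduction lam).level) : Coord S.dim → ℂ := (exists_base hS hB).choose

theorem basePoint_mem (hS : FlagGeneric S lam) {B : S.GlCoord → ℂ}
    (hB : B ∈ (dualReduction lam).level) : basePoint hS hB ∈ (quiverVariety S.dim lam).level :=
  (exists_base hS hB).choose_spec.1

theorem resid_basePoint (hS : FlagGeneric S lam) {B : S.GlCoord → ℂ}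
    (hB : B ∈ (dualReduction lam).level) :
    resid (basePoint hS hB) = pairResid lam (baseP hS) (baseQ hS B) :=
  (exists_base hS hB).choose_spec.2

/-- Injectivity on the quotient. Replace x by an equivalent y with invertible P₁; the base change
carrying P₁ to the normal form carries Q₁ to the normal form as well, since Q₁P₁ is unchanged. So y
and y₀ lie in one orbit. -/
theorem rel_of_resid_eq (hS : FlagGeneric S lam) {x y₀ : Coord S.dim → ℂ}
    (hx : x ∈ (quiverVariety S.dim lam).level) (hy₀ : y₀ ∈ (quiverVariety S.dim lam).level)
    (hr₀ : resid y₀ = pairResid lam (baseP hS) (baseQ hS (toGl hS.leg_ne_nil x))) :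
    (quiverVariety S.dim lam).Rel ⟨x, hx⟩ ⟨y₀, hy₀⟩ := by
  obtain ⟨y, hy, P₁, Q₁, P₂, hyr, hQP, hP₂, hrel⟩ := exists_rel_invertible hS hx
    (pairLevel_of_mem_level hS hx) (resid_eq_pairResid hS.leg_ne_nil hx)
  obtain ⟨z, hz₁, hz₂⟩ := hrel
  obtain ⟨P', hP'₁, hP'₂⟩ := exists_baseP_inv hS
  have hP₂' : P₁ * P₂ = 1 :=
    (Matrix.mul_eq_one_comm_of_card_eq _ _ _ (center_eq_card hS)).2 hP₂
  let g : GL (Fin S.center) ℂ := ⟨baseP hS * P₂, P₁ * P',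
    by rw [Matrix.mul_assoc, ← Matrix.mul_assoc P₂, hP₂, Matrix.one_mul, hP'₂],
    by rw [Matrix.mul_assoc, ← Matrix.mul_assoc P', hP'₁, Matrix.one_mul, hP₂']⟩
  have hr : ∀ i, resid y₀ i = g.val * resid y i * g⁻¹.val := by
    intro i
    rw [hyr, conj_pairResid, hr₀]
    congr 1
    · change _ = baseP hS * P₂ * P₁
      rw [Matrix.mul_assoc, hP₂, Matrix.mul_one]
    · change _ = Q₁ * (P₁ * P')
      rw [← Matrix.mul_assoc, hQP, ← transpose_toMat_toGl,
        ← baseQ_mul_baseP hS, Matrix.mul_assoc, hP'₂, Matrix.mul_one]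
  obtain ⟨g', -, hg'⟩ := exists_quiverAct_eq hS.generic hy hy₀ g hr
  refine ⟨z, hz₁, closure_mono ?_ hz₂⟩
  rintro _ ⟨u, rfl⟩
  let u : ∀ a : S.Node, GL (Fin (S.dim a)) ℂ := u
  refine ⟨u * g'⁻¹, ?_⟩
  change quiverAct (u * g'⁻¹) y₀ = quiverAct u y
  rw [hg', ← quiverAct_mul, inv_mul_cancel_right]

/-- Contributions see each leg only through φψ, which leaves the base change at the adjacent nodes,
that is, an element of H. -/
theorem exists_toGl_eq_conjAct (hS : FlagGeneric S lam) {B : S.GlCoord → ℂ}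
    (hB : B ∈ (dualReduction lam).level)
    {x : Coord S.dim → ℂ} (hx : x ∈ (quiverVariety S.dim lam).level)
    (hr : resid x = pairResid lam (baseP hS) (baseQ hS B)) :
    ∃ h, toGl hS.leg_ne_nil x = conjAct h B := by
  obtain ⟨b, h₁, h₂⟩ := exists_eq_of_resid_eq hS (pairLevel_base hS hB) hx 1 (by simp [hr])
  exact ⟨_, toGl_eq_conjAct hS.leg_ne_nil h₁ h₂ (baseQ_mul_baseP hS B).symm⟩

theorem dual_rel_of_eq_conjAct {B B' : S.GlCoord → ℂ} (hB : B ∈ (dualReduction lam).level)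
    (hB' : B' ∈ (dualReduction lam).level) {h : ∀ i : Fin k, GL (Fin (S.adjDim i.castSucc)) ℂ}
    (hBB' : B' = conjAct h B) : (dualReduction lam).Rel ⟨B', hB'⟩ ⟨B, hB⟩ :=
  ⟨B', subset_closure ⟨(1 : ∀ i : Fin k, GL (Fin (S.adjDim i.castSucc)) ℂ), conjAct_one B'⟩,
    subset_closure ⟨h, hBB'.symm⟩⟩

theorem continuous_toGl (hleg : ∀ i, S.leg i ≠ []) :
    Continuous fun x : Coord S.dim → ℂ => toGl hleg x := by
  refine continuous_pi fun c => ?_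
  change Continuous fun x : Coord S.dim → ℂ => ∑ a, rowMat hleg x c.2 a * colMat hleg x a c.1
  exact continuous_finsetSum _ fun a _ => (continuous_apply _).mul (continuous_apply _)

/-- A continuous equivariant map sends a common limit of two orbits to a common limit of the image
orbits. -/
theorem rel_toGl (hS : FlagGeneric S lam) {x y : Coord S.dim → ℂ}
    (hx : x ∈ (quiverVariety S.dim lam).level) (hy : y ∈ (quiverVariety S.dim lam).level)
    (h : (quiverVariety S.dim lam).Rel ⟨x, hx⟩ ⟨y, hy⟩) :
    (dualReduction lam).Rel ⟨toGl hS.leg_ne_nil x, toGl_mem_level hS hx⟩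
      ⟨toGl hS.leg_ne_nil y, toGl_mem_level hS hy⟩ := by
  obtain ⟨z, h₁, h₂⟩ := h
  have key : ∀ {w : Coord S.dim → ℂ},
      z ∈ closure (Set.range fun g : ∀ a : S.Node, GL (Fin (S.dim a)) ℂ => quiverAct g w) →
      toGl hS.leg_ne_nil z ∈ closure (Set.range fun h => conjAct h (toGl hS.leg_ne_nil w)) := by
    intro w hw
    refine map_mem_closure (continuous_toGl hS.leg_ne_nil) hw ?_
    rintro _ ⟨g, rfl⟩
    exact ⟨_, (toGl_quiverAct hS.leg_ne_nil g w).symm⟩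
  exact ⟨toGl hS.leg_ne_nil z, key h₁, key h₂⟩

theorem exists_transpose_toMat_conjAct (h : ∀ i : Fin k, GL (Fin (S.adjDim i.castSucc)) ℂ)
    (B : S.GlCoord → ℂ) : ∃ b : ∀ i : Fin k, GL (Fin (S.adjDim i.castSucc)) ℂ,
      (toMat (conjAct h B))ᵀ = bd b * (toMat B)ᵀ * bd b⁻¹ := by
  refine ⟨fun i => invTranspose (h i), ?_⟩
  rw [← toMat_conjAct_invTranspose]
  congr 3

/-- Transport b in H to the centre as g = PbP⁻¹, with P the normal form. Up to `pairResid_bd`, g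
sends the pair (P, Q_B) to the pair with the same P and the conjugate of B in place of B, so
convergence of the conjugates to C becomes convergence of contributions. -/
theorem mem_closure_basePoint (hS : FlagGeneric S lam) {B C : S.GlCoord → ℂ}
    (hB : B ∈ (dualReduction lam).level) (hC : C ∈ (dualReduction lam).level)
    (h : C ∈ closure (Set.range fun g => conjAct g B)) :
    basePoint hS hC ∈ closure (Set.range fun g =>
      (quiverVariety S.dim lam).act g (basePoint hS hB)) := by
  -- The limit is taken along the trace on the orbit of the neighbourhoods of C; this filter is
  -- proper because C is in the closure.
  rw [mem_closure_iff_comap_neBot] at h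
  obtain ⟨P', hP'₁, hP'₂⟩ := exists_baseP_inv hS
  have hex : ∀ t : Set.range fun g => conjAct g B,
      ∃ b : ∀ i : Fin k, GL (Fin (S.adjDim i.castSucc)) ℂ,
        (toMat t.1)ᵀ = bd b * (toMat B)ᵀ * bd b⁻¹ := by
    rintro ⟨_, g, rfl⟩
    exact exists_transpose_toMat_conjAct g B
  choose b hb using hex
  let g : (Set.range fun g => conjAct g B) → GL (Fin S.center) ℂ := fun t =>
    ⟨baseP hS * bd (b t) * P', baseP hS * bd (b t)⁻¹ * P',
      by rw [Matrix.mul_assoc, ← Matrix.mul_assoc P', ← Matrix.mul_assoc P', hP'₁, Matrix.one_mul,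
          Matrix.mul_assoc, ← Matrix.mul_assoc (bd (b t)), bd_mul_bd_inv, Matrix.one_mul, hP'₂],
      by rw [Matrix.mul_assoc, ← Matrix.mul_assoc P', ← Matrix.mul_assoc P', hP'₁, Matrix.one_mul,
          Matrix.mul_assoc, ← Matrix.mul_assoc (bd (b t)⁻¹), bd_inv_mul_bd, Matrix.one_mul, hP'₂]⟩
  have hgr : ∀ t i, (g t).val * resid (basePoint hS hB) i * (g t)⁻¹.val =
      pairResid lam (baseP hS) (baseQ hS t.1) i := by
    intro t i
    rw [resid_basePoint, conj_pairResid, ← pairResid_bd (b t)]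
    congr 1
    · change baseP hS * bd (b t) * P' * baseP hS * bd (b t)⁻¹ = _
      rw [Matrix.mul_assoc _ P', hP'₁, Matrix.mul_one, Matrix.mul_assoc, bd_mul_bd_inv,
        Matrix.mul_one]
    · change bd (b t) * (baseQ hS B * (baseP hS * bd (b t)⁻¹ * P')) = _
      calc _ = bd (b t) * (baseQ hS B * baseP hS) * bd (b t)⁻¹ * P' := by
            simp only [Matrix.mul_assoc]
        _ = baseQ hS t.1 * (baseP hS * P') := by
            rw [baseQ_mul_baseP, ← hb t, ← baseQ_mul_baseP hS, Matrix.mul_assoc]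
        _ = _ := by rw [hP'₂, Matrix.mul_one]
  refine mem_closure_orbit hS.generic (basePoint_mem hS hB) (basePoint_mem hS hC) g
    (l := comap Subtype.val (𝓝 C)) fun i => ?_
  simp only [hgr]
  rw [resid_basePoint]
  have hc : Continuous fun M : S.GlCoord → ℂ => baseQ hS M :=
    continuous_matrix fun a b => continuous_apply _
  exact tendsto_pairResid tendsto_const_nhds ((hc.tendsto C).comp tendsto_comap) i

end StarShape

end StarQuiver

/-! ### Algebras of functions, Zariski closed sets, and gluing of local quotients. -/

namespace StarQuiver

open Matrix Filter Topology

set_option linter.unusedSectionVars false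

/-! ### Polynomial and rational functions -/

section Functions

variable {X : Type} {R : Subalgebra ℂ (X → ℂ)}

theorem sum_fun_mem {ι : Type} (s : Finset ι) {f : ι → X → ℂ} (h : ∀ i ∈ s, f i ∈ R) :
    (fun x => ∑ i ∈ s, f i x) ∈ R := by
  rw [← Finset.sum_fn]
  exact R.sum_mem h

theorem prod_fun_mem {ι : Type} (s : Finset ι) {f : ι → X → ℂ} (h : ∀ i ∈ s, f i ∈ R) :
    (fun x => ∏ i ∈ s, f i x) ∈ R := by
  rw [← Finset.prod_fn]
  exact R.prod_mem h

theorem const_fun_mem (c : ℂ) : (fun _ : X => c) ∈ R := R.algebraMap_mem c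

/-- The matrix valued functions with entries in an algebra of functions. -/
def EntriesIn (R : Subalgebra ℂ (X → ℂ)) {α β : Type} (M : X → Matrix α β ℂ) : Prop :=
  ∀ a b, (fun x => M x a b) ∈ R

theorem EntriesIn.const {α β : Type} (M : Matrix α β ℂ) : EntriesIn R fun _ => M :=
  fun _ _ => const_fun_mem _

theorem EntriesIn.mul {α β γ : Type} [Fintype β] {M : X → Matrix α β ℂ} {N : X → Matrix β γ ℂ}
    (hM : EntriesIn R M) (hN : EntriesIn R N) : EntriesIn R fun x => M x * N x := fun a b => by
  simp only [Matrix.mul_apply]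
  exact sum_fun_mem _ fun c _ => R.mul_mem (hM a c) (hN c b)

theorem EntriesIn.add {α β : Type} {M N : X → Matrix α β ℂ}
    (hM : EntriesIn R M) (hN : EntriesIn R N) : EntriesIn R fun x => M x + N x := fun a b =>
  R.add_mem (hM a b) (hN a b)

theorem EntriesIn.sub {α β : Type} {M N : X → Matrix α β ℂ}
    (hM : EntriesIn R M) (hN : EntriesIn R N) : EntriesIn R fun x => M x - N x := fun a b =>
  R.sub_mem (hM a b) (hN a b)

theorem EntriesIn.smul {α β : Type} {f : X → ℂ} (hf : f ∈ R) {M : X → Matrix α β ℂ}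
    (hM : EntriesIn R M) : EntriesIn R fun x => f x • M x := fun a b =>
  R.mul_mem hf (hM a b)

theorem EntriesIn.sum {α β ι : Type} (s : Finset ι) {M : ι → X → Matrix α β ℂ}
    (hM : ∀ i ∈ s, EntriesIn R (M i)) : EntriesIn R fun x => ∑ i ∈ s, M i x := fun a b => by
  simp only [Matrix.sum_apply]
  exact sum_fun_mem _ fun i hi => hM i hi a b

theorem EntriesIn.transpose {α β : Type} {M : X → Matrix α β ℂ} (hM : EntriesIn R M) :
    EntriesIn R fun x => (M x)ᵀ := fun a b => hM b a

variable {ι : Type} [Fintype ι] [DecidableEq ι] {M : X → Matrix ι ι ℂ}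

theorem EntriesIn.pow (hM : EntriesIn R M) (n : ℕ) : EntriesIn R fun x => M x ^ n := by
  induction n with
  | zero => simpa only [pow_zero] using EntriesIn.const 1
  | succ n ih => simpa only [pow_succ] using ih.mul hM

theorem EntriesIn.aeval (hM : EntriesIn R M) (q : Polynomial ℂ) :
    EntriesIn R fun x => Polynomial.aeval (M x) q := by
  simp only [Polynomial.aeval_eq_sum_range]
  exact EntriesIn.sum _ fun i _ => EntriesIn.smul (const_fun_mem _) (hM.pow i)

theorem EntriesIn.trace_mem (hM : EntriesIn R M) : (fun x => (M x).trace) ∈ R :=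
  sum_fun_mem _ fun i _ => hM i i

theorem EntriesIn.det_mem (hM : EntriesIn R M) : (fun x => (M x).det) ∈ R := by
  simp only [Matrix.det_apply']
  exact sum_fun_mem _ fun s _ => R.mul_mem (const_fun_mem _) (prod_fun_mem _ fun i _ => hM _ _)

theorem EntriesIn.adjugate (hM : EntriesIn R M) : EntriesIn R fun x => (M x).adjugate := by
  intro a b
  simp only [Matrix.adjugate_apply]
  refine EntriesIn.det_mem (M := fun x => (M x).updateRow b (Pi.single a 1)) fun c e => ?_
  by_cases h : c = b
  · subst h
    simp only [Matrix.updateRow_self]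
    exact const_fun_mem _
  · simp only [Matrix.updateRow_ne h]
    exact hM c e

theorem EntriesIn.inv (hM : EntriesIn R M) (hd : (fun x => (M x).det⁻¹) ∈ R) :
    EntriesIn R fun x => (M x)⁻¹ := by
  simp only [Matrix.inv_def, Ring.inverse_eq_inv']
  exact EntriesIn.smul hd hM.adjugate

theorem eval_mem {τ : Type} {s : X → τ → ℂ} (hs : ∀ c, (fun x => s x c) ∈ R)
    (F : MvPolynomial τ ℂ) : (fun x => MvPolynomial.eval (s x) F) ∈ R := by
  induction F using MvPolynomial.induction_on with
  | C a => simpa only [MvPolynomial.eval_C] using const_fun_mem a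
  | add p q hp hq => simp only [map_add]; exact R.add_mem hp hq
  | mul_X p n hp => simp only [map_mul, MvPolynomial.eval_X]; exact R.mul_mem hp (hs n)

end Functions

section Zariski

variable {σ : Type}

/-- The algebra of functions that become polynomial after multiplication by a power of `d`,
where `d` does not vanish. -/
def regularAway (d : MvPolynomial σ ℂ) : Subalgebra ℂ ((σ → ℂ) → ℂ) where
  carrier := {φ | ∃ (K : ℕ) (G : MvPolynomial σ ℂ), ∀ x, MvPolynomial.eval x d ≠ 0 →
    MvPolynomial.eval x d ^ K * φ x = MvPolynomial.eval x G}
  mul_mem' := by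
    rintro φ ψ ⟨K, G, h⟩ ⟨K', G', h'⟩
    refine ⟨K + K', G * G', fun x hx => ?_⟩
    rw [map_mul, ← h x hx, ← h' x hx, Pi.mul_apply]
    ring
  add_mem' := by
    rintro φ ψ ⟨K, G, h⟩ ⟨K', G', h'⟩
    refine ⟨K + K', d ^ K' * G + d ^ K * G', fun x hx => ?_⟩
    rw [map_add, map_mul, map_mul, map_pow, map_pow, ← h x hx, ← h' x hx, Pi.add_apply]
    ring
  algebraMap_mem' r := ⟨0, MvPolynomial.C r, fun x _ => by simp⟩

/-- The algebra of polynomial functions. -/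
def polyFun (σ : Type) : Subalgebra ℂ ((σ → ℂ) → ℂ) where
  carrier := {φ | ∃ F : MvPolynomial σ ℂ, ∀ x, φ x = MvPolynomial.eval x F}
  mul_mem' := by
    rintro φ ψ ⟨F, h⟩ ⟨G, h'⟩
    exact ⟨F * G, fun x => by rw [map_mul, ← h, ← h', Pi.mul_apply]⟩
  add_mem' := by
    rintro φ ψ ⟨F, h⟩ ⟨G, h'⟩
    exact ⟨F + G, fun x => by rw [map_add, ← h, ← h', Pi.add_apply]⟩
  algebraMap_mem' r := ⟨MvPolynomial.C r, fun x => by simp⟩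

theorem mem_polyFun {φ : (σ → ℂ) → ℂ} :
    φ ∈ polyFun σ ↔ ∃ F : MvPolynomial σ ℂ, ∀ x, φ x = MvPolynomial.eval x F := Iff.rfl

theorem coord_mem_polyFun (c : σ) : (fun x => x c) ∈ polyFun σ :=
  mem_polyFun.2 ⟨MvPolynomial.X c, fun x => by simp⟩

theorem polyFun_le_regularAway (d : MvPolynomial σ ℂ) : polyFun σ ≤ regularAway d := by
  intro φ h
  obtain ⟨F, hF⟩ := mem_polyFun.1 h
  exact ⟨0, F, fun x _ => by rw [pow_zero, one_mul, hF]⟩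

theorem inv_mem_regularAway {ι : Type} [Fintype ι] {φ : ι → (σ → ℂ) → ℂ}
    (hφ : ∀ i, φ i ∈ polyFun σ) {d : MvPolynomial σ ℂ}
    (hd : ∀ x, MvPolynomial.eval x d = ∏ i, φ i x) (i : ι) :
    (fun x => (φ i x)⁻¹) ∈ regularAway d := by
  classical
  obtain ⟨G, hG⟩ := mem_polyFun.1 (prod_fun_mem (Finset.univ.erase i) fun j _ => hφ j)
  refine ⟨1, G, fun x hx => ?_⟩
  rw [← hG, pow_one, hd, ← Finset.mul_prod_erase _ _ (Finset.mem_univ i)]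
  rw [hd] at hx
  have : φ i x ≠ 0 := fun h => hx (Finset.prod_eq_zero (Finset.mem_univ i) h)
  field_simp

/-- Zariski closed subsets of affine space. -/
def IsZariskiClosed (s : Set (σ → ℂ)) : Prop :=
  ∃ T : Set (MvPolynomial σ ℂ), s = {x | ∀ p ∈ T, MvPolynomial.eval x p = 0}

theorem IsZariskiClosed.isClosed {s : Set (σ → ℂ)} (h : IsZariskiClosed s) : IsClosed s := by
  obtain ⟨T, rfl⟩ := h
  simp only [Set.ofPred_forall]
  exact isClosed_biInter fun p _ =>
    isClosed_eq (MvPolynomial.continuous_eval p) continuous_const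

theorem isZariskiClosed_eq {φ : (σ → ℂ) → ℂ} (h : φ ∈ polyFun σ) (c : ℂ) :
    IsZariskiClosed {x | φ x = c} := by
  obtain ⟨F, hF⟩ := mem_polyFun.1 h
  refine ⟨{F - MvPolynomial.C c}, ?_⟩
  ext x
  simp [hF, sub_eq_zero]

theorem isZariskiClosed_iInter {ι : Sort*} {s : ι → Set (σ → ℂ)} (h : ∀ i, IsZariskiClosed (s i)) :
    IsZariskiClosed (⋂ i, s i) := by
  choose T hT using h
  refine ⟨⋃ i, T i, ?_⟩
  ext x
  simp only [Set.mem_iInter, hT, Set.mem_ofPred_eq, Set.mem_iUnion]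
  exact ⟨fun h p ⟨i, hp⟩ => h i p hp, fun h i p hp => h p ⟨i, hp⟩⟩

theorem IsZariskiClosed.inter {s t : Set (σ → ℂ)} (hs : IsZariskiClosed s)
    (ht : IsZariskiClosed t) : IsZariskiClosed (s ∩ t) := by
  rw [Set.inter_eq_iInter]
  exact isZariskiClosed_iInter fun b => by cases b <;> assumption

/-- Rank equalities are not closed conditions as such; the trace form of `mem_legOrbit_iff_trace`
is. -/
theorem isZariskiClosed_legOrbit {ι : Type} [Fintype ι] [DecidableEq ι] {dims : List ℕ} {p : ℕ → ℂ}
    (hξ : DistinctRoots p dims.length) {M : (σ → ℂ) → Matrix ι ι ℂ}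
    (hM : EntriesIn (polyFun σ) M) : IsZariskiClosed {x | M x ∈ legOrbit dims p} := by
  have : {x | M x ∈ legOrbit dims p} =
      (⋂ a, ⋂ b, {x | Polynomial.aeval (M x) (legPoly p (dims.length + 1)) a b = 0}) ∩
      ⋂ j, ⋂ _ : j ≤ dims.length,
        {x | (Polynomial.aeval (M x) (tailPoly p dims.length j)).trace = (dims.getD j 0 : ℕ)} := by
    ext x
    rw [Set.mem_ofPred_eq, mem_legOrbit_iff_trace hξ, ← Matrix.ext_iff]
    simp
  rw [this]
  exact (isZariskiClosed_iInter fun a => isZariskiClosed_iInter fun b =>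
    isZariskiClosed_eq (hM.aeval _ a b) _).inter (isZariskiClosed_iInter fun j =>
      isZariskiClosed_iInter fun _ => isZariskiClosed_eq (hM.aeval _).trace_mem _)

/-- A function on a Zariski closed set that is locally a quotient of polynomials is polynomial. -/
theorem exists_polynomial_of_local [Finite σ] {s : Set (σ → ℂ)} (hs : IsZariskiClosed s)
    (f : s → ℂ)
    (h : ∀ x : s, ∃ q G : MvPolynomial σ ℂ, MvPolynomial.eval x.1 q ≠ 0 ∧
      ∀ y : s, MvPolynomial.eval y.1 q * f y = MvPolynomial.eval y.1 G) :
    ∃ F : MvPolynomial σ ℂ, ∀ x : s, f x = MvPolynomial.eval x.1 F := by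
  -- The ideal of denominators of f; the claim is that it contains 1.
  let J : Ideal (MvPolynomial σ ℂ) :=
    { carrier := {q | ∃ G : MvPolynomial σ ℂ, ∀ y : s,
        MvPolynomial.eval y.1 q * f y = MvPolynomial.eval y.1 G}
      add_mem' := by
        rintro q q' ⟨G, hG⟩ ⟨G', hG'⟩
        exact ⟨G + G', fun y => by rw [map_add, map_add, add_mul, hG, hG']⟩
      zero_mem' := ⟨0, fun y => by simp⟩
      smul_mem' := by
        rintro c q ⟨G, hG⟩
        exact ⟨c * G, fun y => by rw [smul_eq_mul, map_mul, map_mul, mul_assoc, hG]⟩ }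
  -- Equations of s lie in J with numerator 0, so common zeros of J lie in s; there the hypothesis
  -- provides a nonvanishing denominator. The Nullstellensatz concludes.
  have hJ : MvPolynomial.zeroLocus ℂ J = ∅ := by
    rw [Set.eq_empty_iff_forall_notMem]
    intro x hx
    have hx' : ∀ q ∈ J, MvPolynomial.eval x q = 0 := hx
    obtain ⟨T, hT⟩ := hs
    have hxs : x ∈ s := by
      rw [hT]
      intro p hp
      refine hx' p ⟨0, fun y => ?_⟩
      have hy : y.1 ∈ {x | ∀ p ∈ T, MvPolynomial.eval x p = 0} := hT ▸ y.2
      rw [hy p hp, zero_mul, map_zero]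
    obtain ⟨q, G, hq, hG⟩ := h ⟨x, hxs⟩
    exact hq (hx' q ⟨G, hG⟩)
  have h1 := MvPolynomial.vanishingIdeal_zeroLocus_eq_radical (K := ℂ) J
  rw [hJ, MvPolynomial.vanishingIdeal_empty] at h1
  have h2 : (1 : MvPolynomial σ ℂ) ∈ J := by
    rw [← Ideal.eq_top_iff_one, ← Ideal.radical_eq_top, ← h1]
  obtain ⟨G, hG⟩ := h2
  exact ⟨G, fun x => by rw [← hG, map_one, one_mul]⟩

end Zariski

end StarQuiver

/-! ### The bijection of quotients and the regular functions. -/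

namespace StarQuiver

open Matrix Filter Topology

set_option linter.unusedSectionVars false

theorem EntriesIn.atTop {X : Type} {R : Subalgebra ℂ (X → ℂ)} {L : ℕ} {d : Fin (L + 1) → ℕ}
    {u : X → Matrix (Fin (d 0)) (Fin (d 0)) ℂ} (hu : EntriesIn R u) (j : Fin (L + 1)) :
    EntriesIn R fun x => Chain.atTop (u x) j := by
  by_cases hj : j = 0
  · subst hj
    simpa only [Chain.atTop_zero] using hu
  · simp only [Chain.atTop_of_ne _ hj]
    exact EntriesIn.const 1

namespace StarShape

section

variable {m : ℕ} {S : StarShape m} {lam : S.Node → ℂ}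

theorem legTwist_entriesIn {X : Type} {R : Subalgebra ℂ (X → ℂ)} (z : Coord S.dim → ℂ)
    {A : X → Fin m → Matrix (Fin S.center) (Fin S.center) ℂ}
    (hA : ∀ i, EntriesIn R fun x => A x i) (i : Fin m) :
    EntriesIn R fun x => legTwist lam z (A x) i := by
  simp only [legTwist, intertwiner]
  exact EntriesIn.sum _ fun _ _ => ((hA i).aeval _).mul (EntriesIn.const _)

theorem sect_entriesIn {X : Type} {R : Subalgebra ℂ (X → ℂ)} (z : Coord S.dim → ℂ)
    {A : X → Fin m → Matrix (Fin S.center) (Fin S.center) ℂ}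
    (hA : ∀ i, EntriesIn R fun x => A x i)
    (hd : ∀ i, (fun x => (legTwist lam z (A x) i).det⁻¹) ∈ R) (c : Coord S.dim) :
    (fun x => sect lam z (A x) c) ∈ R := by
  have key : ∀ i j, EntriesIn R (fun x => (chain (sect lam z (A x)) i).φ j) ∧
      EntriesIn R (fun x => (chain (sect lam z (A x)) i).ψ j) := by
    intro i j
    have h1 := legTwist_entriesIn (lam := lam) z hA i
    have h2 := h1.inv (hd i)
    have h3 := fun j => EntriesIn.atTop (d := S.legDim i) h1 j
    have h4 := fun j => EntriesIn.atTop (d := S.legDim i) h2 j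
    simp only [sect, chain_ofChains]
    exact ⟨((h3 _).mul (EntriesIn.const _)).mul (h4 _),
      ((h3 _).mul (EntriesIn.const _)).mul (h4 _)⟩
  have h1 : ∀ (a b : S.Node) (e : a ⟶ b), EntriesIn R fun x => fwd (sect lam z (A x)) e :=
    S.arrow_induction fun i j => (key i j).1
  have h2 : ∀ (a b : S.Node) (e : a ⟶ b), EntriesIn R fun x => bwd (sect lam z (A x)) e :=
    S.arrow_induction fun i j => (key i j).2
  obtain ⟨a, b, e, ⟨s, t⟩ | ⟨s, t⟩⟩ := c
  · exact h1 a b e s t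
  · exact h2 a b e s t

end

variable {k : ℕ} {S : StarShape (k + 1)} {lam : S.Node → ℂ}

theorem isZariskiClosed_dualLevel (hS : FlagGeneric S lam) :
    IsZariskiClosed (dualReduction lam).level := by
  have h : (dualReduction lam).level = {B : S.GlCoord → ℂ | lam S.ctr • 1 - (toMat B)ᵀ ∈
        legOrbit (S.leg (Fin.last k)) (legParam lam (Fin.last k))} ∩
      ⋂ i : Fin k, {B : S.GlCoord → ℂ | (diagBlock B i)ᵀ + legParam lam i.castSucc 0 • 1 ∈
        legOrbit (S.leg i.castSucc).tail fun j => legParam lam i.castSucc (j + 1)} :=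
    Set.ext fun (B : S.GlCoord → ℂ) => mem_dualLevel_iff.trans
      ⟨fun h => ⟨h.1, Set.mem_iInter.2 h.2⟩, fun h => ⟨h.1, Set.mem_iInter.1 h.2⟩⟩
  have hM : EntriesIn (polyFun S.GlCoord) fun B => toMat B := fun a b => coord_mem_polyFun _
  have hD : ∀ i : Fin k, EntriesIn (polyFun S.GlCoord) fun B => diagBlock B i :=
    fun i a b => coord_mem_polyFun _
  rw [h]
  refine (isZariskiClosed_legOrbit (hS.generic _) ((EntriesIn.const _).sub hM.transpose)).inter
    (isZariskiClosed_iInter fun i => isZariskiClosed_legOrbit ?_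
      ((hD i).transpose.add (EntriesIn.const _)))
  have hl := List.length_pos_iff.2 (hS.leg_ne_nil i.castSucc)
  obtain ⟨L, hL⟩ : ∃ L, (S.leg i.castSucc).length = L + 1 := ⟨_, (Nat.succ_pred hl.ne').symm⟩
  have hξ := hS.generic i.castSucc
  rw [hL] at hξ
  rw [List.length_tail, hL]
  exact hξ.tail

theorem conjAct_mem_level {B : S.GlCoord → ℂ} (hB : B ∈ (dualReduction lam).level)
    (h : ∀ i : Fin k, GL (Fin (S.adjDim i.castSucc)) ℂ) :
    conjAct h B ∈ (dualReduction lam).level := by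
  have key : ∀ {ι : Type} [Fintype ι] [DecidableEq ι] {d : List ℕ} {p : ℕ → ℂ} {c : ℂ}
      {M u v : Matrix ι ι ℂ}, u * v = 1 → M + c • 1 ∈ legOrbit d p →
      u * M * v + c • 1 ∈ legOrbit d p := by
    intro ι _ _ d p c M u v huv hM
    have hvu := mul_eq_one_comm.1 huv
    refine mem_legOrbit_of_conj (u := v) (v := u) huv hvu ?_ hM
    rw [Matrix.mul_add, Matrix.add_mul, Matrix.mul_smul, Matrix.smul_mul, Matrix.one_mul,
      Matrix.mul_one, ← Matrix.mul_assoc, ← Matrix.mul_assoc, hvu, Matrix.one_mul]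
  obtain ⟨⟨A, hA, hAB⟩, h₂⟩ := hB
  refine ⟨⟨-toMat (conjAct h B) + (-(if Fin.last k = Fin.last k then -lam none else 0)) • 1, ?_, ?_⟩,
    fun i => ?_⟩
  · have : -toMat (conjAct h B) = bd h * -toMat B * bd h⁻¹ := by
      rw [toMat_conjAct, Matrix.mul_neg, Matrix.neg_mul]
      rfl
    rw [this]
    refine key (bd_mul_bd_inv h) ?_
    rw [hAB, neg_smul, add_neg_cancel_right]
    exact hA
  · rw [neg_smul, neg_add_cancel_right]
  · obtain ⟨A, hA, hAB⟩ := h₂ i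
    refine ⟨diagBlock (conjAct h B) i + legParam lam i.castSucc 0 • 1, ?_,
      (add_sub_cancel_right _ _).symm⟩
    have : diagBlock (conjAct h B) i = (h i).val * diagBlock B i * (h i)⁻¹.val := by
      change colBlock (rowBlock (toMat (conjAct h B)) i) i = _
      rw [toMat_conjAct, rowBlock_mul, rowBlock_blockDiagonal'_mul, colBlock_mul_blockDiagonal']
      rfl
    rw [this]
    refine key (Units.mul_inv (h i)) ?_
    rw [hAB, sub_add_cancel]
    exact hA

theorem rel_basePoint (hS : FlagGeneric S lam) {B B' : S.GlCoord → ℂ}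
    (hB : B ∈ (dualReduction lam).level) (hB' : B' ∈ (dualReduction lam).level)
    (h : (dualReduction lam).Rel ⟨B, hB⟩ ⟨B', hB'⟩) :
    (quiverVariety S.dim lam).Rel ⟨basePoint hS hB, basePoint_mem hS hB⟩
      ⟨basePoint hS hB', basePoint_mem hS hB'⟩ := by
  obtain ⟨C, h₁, h₂⟩ := h
  -- The common limit can be lifted only if it lies in the level set, which is closed and H-stable.
  have hC : C ∈ (dualReduction lam).level := by
    refine (isZariskiClosed_dualLevel hS).isClosed.closure_subset_iff.2 ?_ h₁
    rintro _ ⟨g, rfl⟩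
    exact conjAct_mem_level hB g
  exact rel_of_mem_closure _ _ (mem_closure_basePoint hS hB hC h₁)
    (mem_closure_basePoint hS hB' hC h₂)

theorem _root_.StarQuiver.Reduction.Rel.symm {R : Reduction} {x y : R.level} (h : R.Rel x y) :
    R.Rel y x := by
  rwa [Reduction.Rel, Set.inter_comm]

/-- The bijection between the points of the two quotients. -/
noncomputable def quotEquiv (hS : FlagGeneric S lam) :
    (quiverVariety S.dim lam).Quotient ≃ (dualReduction lam).Quotient where
  toFun := Quot.map (fun x => ⟨toGl hS.leg_ne_nil x.1, toGl_mem_level hS x.2⟩)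
    fun x y h => rel_toGl hS x.2 y.2 h
  invFun := Quot.map (fun B => ⟨basePoint hS B.2, basePoint_mem hS B.2⟩)
    fun B B' h => rel_basePoint hS B.2 B'.2 h
  left_inv := by
    rintro ⟨x⟩
    exact Quot.sound (rel_of_resid_eq hS x.2 _ (resid_basePoint hS _)).symm
  right_inv := by
    rintro ⟨B⟩
    obtain ⟨h, hh⟩ := exists_toGl_eq_conjAct hS B.2 (basePoint_mem hS B.2) (resid_basePoint hS B.2)
    exact Quot.sound (dual_rel_of_eq_conjAct B.2 _ hh)

theorem toGl_mem_polyFun (hleg : ∀ i, S.leg i ≠ []) (c : S.GlCoord) :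
    (fun x => toGl hleg x c) ∈ polyFun (Coord S.dim) := by
  have h₁ : EntriesIn (polyFun (Coord S.dim)) fun x => rowMat hleg x :=
    fun a b => coord_mem_polyFun _
  have h₂ : EntriesIn (polyFun (Coord S.dim)) fun x => colMat hleg x :=
    fun a b => coord_mem_polyFun _
  exact h₁.mul h₂ _ _

theorem pairResid_entriesIn {X : Type} {R : Subalgebra ℂ (X → ℂ)}
    {P : X → Matrix (Fin S.center) S.BlockIndex ℂ} {Q : X → Matrix S.BlockIndex (Fin S.center) ℂ}
    (hP : EntriesIn R P) (hQ : EntriesIn R Q) (i : Fin (k + 1)) :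
    EntriesIn R fun x => pairResid lam (P x) (Q x) i := by
  refine Fin.lastCases ?_ (fun i => ?_) i
  · simp only [pairResid_last]
    exact (EntriesIn.const _).sub (hP.mul hQ)
  · simp only [pairResid_castSucc]
    exact EntriesIn.mul (M := fun x => colBlock (P x) i) (fun a b => hP _ _) fun a b => hQ _ _

instance : Finite S.GlCoord := inferInstanceAs (Finite (S.BlockIndex × S.BlockIndex))

/-- One direction composes with the polynomial map `toGl`. For the converse, `sect` based over B₀
lifts nearby points B by rational functions of B, so f is locally a quotient of polynomials, and
`exists_polynomial_of_local` patches. -/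
theorem isRegular_comp_quotEquiv (hS : FlagGeneric S lam) (f : (dualReduction lam).Quotient → ℂ) :
    (dualReduction lam).IsRegular f ↔ (quiverVariety S.dim lam).IsRegular (f ∘ quotEquiv hS) := by
  constructor
  · rintro ⟨F, hF⟩
    obtain ⟨F', hF'⟩ := mem_polyFun.1 (eval_mem (toGl_mem_polyFun hS.leg_ne_nil) F)
    refine ⟨F', fun x => ?_⟩
    exact (hF _).trans (hF' x.1)
  · rintro ⟨F, hF⟩
    refine exists_polynomial_of_local (σ := S.GlCoord) (isZariskiClosed_dualLevel hS) (fun B => f (Quot.mk _ B))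
      fun B₀ => ?_
    obtain ⟨B₀, hB₀⟩ := B₀
    let A : (S.GlCoord → ℂ) → Fin (k + 1) → Matrix (Fin S.center) (Fin S.center) ℂ :=
      fun B => pairResid lam (baseP hS) (baseQ hS B)
    have hAB₀ : A B₀ = resid (basePoint hS hB₀) := (resid_basePoint hS hB₀).symm
    have hA : ∀ i, EntriesIn (polyFun S.GlCoord) fun B => A B i :=
      pairResid_entriesIn (EntriesIn.const _) fun a b => coord_mem_polyFun _
    have hu : ∀ i, (fun B => (legTwist lam (basePoint hS hB₀) (A B) i).det) ∈ polyFun S.GlCoord :=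
      fun i => (legTwist_entriesIn _ hA i).det_mem
    obtain ⟨d, hd⟩ := mem_polyFun.1 (prod_fun_mem Finset.univ fun i _ => hu i)
    obtain ⟨K, G, hG⟩ := eval_mem (R := regularAway d) (sect_entriesIn (basePoint hS hB₀)
      (fun i a b => polyFun_le_regularAway d (hA i a b))
      (inv_mem_regularAway hu fun B => (hd B).symm)) F
    -- The extra factor d makes the identity hold trivially where d vanishes and `sect` is
    -- meaningless.
    refine ⟨d ^ (K + 1), d * G, ?_, fun B => ?_⟩
    · rw [map_pow, ← hd]
      refine pow_ne_zero _ (Finset.prod_ne_zero_iff.2 fun i _ => ?_)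
      change (legTwist lam (basePoint hS hB₀) (A B₀) i).det ≠ 0
      rw [hAB₀, legTwist_self hS.generic (basePoint_mem hS hB₀), Matrix.det_one]
      exact one_ne_zero
    · obtain ⟨B, hB⟩ := B
      by_cases h0 : MvPolynomial.eval B d = 0
      · simp [h0]
      have hdet : ∀ i, (legTwist lam (basePoint hS hB₀) (A B) i).det ≠ 0 := by
        intro i hi
        refine h0 ?_
        rw [← hd]
        exact Finset.prod_eq_zero (Finset.mem_univ i) hi
      have hAO := fun i => pairResid_mem_legOrbit hS (pairLevel_base hS hB) i
      have hx := sect_mem_level hS.generic (basePoint_mem hS hB₀) hAO (sum_pairResid _ _) hdet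
      have hr : resid (sect lam (basePoint hS hB₀) (A B)) = A B :=
        funext fun i => resid_sect hS.generic (basePoint_mem hS hB₀) hAO hdet i
      obtain ⟨h, hh⟩ := exists_toGl_eq_conjAct hS hB hx hr
      have hq : quotEquiv hS (Quot.mk _ ⟨_, hx⟩) = Quot.mk _ ⟨B, hB⟩ :=
        Quot.sound (dual_rel_of_eq_conjAct hB _ hh)
      have hf : f (Quot.mk _ ⟨B, hB⟩) = _ := (congrArg f hq).symm.trans (hF ⟨_, hx⟩)
      refine (congrArg (fun t => MvPolynomial.eval B (d ^ (K + 1)) * t) hf).trans ?_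
      change MvPolynomial.eval B (d ^ (K + 1)) * _ = MvPolynomial.eval B (d * G)
      rw [map_pow, map_mul, pow_succ', mul_assoc]
      exact congrArg _ (hG B h0)

end StarShape

end StarQuiver

/-! ### Compatibility with the Poisson brackets. -/

namespace StarQuiver

open Matrix

set_option linter.unusedSectionVars false

theorem eval_bind₁ {σ τ : Type} (β : σ → MvPolynomial τ ℂ) (x : τ → ℂ) (F : MvPolynomial σ ℂ) :
    MvPolynomial.eval x (MvPolynomial.bind₁ β F) =
      MvPolynomial.eval (fun s => MvPolynomial.eval x (β s)) F := by
  induction F using MvPolynomial.induction_on with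
  | C a => simp
  | add p q hp hq => simp [hp, hq]
  | mul_X p n hp => simp [hp]

theorem eval_pderiv_bind₁ {σ τ : Type} [Fintype σ] (β : σ → MvPolynomial τ ℂ) (x : τ → ℂ)
    (y : τ) (F : MvPolynomial σ ℂ) :
    MvPolynomial.eval x (MvPolynomial.pderiv y (MvPolynomial.bind₁ β F)) =
      ∑ s, MvPolynomial.eval (fun s => MvPolynomial.eval x (β s)) (MvPolynomial.pderiv s F) *
        MvPolynomial.eval x (MvPolynomial.pderiv y (β s)) := by
  classical
  induction F using MvPolynomial.induction_on with
  | C a => simp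
  | add p q hp hq => simp [hp, hq, add_mul, Finset.sum_add_distrib]
  | mul_X p n hp =>
    simp only [map_mul, MvPolynomial.bind₁_X_right, Derivation.leibniz, map_add, smul_eq_mul,
      eval_bind₁, hp, add_mul, Finset.sum_add_distrib, MvPolynomial.pderiv_X, MvPolynomial.eval_X]
    congr 1
    · rw [Finset.sum_eq_single n]
      · simp
      · intro s _ hs
        simp [hs.symm]
      · simp
    · rw [Finset.mul_sum]
      exact Finset.sum_congr rfl fun s _ => (mul_assoc _ _ _).symm

theorem pderiv_bind₁_eq_zero {σ τ : Type} (β : σ → MvPolynomial τ ℂ) {y : τ}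
    (h : ∀ s, MvPolynomial.pderiv y (β s) = 0) (F : MvPolynomial σ ℂ) :
    MvPolynomial.pderiv y (MvPolynomial.bind₁ β F) = 0 := by
  induction F using MvPolynomial.induction_on with
  | C a => simp
  | add p q hp hq => simp [hp, hq]
  | mul_X p n hp => simp [hp, h, Derivation.leibniz]

namespace StarShape

variable {k : ℕ} {S : StarShape (k + 1)} {lam : S.Node → ℂ} (hleg : ∀ i, S.leg i ≠ [])

/-- The coordinates that are the entries of `colMat`. -/
def colCoord (c : Fin S.center) (s : S.BlockIndex) : Coord S.dim :=
  ⟨S.nd s.1.castSucc (first hleg s.1.castSucc).succ,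
    S.nd s.1.castSucc (first hleg s.1.castSucc).castSucc, S.arr _ _,
    Sum.inl (c, adjEquiv hleg s.1.castSucc s.2)⟩

/-- The coordinates that are the entries of `rowMat`. -/
def rowCoord (s : S.BlockIndex) (c : Fin S.center) : Coord S.dim :=
  ⟨S.nd s.1.castSucc (first hleg s.1.castSucc).succ,
    S.nd s.1.castSucc (first hleg s.1.castSucc).castSucc, S.arr _ _,
    Sum.inr (adjEquiv hleg s.1.castSucc s.2, c)⟩

theorem nd_succ_inj {i i' : Fin (k + 1)} {j : Fin (S.leg i).length} {j' : Fin (S.leg i').length}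
    (h : S.nd i j.succ = S.nd i' j'.succ) : i = i' ∧ j.val = j'.val := by
  have h' : (some ⟨i, j⟩ : Option (Σ i, Fin (S.leg i).length)) = some ⟨i', j'⟩ := h
  cases h'
  exact ⟨rfl, rfl⟩

theorem colCoord_inj {c c' : Fin S.center} {s s' : S.BlockIndex} :
    colCoord hleg c s = colCoord hleg c' s' ↔ c = c' ∧ s = s' := by
  refine ⟨fun h => ?_, by rintro ⟨rfl, rfl⟩; rfl⟩
  obtain ⟨i, b⟩ := s
  obtain ⟨i', b'⟩ := s'
  obtain rfl : i = i' := Fin.castSucc_injective _ (nd_succ_inj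
    (j := first hleg i.castSucc) (j' := first hleg i'.castSucc) (congrArg Sigma.fst h)).1
  have h' := Sum.inl.inj (congrArg Prod.snd (eq_of_heq (Sigma.mk.inj (eq_of_heq
    (Sigma.mk.inj h).2)).2))
  have h1 : c = c' := congrArg Prod.fst h'
  have h2 : adjEquiv hleg i.castSucc b = adjEquiv hleg i.castSucc b' := congrArg Prod.snd h'
  exact ⟨h1, by rw [(adjEquiv hleg i.castSucc).injective h2]⟩

theorem rowCoord_inj {c c' : Fin S.center} {s s' : S.BlockIndex} :
    rowCoord hleg s c = rowCoord hleg s' c' ↔ s = s' ∧ c = c' := by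
  refine ⟨fun h => ?_, by rintro ⟨rfl, rfl⟩; rfl⟩
  obtain ⟨i, b⟩ := s
  obtain ⟨i', b'⟩ := s'
  obtain rfl : i = i' := Fin.castSucc_injective _ (nd_succ_inj
    (j := first hleg i.castSucc) (j' := first hleg i'.castSucc) (congrArg Sigma.fst h)).1
  have h' := Sum.inr.inj (congrArg Prod.snd (eq_of_heq (Sigma.mk.inj (eq_of_heq
    (Sigma.mk.inj h).2)).2))
  have h1 : c = c' := congrArg Prod.snd h'
  have h2 : adjEquiv hleg i.castSucc b = adjEquiv hleg i.castSucc b' := congrArg Prod.fst h'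
  exact ⟨by rw [(adjEquiv hleg i.castSucc).injective h2], h1⟩

theorem colCoord_ne_rowCoord {c c' : Fin S.center} {s s' : S.BlockIndex} :
    colCoord hleg c s ≠ rowCoord hleg s' c' := by
  intro h
  obtain ⟨i, b⟩ := s
  obtain ⟨i', b'⟩ := s'
  obtain rfl : i = i' := Fin.castSucc_injective _ (nd_succ_inj
    (j := first hleg i.castSucc) (j' := first hleg i'.castSucc) (congrArg Sigma.fst h)).1
  exact Sum.inl_ne_inr (congrArg Prod.snd (eq_of_heq (Sigma.mk.inj (eq_of_heq
    (Sigma.mk.inj h).2)).2))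

/-- Every term of the bracket contains a derivative of F, so it suffices that F alone depends only
on the entries of P and Q. -/
theorem quiverBracket_eq {F : MvPolynomial (Coord S.dim) ℂ}
    (hF : ∀ y, (∀ c s, colCoord hleg c s ≠ y) → (∀ s c, rowCoord hleg s c ≠ y) →
      MvPolynomial.pderiv y F = 0) (G : MvPolynomial (Coord S.dim) ℂ) :
    quiverBracket F G = ∑ s : S.BlockIndex, ∑ c : Fin S.center,
      (MvPolynomial.pderiv (colCoord hleg c s) F * MvPolynomial.pderiv (rowCoord hleg s c) G -
        MvPolynomial.pderiv (rowCoord hleg s c) F * MvPolynomial.pderiv (colCoord hleg c s) G) := by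
  rw [quiverBracket, sum_arrow (S := S) (fun i j e => ∑ a : Fin (S.dim j), ∑ b : Fin (S.dim i),
    (MvPolynomial.pderiv ⟨i, j, e, Sum.inl (a, b)⟩ F *
        MvPolynomial.pderiv ⟨i, j, e, Sum.inr (b, a)⟩ G -
      MvPolynomial.pderiv ⟨i, j, e, Sum.inr (b, a)⟩ F *
        MvPolynomial.pderiv ⟨i, j, e, Sum.inl (a, b)⟩ G))]
  have hz : ∀ (i : Fin (k + 1)) (j : Fin (S.leg i).length)
      (t : (Fin (S.dim (S.nd i j.castSucc)) × Fin (S.dim (S.nd i j.succ))) ⊕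
        (Fin (S.dim (S.nd i j.succ)) × Fin (S.dim (S.nd i j.castSucc)))),
      (i = Fin.last k ∨ j.val ≠ 0) → MvPolynomial.pderiv
        (⟨S.nd i j.succ, S.nd i j.castSucc, S.arr i j, t⟩ : Coord S.dim) F = 0 := by
    intro i j t hij
    have : ∀ i' : Fin k, S.nd i'.castSucc (first hleg i'.castSucc).succ ≠ S.nd i j.succ := by
      intro i' h
      obtain ⟨h1, h2⟩ := nd_succ_inj h
      rcases hij with h3 | h3
      · exact (Fin.castSucc_lt_last i').ne (h1.trans h3)
      · exact h3 h2.symm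
    exact hF _ (fun c s h => this s.1 (congrArg Sigma.fst h))
      fun s c h => this s.1 (congrArg Sigma.fst h)
  rw [Fin.sum_univ_castSucc, Fintype.sum_sigma]
  have hlast : ∑ j : Fin (S.leg (Fin.last k)).length,
      ∑ a : Fin (S.dim (S.nd (Fin.last k) j.castSucc)), ∑ b : Fin (S.dim (S.nd (Fin.last k) j.succ)),
      (MvPolynomial.pderiv ⟨_, _, S.arr (Fin.last k) j, Sum.inl (a, b)⟩ F *
        MvPolynomial.pderiv ⟨_, _, S.arr (Fin.last k) j, Sum.inr (b, a)⟩ G -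
      MvPolynomial.pderiv ⟨_, _, S.arr (Fin.last k) j, Sum.inr (b, a)⟩ F *
        MvPolynomial.pderiv ⟨_, _, S.arr (Fin.last k) j, Sum.inl (a, b)⟩ G) = 0 :=
    Finset.sum_eq_zero fun j _ => Finset.sum_eq_zero fun a _ => Finset.sum_eq_zero fun b _ => by
      rw [hz _ _ _ (Or.inl rfl), hz _ _ _ (Or.inl rfl), zero_mul, zero_mul, sub_zero]
  rw [hlast, add_zero]
  refine Finset.sum_congr rfl fun i _ => ?_
  rw [Finset.sum_eq_single (first hleg i.castSucc)]
  · rw [Finset.sum_comm]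
    exact ((adjEquiv hleg i.castSucc).sum_comp fun b => ∑ c : Fin S.center,
      (MvPolynomial.pderiv (⟨_, _, S.arr i.castSucc (first hleg i.castSucc), Sum.inl (c, b)⟩ :
          Coord S.dim) F *
        MvPolynomial.pderiv (⟨_, _, S.arr i.castSucc (first hleg i.castSucc), Sum.inr (b, c)⟩ :
          Coord S.dim) G -
      MvPolynomial.pderiv (⟨_, _, S.arr i.castSucc (first hleg i.castSucc), Sum.inr (b, c)⟩ :
          Coord S.dim) F *
        MvPolynomial.pderiv (⟨_, _, S.arr i.castSucc (first hleg i.castSucc), Sum.inl (c, b)⟩ :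
          Coord S.dim) G)).symm
  · intro j _ hj
    have hj' : j.val ≠ 0 := fun h => hj (Fin.ext h)
    refine Finset.sum_eq_zero fun a _ => Finset.sum_eq_zero fun b _ => ?_
    rw [hz _ _ _ (Or.inr hj'), hz _ _ _ (Or.inr hj'), zero_mul, zero_mul, sub_zero]
  · intro h
    exact absurd (Finset.mem_univ _) h

/-- The polynomials that are the coordinates of `toGl`. -/
noncomputable def toGlPoly (p : S.GlCoord) : MvPolynomial (Coord S.dim) ℂ :=
  ∑ c, MvPolynomial.X (rowCoord hleg p.2 c) * MvPolynomial.X (colCoord hleg c p.1)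

theorem eval_toGlPoly (x : Coord S.dim → ℂ) (p : S.GlCoord) :
    MvPolynomial.eval x (toGlPoly hleg p) = toGl hleg x p := by
  simp only [toGlPoly, map_sum, map_mul, MvPolynomial.eval_X]
  rfl

theorem pderiv_colCoord_toGlPoly (c : Fin S.center) (s : S.BlockIndex) (p : S.GlCoord) :
    MvPolynomial.pderiv (colCoord hleg c s) (toGlPoly hleg p) =
      if p.1 = s then MvPolynomial.X (rowCoord hleg p.2 c) else 0 := by
  classical
  simp only [toGlPoly, map_sum, Derivation.leibniz, MvPolynomial.pderiv_X, Pi.single_apply,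
    (colCoord_ne_rowCoord hleg).symm, colCoord_inj, smul_eq_mul]
  by_cases h : p.1 = s
  · simp [h]
  · simp [h]

theorem pderiv_rowCoord_toGlPoly (c : Fin S.center) (s : S.BlockIndex) (p : S.GlCoord) :
    MvPolynomial.pderiv (rowCoord hleg s c) (toGlPoly hleg p) =
      if p.2 = s then MvPolynomial.X (colCoord hleg c p.1) else 0 := by
  classical
  simp only [toGlPoly, map_sum, Derivation.leibniz, MvPolynomial.pderiv_X, Pi.single_apply,
    colCoord_ne_rowCoord hleg, rowCoord_inj, smul_eq_mul]
  by_cases h : p.2 = s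
  · simp [h]
  · simp [h]

theorem pderiv_toGlPoly_eq_zero {y : Coord S.dim} (h₁ : ∀ c s, colCoord hleg c s ≠ y)
    (h₂ : ∀ s c, rowCoord hleg s c ≠ y) (p : S.GlCoord) :
    MvPolynomial.pderiv y (toGlPoly hleg p) = 0 := by
  classical
  simp [toGlPoly, Derivation.leibniz, MvPolynomial.pderiv_X, h₁, h₂]

/-- The values of the partial derivatives of a function on `gl_N`. -/
noncomputable def gradMat (F : MvPolynomial S.GlCoord ℂ) (B : S.GlCoord → ℂ) :
    Matrix S.BlockIndex S.BlockIndex ℂ :=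
  Matrix.of fun a b => MvPolynomial.eval B (MvPolynomial.pderiv (a, b) F)

theorem eval_pderiv_colCoord (F : MvPolynomial S.GlCoord ℂ) (x : Coord S.dim → ℂ)
    (c : Fin S.center) (s : S.BlockIndex) :
    MvPolynomial.eval x (MvPolynomial.pderiv (colCoord hleg c s)
      (MvPolynomial.bind₁ (toGlPoly hleg) F)) = (gradMat F (toGl hleg x) * rowMat hleg x) s c := by
  rw [eval_pderiv_bind₁, Fintype.sum_prod_type, Finset.sum_eq_single s]
  · simp only [eval_toGlPoly, pderiv_colCoord_toGlPoly, if_true, MvPolynomial.eval_X]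
    rfl
  · intro s' _ hs
    simp [pderiv_colCoord_toGlPoly, hs]
  · simp

theorem eval_pderiv_rowCoord (F : MvPolynomial S.GlCoord ℂ) (x : Coord S.dim → ℂ)
    (c : Fin S.center) (s : S.BlockIndex) :
    MvPolynomial.eval x (MvPolynomial.pderiv (rowCoord hleg s c)
      (MvPolynomial.bind₁ (toGlPoly hleg) F)) = (colMat hleg x * gradMat F (toGl hleg x)) c s := by
  rw [eval_pderiv_bind₁, Fintype.sum_prod_type_right, Finset.sum_eq_single s]
  · simp only [eval_toGlPoly, pderiv_rowCoord_toGlPoly, if_true, MvPolynomial.eval_X]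
    exact Finset.sum_congr rfl fun _ _ => mul_comm _ _
  · intro s' _ hs
    simp [pderiv_rowCoord_toGlPoly, hs]
  · simp

/-- `grad` and `gradMat` are indexed oppositely, so rewriting the trace in terms of Bᵀ reverses the
commutator. -/
theorem eval_glBracket (F G : MvPolynomial S.GlCoord ℂ) (B : S.GlCoord → ℂ) :
    MvPolynomial.eval B (glBracket F G) =
      ((toMat B)ᵀ * (gradMat G B * gradMat F B - gradMat F B * gradMat G B)).trace := by
  have h : ∀ F : MvPolynomial S.GlCoord ℂ, (grad F).map (MvPolynomial.eval B) = (gradMat F B)ᵀ :=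
    fun F => rfl
  have hX : (Matrix.mvPolynomialX S.BlockIndex S.BlockIndex ℂ).map (MvPolynomial.eval B) =
      toMat B := by
    ext a b
    simp [toMat]
  have h1 : MvPolynomial.eval B (glBracket F G) = ((Matrix.mvPolynomialX S.BlockIndex S.BlockIndex ℂ *
      (grad F * grad G - grad G * grad F)).map (MvPolynomial.eval B)).trace :=
    AddMonoidHom.map_trace (MvPolynomial.eval B) _
  rw [h1, Matrix.map_mul, Matrix.map_sub _ (map_sub _), Matrix.map_mul, Matrix.map_mul, h, h, hX,
    ← Matrix.trace_transpose, Matrix.transpose_mul, Matrix.transpose_sub, Matrix.transpose_mul,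
    Matrix.transpose_mul, Matrix.transpose_transpose, Matrix.transpose_transpose,
    Matrix.trace_mul_comm]

/-- With f, g the derivative matrices of F, G at B, the chain rule gives fQ and Pf as the
derivatives in P and Q. The bracket is therefore Tr(QP(gf - fg)), the Lie-Poisson bracket at B =
(QP)ᵀ. -/
theorem eval_quiverBracket (F G : MvPolynomial S.GlCoord ℂ) (x : Coord S.dim → ℂ) :
    MvPolynomial.eval x (quiverBracket (MvPolynomial.bind₁ (toGlPoly hleg) F)
      (MvPolynomial.bind₁ (toGlPoly hleg) G)) =
      MvPolynomial.eval (toGl hleg x) (glBracket F G) := by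
  rw [quiverBracket_eq hleg (fun y h₁ h₂ => pderiv_bind₁_eq_zero _
    (pderiv_toGlPoly_eq_zero hleg h₁ h₂) _), eval_glBracket, transpose_toMat_toGl]
  simp only [map_sum, map_sub, map_mul, eval_pderiv_colCoord, eval_pderiv_rowCoord,
    Finset.sum_sub_distrib]
  set f := gradMat F (toGl hleg x)
  set g := gradMat G (toGl hleg x)
  set R := rowMat hleg x
  set C := colMat hleg x
  have h₁ : ∀ a b : Matrix S.BlockIndex S.BlockIndex ℂ,
      ∑ s, ∑ c, (a * R) s c * (C * b) c s = (R * C * (b * a)).trace := by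
    intro a b
    rw [Matrix.mul_assoc R, Matrix.trace_mul_comm, ← Matrix.mul_assoc, Matrix.mul_assoc,
      Matrix.trace_mul_comm]
    rfl
  have h₂ : ∑ s, ∑ c, (C * f) c s * (g * R) s c = (R * C * (f * g)).trace := by
    rw [← h₁]
    simp only [mul_comm]
  rw [h₁, h₂, ← Matrix.trace_sub, ← Matrix.mul_sub]

/-- Equivariance of `toGl` turns invariant lifts on `gl_N` into invariant lifts on W, whose bracket
is known. -/
theorem isPoissonBracket_comp_quotEquiv (hS : FlagGeneric S lam)
    {f g h : (dualReduction lam).Quotient → ℂ} (H : (dualReduction lam).IsPoissonBracket f g h) :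
    (quiverVariety S.dim lam).IsPoissonBracket (f ∘ quotEquiv hS) (g ∘ quotEquiv hS)
      (h ∘ quotEquiv hS) := by
  have key : ∀ {F : MvPolynomial S.GlCoord ℂ} {f : (dualReduction lam).Quotient → ℂ},
      (dualReduction lam).Represents F f → (quiverVariety S.dim lam).Represents
        (MvPolynomial.bind₁ (toGlPoly hS.leg_ne_nil) F : MvPolynomial (Coord S.dim) ℂ)
        (f ∘ quotEquiv hS) := by
    rintro F f ⟨hinv, hf⟩
    have he : ∀ x, MvPolynomial.eval x (MvPolynomial.bind₁ (toGlPoly hS.leg_ne_nil) F) =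
        MvPolynomial.eval (toGl hS.leg_ne_nil x) F := fun x => by
      rw [eval_bind₁]
      simp only [eval_toGlPoly]
    refine ⟨fun γ x => ?_, fun x => (hf _).trans (he x.1).symm⟩
    refine (he _).trans (Eq.trans ?_ (he x).symm)
    refine (congrArg (fun B => MvPolynomial.eval B F)
      (toGl_quiverAct hS.leg_ne_nil γ x)).trans ?_
    exact hinv _ _
  obtain ⟨F, G, hF, hG, hh⟩ := H
  exact ⟨_, _, key hF, key hG, fun x => (hh _).trans (eval_quiverBracket _ F G x.1).symm⟩

end StarShape

end StarQuiver

/-! ### From almost affine quivers to the working hypotheses, and the conclusion. -/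

namespace StarQuiver

open Matrix

set_option linter.unusedSectionVars false

theorem getD_lt_getD_cons {n : ℕ} {l : List ℕ} (hl : (n :: l).Pairwise (· > ·))
    (hpos : ∀ d ∈ n :: l, 0 < d) : ∀ j ≤ l.length, l.getD j 0 < (n :: l).getD j 0 := by
  induction l generalizing n with
  | nil =>
    intro j hj
    obtain rfl : j = 0 := Nat.le_zero.1 hj
    simpa using hpos
  | cons d l ih =>
    intro j hj
    rcases j with _ | j
    · simpa using (List.pairwise_cons.1 hl).1 d (by simp)
    · exact ih (List.pairwise_cons.1 hl).2 (fun e he => hpos e (List.mem_cons_of_mem _ he)) j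
        (Nat.le_of_succ_le_succ hj)

theorem getD_reverse_range' (n j : ℕ) : (List.range' 1 n).reverse.getD j 0 = n - j := by
  rw [List.getD_eq_getElem?_getD]
  by_cases h : j < n
  · rw [List.getElem?_reverse (by simpa using h), List.getElem?_range' (by simp; omega)]
    simp
    omega
  · rw [List.getElem?_eq_none (by simpa using h)]
    simp
    omega

namespace StarShape

variable {k : ℕ} {S : StarShape (k + 1)}

theorem incr_leg_last : S.incr.leg (Fin.last k) = (S.leg (Fin.last k)).map (· + 1) ++ [1] :=
  if_pos rfl

theorem incr_leg_castSucc (i : Fin k) : S.incr.leg i.castSucc = S.leg i.castSucc :=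
  if_neg (Fin.castSucc_lt_last i).ne

theorem AlmostAffine.incr_full (hS : S.AlmostAffine) :
    S.incr.center :: S.incr.leg (Fin.last k) = (List.range' 1 S.incr.center).reverse := by
  have h : S.incr.center :: S.incr.leg (Fin.last k) =
      (S.center :: S.leg (Fin.last k)).map (· + 1) ++ [1] := by
    rw [incr_leg_last]
    rfl
  rw [h, hS.full]
  change _ = (List.range' 1 (S.center + 1)).reverse
  rw [List.range'_succ, List.reverse_cons, List.map_reverse]
  congr 2
  have := List.map_add_range' (a := 1) 1 S.center 1
  simpa only [add_comm] using this

theorem isSemisimple_of_residue {ι : Type} [Fintype ι] [DecidableEq ι] {A : Matrix ι ι ℂ} {c : ℂ}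
    (h : Module.End.IsSemisimple (Matrix.toLin' (A + c • (1 : Matrix ι ι ℂ)))) :
    Module.End.IsSemisimple (Matrix.toLin' A) := by
  rw [← Module.End.isSemisimple_sub_algebraMap_iff (μ := -c)]
  convert h using 1
  rw [map_add, map_smul, Matrix.toLin'_one, map_neg, sub_neg_eq_add]
  rfl

/-- Dimensions still strictly decrease after incrementing: the last leg is N, …, 1, and on the
others only the top has grown. The scalar shift of the last orbit does not affect semisimplicity. -/
theorem AlmostAffine.distinctRoots_incr (hS : S.AlmostAffine) {lam : S.incr.Node → ℂ}
    (hgen : ∀ i, IsSemisimpleOrbit (residueOrbit lam (Fin S.incr.center) i)) :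
    Generic lam := by
  intro i
  obtain ⟨⟨B, hB⟩, hs⟩ := hgen i
  obtain ⟨A, hA, rfl⟩ := hB
  refine distinctRoots_of_isSemisimple ?_ hA (isSemisimple_of_residue (hs _ ⟨A, hA, rfl⟩))
  rw [Fintype.card_fin]
  refine Fin.lastCases ?_ (fun i => ?_) i
  · have h : ∀ j, (S.incr.center :: S.incr.leg (Fin.last k)).getD j 0 = S.incr.center - j := by
      intro j
      rw [hS.incr_full, getD_reverse_range']
    intro j hj
    have h1 := h (j + 1)
    rw [List.getD_cons_succ] at h1
    have h2 : (S.incr.leg (Fin.last k)).length + 1 = S.incr.center := by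
      simpa using congrArg List.length hS.incr_full
    rw [h1, h j]
    omega
  · have hd := hS.decreasing i.castSucc
    have hp := hS.pos i.castSucc
    rw [incr_leg_castSucc]
    refine getD_lt_getD_cons (List.pairwise_cons.2
      ⟨fun d hd' => ?_, (List.pairwise_cons.1 hd).2⟩) ?_
    · exact Nat.lt_succ_of_lt ((List.pairwise_cons.1 hd).1 d hd')
    · intro d hd'
      rcases List.mem_cons.1 hd' with rfl | hd'
      · exact Nat.succ_pos _
      · exact hp d hd'

theorem AlmostAffine.flagGeneric_incr (hS : S.AlmostAffine) {lam : S.incr.Node → ℂ}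
    (hgen : ∀ i, IsSemisimpleOrbit (residueOrbit lam (Fin S.incr.center) i)) :
    FlagGeneric S.incr lam where
  generic := hS.distinctRoots_incr hgen
  leg_ne_nil i := by
    refine Fin.lastCases ?_ (fun i => ?_) i
    · rw [incr_leg_last]
      simp
    · rw [incr_leg_castSucc]
      exact hS.leg_ne_nil _
  sum_adjDim := hS.sum_incr
  length_last := by simpa using congrArg List.length hS.incr_full
  getD_last j hj := by
    have h2 : (S.incr.leg (Fin.last k)).length + 1 = S.incr.center := by
      simpa using congrArg List.length hS.incr_full
    rw [hS.incr_full, getD_reverse_range', ← List.getD_cons_succ (x := S.incr.center),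
      hS.incr_full, getD_reverse_range']
    omega

end StarShape

end StarQuiver

theorem mainTheorem1 {k : ℕ} (S : StarQuiver.StarShape (k + 1)) (hS : S.AlmostAffine)
    (lam : S.incr.Node → ℂ)
    (hlam : ∑ a : S.incr.Node, lam a * (S.incr.dim a : ℂ) = 0)
    (hgen : ∀ i : Fin (k + 1), StarQuiver.IsSemisimpleOrbit
      (StarQuiver.StarShape.residueOrbit lam (Fin S.incr.center) i)) :
    ∃ e : (StarQuiver.quiverVariety S.incr.dim lam).Quotient ≃
        (StarQuiver.StarShape.dualReduction lam).Quotient,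
      (∀ f, (StarQuiver.StarShape.dualReduction lam).IsRegular f ↔
        (StarQuiver.quiverVariety S.incr.dim lam).IsRegular (f ∘ e)) ∧
      (∀ f g h, (StarQuiver.StarShape.dualReduction lam).IsPoissonBracket f g h →
        (StarQuiver.quiverVariety S.incr.dim lam).IsPoissonBracket (f ∘ e) (g ∘ e) (h ∘ e)) := by
  have h := hS.flagGeneric_incr hgen
  exact ⟨StarQuiver.StarShape.quotEquiv h, StarQuiver.StarShape.isRegular_comp_quotEquiv h,
    fun _ _ _ => StarQuiver.StarShape.isPoissonBracket_comp_quotEquiv h⟩
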